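/- Let $k$ be an algebraically closed field of characteristic $0$ and $V$ the $k$-vector space with basis $x,y,z$. For $R\subseteq V\otimes V$ put $S=T(V)/(R)$ (graded by tensor degree) and $S^!=T(V^*)/(R^\perp)$. For a central regular element $f\in S_2$, the algebra $A=S/(f)$ is again quadratic, so $A^!$ is defined. Let $f^!$ denote a central regular element of $A^!_2$ with $A^!/(f^!)=S^!$, and put $C(A)=A^![(f^!)^{-1}]_0$, the degree zero part of the localization. Consider $$\begin{aligned}\mathcal S&=k\langle x,y,z\rangle/(xy+yx,\;yz+zy,\;zx+xz),\\ \mathcal S'&=k\langle x,y,z\rangle/(xy+yx,\;yz+zy+x^2,\;zx+xz),\\ \mathcal N&=k\langle x,y,z\rangle/(xy+yx,\;yz+zy+x^2,\;zx+xz+y^2),\end{aligned}$$ the derivation-quotient algebras of $\omega_S=xyz+yzx+zxy+xzy+zyx+yxz$, $\omega_{S'}=\omega_S+x^3$ and $\omega_N=\omega_S+x^3+y^3$ (Types S, S$'$ and NC). **Theorem.** Let $S$ be $\mathcal S$, $\mathcal S'$ or $\mathcal N$. (a) For every central regular $f\in S_2$ there is a pair $(S,g)$ in the table below and a graded algebra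 automorphism $\varphi$ of $S$ with $\varphi(f)=g$. For $A=S/(f)$ and $B=S/(g)$, an element $f^!$ exists, $A^!\cong B^!$ as graded algebras, and $C(A)\cong C(B)$ as algebras for all choices of $f^!$ and $g^!$. (b) For each pair $(S,f)$ in the table, with $A=S/(f)$, the algebra $A^!$ is the one listed (the generators $x,y,z$ of the listed algebra correspond to $x^*,y^*,z^*$). An element $f^!$ exists and, for every choice of it, $C(A)$ is isomorphic to the algebra listed. Here $\alpha,\beta\in k$. | $(S,f)$ | $A^!$ | condition | $C(A)$ | |---|---|---|---| | $(\mathcal S,x^2)$ | $k[x,y,z]/(y^2,z^2)$ | | $k[u,v]/(u^2,v^2)$ | | $(\mathcal S,x^2+y^2)$ | $k[x,y,z]/(x^2-y^2,z^2)$ | | $k[u]/(u^2)\times k[u]/(u^2)$ | | $(\mathcal S,x^2+y^2+z^2)$ | $k[x,y,z]/(x^2-y^2,x^2-z^2)$ | | $k^4$ | | $(\mathcal S',x^2)$ | $k[x,y,z]/(y^2,z^2)$ | | $k[u,v]/(u^2,v^2)$ | | $(\mathcal S',y^2)$ | $k[x,y,z]/(x^2-yz,z^2)$ | | $k[u]/(u^4)$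 | | $(\mathcal S',x^2+y^2)$ | $k[x,y,z]/(x^2-yz-y^2,z^2)$ | | $k[u]/(u^2)\times k[u]/(u^2)$ | | $(\mathcal S',\alpha x^2+y^2+z^2)$ | $k[x,y,z]/(y^2-z^2,x^2-yz-\alpha y^2)$ | $\alpha=\pm1$ | $k[u]/(u^2)\times k^2$ | | | | $\alpha\ne\pm1$ | $k^4$ | | $(\mathcal N,\alpha x^2+y^2)$ | $k[x,y,z]/(x^2-yz-\alpha(y^2-xz),z^2)$ | $\alpha=0$ | $k[u]/(u^4)$ | | | | $\alpha\neq0$ | $k[u]/(u^2)\times k[u]/(u^2)$ | | $(\mathcal N,\alpha x^2+\beta y^2+z^2)$ | $k[x,y,z]/(x^2-yz-\alpha z^2,\,y^2-xz-\beta z^2)$ | | $k[u]/(u^4-2\beta u^2-u-\alpha+\beta^2)$ | (c) Let $\Delta_{\alpha,\beta}=-27-256\alpha^3+288\alpha\beta+256\alpha^2\beta^2-256\beta^3$, the discriminant of $u^4-2\beta u^2-u-\alpha+\beta^2$. For $A=\mathcal N/(\alpha x^2+\beta y^2+z^2)$: - $C(A)\cong k^4$ if and only if $\Delta_{\alpha,\beta}\ne0$;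 - $C(A)\cong k[u]/(u^3)\times k$ if and only if $\alpha=\frac34\mu$ and $\beta=\frac34\mu^2$ for some $\mu\in k$ with $\mu^3=1$; - $C(A)\cong k[u]/(u^2)\times k^2$ if and only if $\Delta_{\alpha,\beta}=0$ and there is no such $\mu$. -/

import Mathlib

open scoped TensorProduct

noncomputable section

/-! ### Quadratic algebras and quadratic duals -/

section Quadratic

variable {k V : Type*} [Field k] [AddCommGroup V] [Module k V]

/-- The inclusion of `V ⊗ V` as the degree two part of the tensor algebra `T(V)`. -/
def tensorTwo (k V : Type*) [Field k] [AddCommGroup V] [Module k V] :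
    V ⊗[k] V →ₗ[k] TensorAlgebra k V :=
  LinearMap.mul' k (TensorAlgebra k V) ∘ₗ
    TensorProduct.map (TensorAlgebra.ι k) (TensorAlgebra.ι k)

/-- The relations `r = 0`, for `r` in a subspace `R ⊆ V ⊗ V`. -/
def quadRel (R : Submodule k (V ⊗[k] V)) (a b : TensorAlgebra k V) : Prop :=
  (∃ r ∈ R, a = tensorTwo k V r) ∧ b = 0

/-- The quadratic algebra `T(V)/(R)`, for a subspace `R ⊆ V ⊗ V`. -/
abbrev QuadAlg (R : Submodule k (V ⊗[k] V)) : Type _ := RingQuot (quadRel R)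

/-- The canonical surjection `T(V) → T(V)/(R)`. -/
def quadMk (R : Submodule k (V ⊗[k] V)) : TensorAlgebra k V →ₐ[k] QuadAlg R :=
  RingQuot.mkAlgHom k (quadRel R)

/-- The canonical map `V → T(V)/(R)`. -/
def quadGen (R : Submodule k (V ⊗[k] V)) : V →ₗ[k] QuadAlg R :=
  (quadMk R).toLinearMap ∘ₗ TensorAlgebra.ι k

/-- The canonical map `V ⊗ V → T(V)/(R)`, whose image is the degree two part. -/
def quadTwo (R : Submodule k (V ⊗[k] V)) : V ⊗[k] V →ₗ[k] QuadAlg R :=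
  (quadMk R).toLinearMap ∘ₗ tensorTwo k V

/-- The homogeneous part of degree `n` of `T(V)/(R)`: the span of products of `n` generators. -/
def quadDeg (R : Submodule k (V ⊗[k] V)) (n : ℕ) : Submodule k (QuadAlg R) :=
  (LinearMap.range (quadGen R)) ^ n

theorem quadTwo_eq_zero (R : Submodule k (V ⊗[k] V)) {r : V ⊗[k] V} (hr : r ∈ R) :
    quadTwo R r = 0 := by
  have h := RingQuot.mkAlgHom_rel k (s := quadRel R) (x := tensorTwo k V r) (y := 0)
    ⟨⟨r, hr, rfl⟩, rfl⟩
  simpa [quadTwo, quadMk] using h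

/-- The canonical surjection `T(V)/(R) → T(V)/(R')` for `R ⊆ R'`. -/
def quadMap {R R' : Submodule k (V ⊗[k] V)} (h : R ≤ R') : QuadAlg R →ₐ[k] QuadAlg R' :=
  RingQuot.liftAlgHom k ⟨quadMk R', by
    rintro a b ⟨⟨r, hr, rfl⟩, rfl⟩
    rw [map_zero]
    exact quadTwo_eq_zero R' (h hr)⟩

theorem quadMap_quadMk {R R' : Submodule k (V ⊗[k] V)} (h : R ≤ R') (x : TensorAlgebra k V) :
    quadMap h (quadMk R x) = quadMk R' x :=
  RingQuot.liftAlgHom_mkAlgHom_apply k _ _ x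

/-- The orthogonal complement `R^⊥ ⊆ V* ⊗ V*` of `R ⊆ V ⊗ V`, for the pairing
`(φ ⊗ ψ)(v ⊗ w) = φ(v) ψ(w)`. -/
def orth (R : Submodule k (V ⊗[k] V)) :
    Submodule k (Module.Dual k V ⊗[k] Module.Dual k V) :=
  R.dualAnnihilator.comap (TensorProduct.dualDistrib k V V)

theorem orth_anti {R R' : Submodule k (V ⊗[k] V)} (h : R ≤ R') : orth R' ≤ orth R :=
  Submodule.comap_mono (Submodule.dualAnnihilator_anti h)

/-- The quadratic dual `T(V*)/(R^⊥)` of `T(V)/(R)`. -/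
abbrev QuadDual (R : Submodule k (V ⊗[k] V)) : Type _ := QuadAlg (orth R)

/-- Isomorphisms of graded algebras `T(V)/(R) → T(W)/(Q)`. -/
def IsGradedIso {W : Type*} [AddCommGroup W] [Module k W]
    {R : Submodule k (V ⊗[k] V)} {Q : Submodule k (W ⊗[k] W)}
    (φ : QuadAlg R ≃ₐ[k] QuadAlg Q) : Prop :=
  ∀ n, (quadDeg R n).map φ.toLinearMap = quadDeg Q n

end Quadratic

/-! ### Localization at a central element and its degree zero part -/

section Localization

variable {k B : Type*} [Field k] [Ring B] [Algebra k B]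

/-- The powers of a central element satisfy the Ore condition. -/
abbrev centralOre (w : B) (hw : w ∈ Subring.center B) :
    OreLocalization.OreSet (Submonoid.powers w) :=
  have hc : ∀ (s : Submonoid.powers w) (r : B), (s : B) * r = r * s := by
    rintro ⟨_, n, rfl⟩ r
    exact ((Subring.mem_center_iff.mp (Subring.pow_mem _ hw n)) r).symm
  { ore_right_cancel := fun r₁ r₂ s h => ⟨s, by rw [hc, hc, h]⟩
    oreNum := fun r _ => r
    oreDenom := fun _ s => s
    ore_eq := fun r s => hc s r }

/-- The localization `B[w⁻¹]` of a ring at a central element `w`. -/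
abbrev CentralLoc (w : B) (hw : w ∈ Subring.center B) : Type _ :=
  letI := centralOre w hw
  OreLocalization (Submonoid.powers w) B

/-- The fraction `a / w ^ n` in `B[w⁻¹]`. -/
def centralFrac (w : B) (hw : w ∈ Subring.center B) (a : B) (n : ℕ) : CentralLoc w hw :=
  letI := centralOre w hw
  OreLocalization.oreDiv a (⟨w ^ n, n, rfl⟩ : Submonoid.powers w)

theorem centralFrac_mul (w : B) (hw : w ∈ Subring.center B) (a b : B) (n m : ℕ) :
    centralFrac w hw a n * centralFrac w hw b m = centralFrac w hw (a * b) (n + m) := by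
  let _ := centralOre w hw
  have hc : w ^ m * a = a * w ^ m :=
    ((Subring.mem_center_iff.mp (Subring.pow_mem _ hw m)) a).symm
  have h := OreLocalization.oreDiv_mul_char a b (⟨w ^ n, n, rfl⟩ : Submonoid.powers w)
    (⟨w ^ m, m, rfl⟩ : Submonoid.powers w) a (⟨w ^ m, m, rfl⟩ : Submonoid.powers w) hc
  unfold centralFrac
  rw [h]
  congr 1
  ext
  simp [← pow_add, add_comm]

theorem centralFrac_add (w : B) (hw : w ∈ Subring.center B) (a b : B) (n m : ℕ) :
    centralFrac w hw a n + centralFrac w hw b m =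
      centralFrac w hw (w ^ m * a + w ^ n * b) (n + m) := by
  let _ := centralOre w hw
  have h := OreLocalization.oreDiv_add_char (r := a) (r' := b)
    (⟨w ^ n, n, rfl⟩ : Submonoid.powers w)
    (⟨w ^ m, m, rfl⟩ : Submonoid.powers w) (w ^ n) (⟨w ^ m, m, rfl⟩ : Submonoid.powers w)
    (by simp [← pow_add, add_comm])
  unfold centralFrac
  rw [h]
  congr 1
  ext
  simp [← pow_add, add_comm]

theorem centralFrac_algebraMap (w : B) (hw : w ∈ Subring.center B) (c : k) :
    algebraMap k (CentralLoc w hw) c = centralFrac w hw (algebraMap k B c) 0 := by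
  let _ := centralOre w hw
  unfold centralFrac
  have : (⟨w ^ 0, 0, rfl⟩ : Submonoid.powers w) = 1 := by ext; simp
  rw [this]
  rfl

/-- Suppose that `B` is generated by its degree one part `P`, so that `P ^ n` is the degree `n`
part, and that `w` is central of degree two. Then `B[w⁻¹]` is `ℤ`-graded, and this is its degree
zero part: the fractions `a / w ^ n` with `a` of degree `2 n`. -/
def degZeroLoc (P : Submodule k B) (w : B) (hw : w ∈ Subring.center B) (hP : w ∈ P ^ 2) :
    Subalgebra k (CentralLoc w hw) where
  carrier := {x | ∃ n : ℕ, ∃ a ∈ P ^ (2 * n), x = centralFrac w hw a n}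
  mul_mem' := by
    rintro _ _ ⟨n, a, ha, rfl⟩ ⟨m, b, hb, rfl⟩
    refine ⟨n + m, a * b, ?_, centralFrac_mul w hw a b n m⟩
    rw [mul_add, pow_add]
    exact Submodule.mul_mem_mul ha hb
  add_mem' := by
    rintro _ _ ⟨n, a, ha, rfl⟩ ⟨m, b, hb, rfl⟩
    refine ⟨n + m, _, ?_, centralFrac_add w hw a b n m⟩
    have hpow : ∀ j : ℕ, w ^ j ∈ P ^ (2 * j) := fun j => by
      rw [pow_mul]; exact Submodule.pow_mem_pow _ hP j
    refine add_mem ?_ ?_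
    · rw [add_comm n m, mul_add, pow_add]; exact Submodule.mul_mem_mul (hpow m) ha
    · rw [mul_add, pow_add]; exact Submodule.mul_mem_mul (hpow n) hb
  algebraMap_mem' := fun c =>
    ⟨0, algebraMap k B c, by simp [Submodule.mem_one], centralFrac_algebraMap w hw c⟩

end Localization

/-! ### The algebra `C(A)` of a quotient `A = S/(f)` of a quadratic algebra `S = T(V)/(R)`

An element of `S` of degree two is given by a representative `f ∈ V ⊗ V`. -/

section Conic

variable {k V : Type*} [Field k] [AddCommGroup V] [Module k V]

/-- The class of `f` is a central regular element of `S = T(V)/(R)`. -/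
def IsCentralRegular (R : Submodule k (V ⊗[k] V)) (f : V ⊗[k] V) : Prop :=
  quadTwo R f ∈ Subring.center (QuadAlg R) ∧ IsRegular (quadTwo R f)

/-- The relations of the quadratic algebra `A = S/(f) = T(V)/(R + k f)`. -/
def conicRel (R : Submodule k (V ⊗[k] V)) (f : V ⊗[k] V) : Submodule k (V ⊗[k] V) :=
  R ⊔ Submodule.span k {f}

theorem le_conicRel (R : Submodule k (V ⊗[k] V)) (f : V ⊗[k] V) : R ≤ conicRel R f :=
  le_sup_left

/-- The quotient `S/(f)` is indeed the quadratic algebra with relations `R + k f`. -/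
def conicEquiv (R : Submodule k (V ⊗[k] V)) (f : V ⊗[k] V) :
    RingQuot (fun a b : QuadAlg R => a = quadTwo R f ∧ b = 0) ≃ₐ[k] QuadAlg (conicRel R f) :=
  AlgEquiv.ofAlgHom
    (RingQuot.liftAlgHom k ⟨quadMap (le_conicRel R f), by
      rintro _ _ ⟨rfl, rfl⟩
      rw [map_zero]
      have h : quadMap (le_conicRel R f) (quadTwo R f) = quadTwo (conicRel R f) f :=
        quadMap_quadMk (le_conicRel R f) (tensorTwo k V f)
      rw [h]
      exact quadTwo_eq_zero _ (Submodule.mem_sup_right (Submodule.mem_span_singleton_self f))⟩)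
    (RingQuot.liftAlgHom k ⟨(RingQuot.mkAlgHom k
        (fun a b : QuadAlg R => a = quadTwo R f ∧ b = 0)).comp (quadMk R), by
      rintro _ _ ⟨⟨r, hr, rfl⟩, rfl⟩
      rw [map_zero]
      obtain ⟨s, hs, t, ht, rfl⟩ := Submodule.mem_sup.mp hr
      obtain ⟨c, rfl⟩ := Submodule.mem_span_singleton.mp ht
      have h0 : quadMk R (tensorTwo k V s) = 0 := quadTwo_eq_zero R hs
      have h1 := RingQuot.mkAlgHom_rel k
        (s := fun a b : QuadAlg R => a = quadTwo R f ∧ b = 0) (x := quadTwo R f) (y := 0)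
        ⟨rfl, rfl⟩
      rw [map_zero] at h1
      have h2 : quadMk R (tensorTwo k V f) = quadTwo R f := rfl
      rw [AlgHom.comp_apply, map_add, map_add, h0, map_smul, map_smul, h2, zero_add, map_smul,
        h1, smul_zero]⟩)
    (by
      ext x
      simp [quadMap, quadMk])
    (by
      ext x
      simp [quadMap, quadMk])

/-- The canonical surjection `A^! → S^!`. -/
def dualProj (R : Submodule k (V ⊗[k] V)) (f : V ⊗[k] V) :
    QuadDual (conicRel R f) →ₐ[k] QuadDual R :=
  quadMap (orth_anti (le_conicRel R f))

/-- `w` is an element `f^!`: a central regular element of degree two of `A^!` such that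
`A^!/(f^!) = S^!`. -/
structure IsDualElement (R : Submodule k (V ⊗[k] V)) (f : V ⊗[k] V)
    (w : QuadDual (conicRel R f)) : Prop where
  deg_two : w ∈ quadDeg (orth (conicRel R f)) 2
  central : w ∈ Subring.center (QuadDual (conicRel R f))
  regular : IsRegular w
  ker_eq : RingHom.ker (dualProj R f) = Ideal.span {w}

/-- The algebra `C(A) = A^![(f^!)⁻¹]₀`, with `w = f^!`. -/
abbrev CAlg (R : Submodule k (V ⊗[k] V)) (f : V ⊗[k] V) (w : QuadDual (conicRel R f))
    (h : IsDualElement R f w) : Type _ :=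
  degZeroLoc (LinearMap.range (quadGen (orth (conicRel R f)))) w h.central h.deg_two

/-- `f^!` exists, and `C(A) ≅ B` for every choice of it. -/
def CAlgIs (R : Submodule k (V ⊗[k] V)) (f : V ⊗[k] V) (B : Type*) [Ring B] [Algebra k B] :
    Prop :=
  (∃ w, IsDualElement R f w) ∧
    ∀ (w : QuadDual (conicRel R f)) (h : IsDualElement R f w), Nonempty (CAlg R f w h ≃ₐ[k] B)

/-- The pairs `(S, f)` and `(S', f')` are isomorphic: there is an isomorphism of graded algebras
`S → S'` that maps `f` to `f'`. -/
def PairIso (R R' : Submodule k (V ⊗[k] V)) (f f' : V ⊗[k] V) : Prop :=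
  ∃ φ : QuadAlg R ≃ₐ[k] QuadAlg R', IsGradedIso φ ∧ φ (quadTwo R f) = quadTwo R' f'

/-- The pairs `(S, f)` and `(S', f')` are isomorphic, and for `A = S/(f)`, `A' = S'/(f')` there
are isomorphisms `A^! ≅ A'^!` of graded algebras and `C(A) ≅ C(A')` of algebras. -/
def SameConic (R R' : Submodule k (V ⊗[k] V)) (f f' : V ⊗[k] V) : Prop :=
  PairIso R R' f f' ∧
    (∃ ψ : QuadDual (conicRel R f) ≃ₐ[k] QuadDual (conicRel R' f'), IsGradedIso ψ) ∧
    (∃ w, IsDualElement R f w) ∧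
    ∀ (w : QuadDual (conicRel R f)) (h : IsDualElement R f w)
      (w' : QuadDual (conicRel R' f')) (h' : IsDualElement R' f' w'),
      Nonempty (CAlg R f w h ≃ₐ[k] CAlg R' f' w' h')

end Conic

/-! ### The superpotentials, with `V = k³` and its standard basis `x, y, z` -/

section Types

variable (k : Type*) [Field k]

/-- The basis vector `x`, `y` or `z` of `V`, for `i = 0, 1, 2`. -/
def bas (i : Fin 3) : Fin 3 → k := Pi.single i 1

/-- The monomial `x_i x_j x_l` in `V ⊗ V ⊗ V`. -/
def mono3 (i j l : Fin 3) : (Fin 3 → k) ⊗[k] ((Fin 3 → k) ⊗[k] (Fin 3 → k)) :=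
  bas k i ⊗ₜ[k] (bas k j ⊗ₜ[k] bas k l)

variable {k} in
/-- The derivative `∂_{x_i} ω ∈ V ⊗ V`, that is `ω_i` where `ω = ∑ i, x_i ⊗ ω_i`. -/
def pderivPot (i : Fin 3) :
    (Fin 3 → k) ⊗[k] ((Fin 3 → k) ⊗[k] (Fin 3 → k)) →ₗ[k] (Fin 3 → k) ⊗[k] (Fin 3 → k) :=
  (TensorProduct.lid k _).toLinearMap ∘ₗ LinearMap.rTensor _ (LinearMap.proj i)

variable {k} in
/-- The relations of the derivation-quotient algebra `D(ω)`. -/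
def derivRel (ω : (Fin 3 → k) ⊗[k] ((Fin 3 → k) ⊗[k] (Fin 3 → k))) :
    Submodule k ((Fin 3 → k) ⊗[k] (Fin 3 → k)) :=
  Submodule.span k (Set.range fun i => pderivPot i ω)

/-- The superpotential of Type S. -/
def potS : (Fin 3 → k) ⊗[k] ((Fin 3 → k) ⊗[k] (Fin 3 → k)) :=
  mono3 k 0 1 2 + mono3 k 1 2 0 + mono3 k 2 0 1 + mono3 k 0 2 1 + mono3 k 2 1 0 + mono3 k 1 0 2

/-- The superpotential of Type S'. -/
def potS' : (Fin 3 → k) ⊗[k] ((Fin 3 → k) ⊗[k] (Fin 3 → k)) := potS k + mono3 k 0 0 0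

/-- The superpotential of Type NC. -/
def potN : (Fin 3 → k) ⊗[k] ((Fin 3 → k) ⊗[k] (Fin 3 → k)) :=
  potS k + mono3 k 0 0 0 + mono3 k 1 1 1

/-- The relations of the algebra `𝒮 = D(ω_S)`. -/
def relS : Submodule k ((Fin 3 → k) ⊗[k] (Fin 3 → k)) := derivRel (potS k)

/-- The relations of the algebra `𝒮' = D(ω_{S'})`. -/
def relS' : Submodule k ((Fin 3 → k) ⊗[k] (Fin 3 → k)) := derivRel (potS' k)

/-- The relations of the algebra `𝒩 = D(ω_N)`. -/
def relN : Submodule k ((Fin 3 → k) ⊗[k] (Fin 3 → k)) := derivRel (potN k)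

variable {k} in
/-- The element `a x² + b y² + c z²`. -/
def diagForm (a b c : k) : (Fin 3 → k) ⊗[k] (Fin 3 → k) :=
  a • (bas k 0 ⊗ₜ[k] bas k 0) + b • (bas k 1 ⊗ₜ[k] bas k 1) + c • (bas k 2 ⊗ₜ[k] bas k 2)

variable {k} in
/-- For `A = S/(f)`: `A^! ≅ k[x, y, z]/(J)`, by an isomorphism that maps the generators
`x*, y*, z*` of `A^!` to the classes of `x, y, z`. -/
def DualIs (R : Submodule k ((Fin 3 → k) ⊗[k] (Fin 3 → k))) (f : (Fin 3 → k) ⊗[k] (Fin 3 → k))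
    (J : Set (MvPolynomial (Fin 3) k)) : Prop :=
  ∃ e : QuadDual (conicRel R f) ≃ₐ[k] (MvPolynomial (Fin 3) k ⧸ Ideal.span J),
    ∀ i : Fin 3, e (quadGen (orth (conicRel R f)) (LinearMap.proj i)) =
      Ideal.Quotient.mk (Ideal.span J) (MvPolynomial.X i)

/-- The truncated polynomial algebra `k[u]/(uⁿ)`. -/
abbrev Trunc1 (n : ℕ) : Type _ := Polynomial k ⧸ Ideal.span {(Polynomial.X : Polynomial k) ^ n}

/-- The algebra `k[u, v]/(u², v²)`. -/
abbrev Trunc2 : Type _ := MvPolynomial (Fin 2) k ⧸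
  Ideal.span {(MvPolynomial.X 0 : MvPolynomial (Fin 2) k) ^ 2, MvPolynomial.X 1 ^ 2}

variable {k} in
/-- The quartic `u⁴ - 2 β u² - u - α + β²`. -/
def quartic (α β : k) : Polynomial k :=
  Polynomial.X ^ 4 - Polynomial.C (2 * β) * Polynomial.X ^ 2 - Polynomial.X
    - Polynomial.C α + Polynomial.C (β ^ 2)

variable {k} in
/-- The discriminant of the quartic `u⁴ - 2 β u² - u - α + β²`. -/
def discN (α β : k) : k :=
  -27 - 256 * α ^ 3 + 288 * α * β + 256 * α ^ 2 * β ^ 2 - 256 * β ^ 3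

end Types

end

/-!
All three algebras `S` belong to the family `relE ε ε'` of relations
`xy + yx`, `yz + zy + ε x²`, `zx + xz + ε' y²`.

*Central elements.* A homomorphism from `S` to `M₂(k)` shows that a central element of degree two is
a combination `a x² + b y² + c z²`, and it is nonzero if it is regular
(`exists_diagForm_of_isCentralRegular`). Rescaling the variables, together with the swaps `x ↔ y`
and `y ↔ z` where they are automorphisms, brings it into the normal form of the table
(`areConjugate_normalForm_S`, `areConjugate_normalForm_S'`, `areConjugate_normalForm_N`). A linear
automorphism acts on every object in sight, which gives `SameConic` (`IsPairMap.sameConic`).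

*The dual algebra.* For `f = a x² + b y² + c z²`, the algebra `A^!` is commutative, and it contains
an element `w` of degree two with `x² - ε yz = a w`, `y² - ε' xz = b w` and `z² = c w`. These are
all the relations, `w` generates the kernel of `A^! → S^!`, and every candidate for `f^!` is a
multiple of `w`. Eliminating `w` gives the presentations of the table (`dualIs_of_relations`).

*The algebra `C(A)`.* The three relations, with `w` as a fourth variable, say that `A^!` is the
homogeneous coordinate ring of an intersection of two conics, that is, of a scheme of length four,
and `C(A)` is the coordinate ring of this scheme. Instead of projective geometry, the proof uses
dimensions: a point of the intersection with values in an algebra `C` of dimension four, one of its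
coordinates being `1`, is a homomorphism `θ : A^! → C`. Suppose that `1`, the two other coordinates
and their product span `C`. As `A^!_2` has dimension at most four and maps onto `C`, the map `θ` is
injective in degree two, and multiplication by the variable that is sent to `1` propagates this to
higher degrees (`eq_zero_of_mem_pow_of_map_eq_zero`). Hence `w`, which maps to a unit, is regular,
and `θ` identifies `C(A)` with `C` (`cAlgIs_of_point`). It remains to write down a generic point for
each row of the table. For `z² = w` and `ε = ε' = 1` it is `(u² - β : u : 1)`, where `u` is a root of the
quartic.

*The quartic.* Since its coefficient of `u` is not zero, its roots are distinct, or one of them is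
double, or one is triple (`quartic_root_types`). Vieta's formulas express the discriminant and the
case of a triple root (`discN_eq_prod_sq`, `quartic_triple_iff`), and nilpotent elements tell the
three algebras apart.
-/

/-! ### Quadratic algebras: universal property, degree two part and grading -/

noncomputable section QuadraticAlgebras

universe u

variable {k V W : Type*} [Field k] [AddCommGroup V] [Module k V] [AddCommGroup W] [Module k W]

theorem tensorTwo_tmul (v w : V) :
    tensorTwo k V (v ⊗ₜ w) = TensorAlgebra.ι k v * TensorAlgebra.ι k w := rfl

/-- The linear map `V ⊗ V → D`, `v ⊗ w ↦ g v * g w`, attached to a linear map `g : V → D` into an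
algebra. -/
def quadEval {D : Type*} [Semiring D] [Algebra k D] (g : V →ₗ[k] D) : V ⊗[k] V →ₗ[k] D :=
  LinearMap.mul' k D ∘ₗ TensorProduct.map g g

@[simp] theorem quadEval_tmul {D : Type*} [Semiring D] [Algebra k D] (g : V →ₗ[k] D) (v w : V) :
    quadEval g (v ⊗ₜ w) = g v * g w := rfl

theorem lift_tensorTwo {D : Type*} [Semiring D] [Algebra k D] (g : V →ₗ[k] D) (r : V ⊗[k] V) :
    TensorAlgebra.lift k g (tensorTwo k V r) = quadEval g r := by
  induction r with
  | zero => simp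
  | tmul v w => simp [tensorTwo_tmul]
  | add a b ha hb => simp [ha, hb]

theorem quadTwo_eq_quadEval (R : Submodule k (V ⊗[k] V)) (r : V ⊗[k] V) :
    quadTwo R r = quadEval (quadGen R) r := by
  induction r with
  | zero => simp
  | tmul v w => simp [tensorTwo_tmul, quadTwo, quadGen]
  | add a b ha hb => simp [ha, hb]

/-- The universal property of `T(V)/(R)`. -/
def quadLift {D : Type*} [Semiring D] [Algebra k D] (R : Submodule k (V ⊗[k] V)) (g : V →ₗ[k] D)
    (h : ∀ r ∈ R, quadEval g r = 0) : QuadAlg R →ₐ[k] D :=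
  RingQuot.liftAlgHom k ⟨TensorAlgebra.lift k g, by
    rintro a b ⟨⟨r, hr, rfl⟩, rfl⟩
    rw [map_zero, lift_tensorTwo, h r hr]⟩

@[simp] theorem quadLift_quadGen {D : Type*} [Semiring D] [Algebra k D]
    (R : Submodule k (V ⊗[k] V)) (g : V →ₗ[k] D) (h : ∀ r ∈ R, quadEval g r = 0) (v : V) :
    quadLift R g h (quadGen R v) = g v := by
  simp [quadLift, quadGen, quadMk]

theorem quadAlg_hom_ext {D : Type*} [Semiring D] [Algebra k D] {R : Submodule k (V ⊗[k] V)}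
    {φ ψ : QuadAlg R →ₐ[k] D} (h : ∀ v, φ (quadGen R v) = ψ (quadGen R v)) : φ = ψ := by
  apply RingQuot.ringQuot_ext'
  ext v
  exact h v

theorem map_quadEval {D E : Type*} [Semiring D] [Algebra k D] [Semiring E] [Algebra k E]
    (φ : D →ₐ[k] E) (g : V →ₗ[k] D) (r : V ⊗[k] V) :
    φ (quadEval g r) = quadEval (φ.toLinearMap ∘ₗ g) r := by
  induction r with
  | zero => simp
  | tmul v w => simp
  | add a b ha hb => simp [ha, hb]

theorem quadLift_quadTwo {D : Type*} [Semiring D] [Algebra k D] (R : Submodule k (V ⊗[k] V))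
    (g : V →ₗ[k] D) (h : ∀ r ∈ R, quadEval g r = 0) (r : V ⊗[k] V) :
    quadLift R g h (quadTwo R r) = quadEval g r := by
  rw [quadTwo_eq_quadEval, map_quadEval]
  congr 1
  ext v
  simp

theorem quadMap_quadGen {R R' : Submodule k (V ⊗[k] V)} (h : R ≤ R') (v : V) :
    quadMap h (quadGen R v) = quadGen R' v :=
  quadMap_quadMk h _

theorem quadMap_quadTwo {R R' : Submodule k (V ⊗[k] V)} (h : R ≤ R') (r : V ⊗[k] V) :
    quadMap h (quadTwo R r) = quadTwo R' r :=
  quadMap_quadMk h _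

theorem quadDeg_two_eq_range (R : Submodule k (V ⊗[k] V)) :
    quadDeg R 2 = LinearMap.range (quadTwo R) := by
  apply le_antisymm
  · rw [quadDeg, pow_two, Submodule.mul_le]
    rintro _ ⟨v, rfl⟩ _ ⟨w, rfl⟩
    exact ⟨v ⊗ₜ w, by rw [quadTwo_eq_quadEval]; rfl⟩
  · rintro _ ⟨r, rfl⟩
    rw [quadTwo_eq_quadEval]
    induction r with
    | zero => simp
    | tmul v w =>
      rw [quadDeg, pow_two]
      exact Submodule.mul_mem_mul ⟨v, rfl⟩ ⟨w, rfl⟩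
    | add a b ha hb => rw [map_add]; exact add_mem ha hb

/-- The action of `v : V` on `k ⊕ V ⊕ (V ⊗ V)/R` by left multiplication, the last summand being
sent to zero. It is the regular representation of `T(V)/(R)` truncated above degree two. -/
def truncRep (R : Submodule k (V ⊗[k] V)) :
    V →ₗ[k] Module.End k (k × V × ((V ⊗[k] V) ⧸ R)) :=
  LinearMap.mk₂ k (fun v p => (0, p.1 • v, R.mkQ (v ⊗ₜ p.2.1)))
    (by intros; simp [TensorProduct.add_tmul]) (by
      intros; ext <;> simp [← TensorProduct.smul_tmul', smul_smul, mul_comm])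
    (by intros; simp [TensorProduct.tmul_add, add_smul])
    (by intros; ext <;> simp [TensorProduct.tmul_smul, smul_smul])

theorem truncRep_apply (R : Submodule k (V ⊗[k] V)) (v : V) (p : k × V × ((V ⊗[k] V) ⧸ R)) :
    truncRep R v p = (0, p.1 • v, R.mkQ (v ⊗ₜ p.2.1)) := rfl

theorem quadEval_truncRep (R : Submodule k (V ⊗[k] V)) (r : V ⊗[k] V)
    (p : k × V × ((V ⊗[k] V) ⧸ R)) :
    quadEval (truncRep R) r p = (0, 0, p.1 • R.mkQ r) := by
  induction r with
  | zero => simp; rfl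
  | tmul v w => simp [truncRep_apply]
  | add a b ha hb => simp [ha, hb]

/-- The degree two part of `T(V)/(R)` is `(V ⊗ V)/R`. -/
theorem quadTwo_eq_zero_iff (R : Submodule k (V ⊗[k] V)) (r : V ⊗[k] V) :
    quadTwo R r = 0 ↔ r ∈ R := by
  refine ⟨fun h => ?_, quadTwo_eq_zero R⟩
  have hR : ∀ s ∈ R, quadEval (truncRep R) s = 0 := by
    intro s hs
    refine LinearMap.ext fun p => ?_
    have h0 : R.mkQ s = 0 := by simpa using hs
    rw [quadEval_truncRep, h0]
    simp
  have h1 := congrArg (quadLift R (truncRep R) hR) h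
  rw [quadLift_quadTwo, map_zero] at h1
  have h2 := LinearMap.congr_fun h1 (1, 0, 0)
  rw [quadEval_truncRep] at h2
  simpa using h2

/-- The homomorphism `T(V)/(R) → (T(V)/(R))[X]` that sends `v : V` to `v X`, and so an element `b`
of degree `n` to `b X ^ n`. It separates the homogeneous components. -/
def quadRees (R : Submodule k (V ⊗[k] V)) : QuadAlg R →ₐ[k] Polynomial (QuadAlg R) :=
  quadLift R (((Polynomial.monomial 1 : QuadAlg R →ₗ[QuadAlg R] _).restrictScalars k) ∘ₗ quadGen R)
    (by
      have key : ∀ r, quadEval (((Polynomial.monomial 1 :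
          QuadAlg R →ₗ[QuadAlg R] _).restrictScalars k) ∘ₗ quadGen R) r =
          Polynomial.monomial 2 (quadTwo R r) := by
        intro r
        rw [quadTwo_eq_quadEval]
        induction r with
        | zero => simp
        | tmul v w => simp [Polynomial.monomial_mul_monomial]
        | add a b ha hb => simp [ha, hb]
      intro r hr
      rw [key, quadTwo_eq_zero R hr, map_zero])

theorem quadRees_of_mem (R : Submodule k (V ⊗[k] V)) {n : ℕ} {b : QuadAlg R}
    (hb : b ∈ quadDeg R n) : quadRees R b = Polynomial.monomial n b := by
  induction n generalizing b with
  | zero =>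
    rw [quadDeg, pow_zero, Submodule.mem_one] at hb
    obtain ⟨c, rfl⟩ := hb
    rw [AlgHom.commutes, Polynomial.algebraMap_apply, Polynomial.monomial_zero_left]
  | succ n ih =>
    rw [quadDeg, pow_succ'] at hb
    induction hb using Submodule.mul_induction_on' with
    | mem_mul_mem a ha c hc =>
      obtain ⟨v, rfl⟩ := ha
      rw [map_mul, ih hc, quadRees, quadLift_quadGen]
      simp [Polynomial.monomial_mul_monomial, add_comm]
    | add a _ c _ ha hc => rw [map_add, ha, hc, map_add]

theorem quadMk_mem_quadDeg (R : Submodule k (V ⊗[k] V)) {n : ℕ} {x : TensorAlgebra k V}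
    (hx : x ∈ LinearMap.range (TensorAlgebra.ι k : V →ₗ[k] _) ^ n) : quadMk R x ∈ quadDeg R n := by
  have h := Submodule.mem_map_of_mem (f := (quadMk R).toLinearMap) hx
  rw [Submodule.map_pow, ← LinearMap.range_comp] at h
  exact h

/-- Every element of `T(V)/(R)` is a sum of homogeneous elements. -/
theorem exists_sum_quadDeg (R : Submodule k (V ⊗[k] V)) (b : QuadAlg R) :
    ∃ (s : Finset ℕ) (c : ℕ → QuadAlg R), (∀ n, c n ∈ quadDeg R n) ∧ b = ∑ n ∈ s, c n := by
  classical
  obtain ⟨x, rfl⟩ := RingQuot.mkAlgHom_surjective k (quadRel R) b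
  let 𝒜 : ℕ → Submodule k (TensorAlgebra k V) :=
    fun n => LinearMap.range (TensorAlgebra.ι k : V →ₗ[k] _) ^ n
  have h := DirectSum.sum_support_decompose 𝒜 x
  refine ⟨(DirectSum.decompose 𝒜 x).support, fun n => quadMk R (DirectSum.decompose 𝒜 x n),
    fun n => quadMk_mem_quadDeg R (DirectSum.decompose 𝒜 x n).2, ?_⟩
  rw [← map_sum, h]
  rfl

/-- A homogeneous element is left regular as soon as it is so on homogeneous elements. -/
theorem eq_zero_of_mul_eq_zero_of_homogeneous (R : Submodule k (V ⊗[k] V)) {m : ℕ} {w : QuadAlg R}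
    (hw : w ∈ quadDeg R m) (hreg : ∀ n, ∀ b ∈ quadDeg R n, w * b = 0 → b = 0)
    {b : QuadAlg R} (hb : w * b = 0) : b = 0 := by
  classical
  obtain ⟨s, c, hc, rfl⟩ := exists_sum_quadDeg R b
  have h := congrArg (quadRees R) hb
  rw [map_mul, map_sum, quadRees_of_mem R hw, map_zero, Finset.mul_sum] at h
  refine Finset.sum_eq_zero fun n hn => hreg n _ (hc n) ?_
  have h2 := congrArg (fun q => Polynomial.coeff q (m + n)) h
  simp only [quadRees_of_mem R (hc _), Polynomial.monomial_mul_monomial,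
    Polynomial.finsetSum_coeff, Polynomial.coeff_monomial, Polynomial.coeff_zero] at h2
  simpa [hn] using h2

/-! ### Functoriality in the generating space -/

theorem quadEval_comp {D : Type*} [Semiring D] [Algebra k D] (g : W →ₗ[k] D) (T : V →ₗ[k] W)
    (r : V ⊗[k] V) : quadEval (g ∘ₗ T) r = quadEval g (TensorProduct.map T T r) := by
  induction r with
  | zero => simp
  | tmul v w => simp
  | add a b ha hb => simp [ha, hb]

theorem quadTwo_map_eq_zero {R : Submodule k (V ⊗[k] V)} {Q : Submodule k (W ⊗[k] W)}
    {T : V →ₗ[k] W} (h : ∀ r ∈ R, TensorProduct.map T T r ∈ Q) (r : V ⊗[k] V) (hr : r ∈ R) :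
    quadEval (quadGen Q ∘ₗ T) r = 0 := by
  rw [quadEval_comp, ← quadTwo_eq_quadEval, quadTwo_eq_zero Q (h r hr)]

/-- The isomorphism `T(V)/(R) → T(W)/(Q)` induced by a linear isomorphism `T : V → W` for which
`T ⊗ T` maps `R` onto `Q`. -/
def quadCongr {R : Submodule k (V ⊗[k] V)} {Q : Submodule k (W ⊗[k] W)} (T : V ≃ₗ[k] W)
    (h : ∀ r, TensorProduct.congr T T r ∈ Q ↔ r ∈ R) : QuadAlg R ≃ₐ[k] QuadAlg Q :=
  AlgEquiv.ofAlgHom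
    (quadLift R (quadGen Q ∘ₗ T.toLinearMap)
      (quadTwo_map_eq_zero fun r hr => (h r).mpr hr))
    (quadLift Q (quadGen R ∘ₗ T.symm.toLinearMap)
      (quadTwo_map_eq_zero fun r hr => by
        rw [← h]
        change TensorProduct.congr T T ((TensorProduct.congr T T).symm r) ∈ Q
        rwa [LinearEquiv.apply_symm_apply]))
    (quadAlg_hom_ext fun v => by simp)
    (quadAlg_hom_ext fun v => by simp)

@[simp] theorem quadCongr_quadGen {R : Submodule k (V ⊗[k] V)} {Q : Submodule k (W ⊗[k] W)}
    (T : V ≃ₗ[k] W) (h : ∀ r, TensorProduct.congr T T r ∈ Q ↔ r ∈ R) (v : V) :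
    quadCongr T h (quadGen R v) = quadGen Q (T v) :=
  quadLift_quadGen _ _ _ _

theorem quadCongr_quadTwo {R : Submodule k (V ⊗[k] V)} {Q : Submodule k (W ⊗[k] W)}
    (T : V ≃ₗ[k] W) (h : ∀ r, TensorProduct.congr T T r ∈ Q ↔ r ∈ R) (r : V ⊗[k] V) :
    quadCongr T h (quadTwo R r) = quadTwo Q (TensorProduct.congr T T r) := by
  have h1 : quadCongr T h (quadTwo R r) = quadEval (quadGen Q ∘ₗ T.toLinearMap) r :=
    quadLift_quadTwo _ _ _ _
  rw [h1, quadEval_comp, quadTwo_eq_quadEval]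
  rfl

theorem quadCongr_isGradedIso {R : Submodule k (V ⊗[k] V)} {Q : Submodule k (W ⊗[k] W)}
    (T : V ≃ₗ[k] W) (h : ∀ r, TensorProduct.congr T T r ∈ Q ↔ r ∈ R) :
    IsGradedIso (quadCongr T h) := by
  have h1 : (LinearMap.range (quadGen R)).map (quadCongr T h : QuadAlg R →ₐ[k] QuadAlg Q).toLinearMap
      = LinearMap.range (quadGen Q) := by
    rw [← LinearMap.range_comp]
    have : (quadCongr T h : QuadAlg R →ₐ[k] QuadAlg Q).toLinearMap ∘ₗ quadGen R
        = quadGen Q ∘ₗ T.toLinearMap := by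
      ext v
      simp
    rw [this, LinearMap.range_comp_of_range_eq_top _ T.range]
  intro n
  have h2 := Submodule.map_pow (LinearMap.range (quadGen R))
    (quadCongr T h : QuadAlg R →ₐ[k] QuadAlg Q) n
  rw [h1] at h2
  exact h2

/-- A commutative model of the quotient by a principal ideal of an algebra whose multiplication is
commutative but which is presented as a mere ring. -/
theorem exists_commRing_quotient {B : Type u} [Ring B] [Algebra k B] (hc : ∀ a b : B, a * b = b * a)
    (w : B) : ∃ (D : Type u) (_ : CommRing D) (_ : Algebra k D) (π : B →ₐ[k] D),
      RingHom.ker π = Ideal.span {w} := by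
  have : (Ideal.span {w}).IsTwoSided := ⟨fun b ha => by
    rw [hc]; exact Ideal.mul_mem_left _ _ ha⟩
  let i : CommRing (B ⧸ Ideal.span {w}) :=
    { (inferInstance : Ring (B ⧸ Ideal.span {w})) with
      mul_comm := fun a b => by
        obtain ⟨a, rfl⟩ := Ideal.Quotient.mk_surjective a
        obtain ⟨b, rfl⟩ := Ideal.Quotient.mk_surjective b
        rw [← map_mul, hc, map_mul] }
  refine ⟨B ⧸ Ideal.span {w}, i, (inferInstance : Algebra k (B ⧸ Ideal.span {w})),
    Ideal.Quotient.mkₐ k (Ideal.span {w}), ?_⟩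
  ext b
  exact Ideal.Quotient.eq_zero_iff_mem

end QuadraticAlgebras

/-! ### The degree zero part of the localization at a central element -/

noncomputable section LocalizationModels

variable {k B E : Type*} [Field k] [Ring B] [Algebra k B] [Ring E] [Algebra k E]

/-- The extension to `B[w⁻¹]` of a homomorphism that maps `w` to a unit. -/
def centralLocLift (w : B) (hw : w ∈ Subring.center B) (θ : B →ₐ[k] E) (hθ : IsUnit (θ w)) :
    CentralLoc w hw →ₐ[k] E :=
  letI := centralOre w hw
  have hu : ∀ s : Submonoid.powers w,
      IsUnit ((θ : B →* E).comp (Submonoid.powers w).subtype s) := by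
    rintro ⟨_, n, rfl⟩
    simpa using hθ.pow n
  { OreLocalization.universalHom (θ : B →+* E)
      (IsUnit.liftRight ((θ : B →* E).comp (Submonoid.powers w).subtype) hu) (fun s => rfl) with
    commutes' := fun c => by
      have h := OreLocalization.universalHom_commutes (θ : B →+* E)
        (IsUnit.liftRight ((θ : B →* E).comp (Submonoid.powers w).subtype) hu) (fun s => rfl)
        (r := algebraMap k B c)
      exact h.trans (θ.commutes c) }

theorem centralLocLift_centralFrac (w : B) (hw : w ∈ Subring.center B) (θ : B →ₐ[k] E)
    (hθ : IsUnit (θ w)) (a : B) (n : ℕ) :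
    θ w ^ n * centralLocLift w hw θ hθ (centralFrac w hw a n) = θ a := by
  let _ := centralOre w hw
  have hu : ∀ s : Submonoid.powers w,
      IsUnit ((θ : B →* E).comp (Submonoid.powers w).subtype s) := by
    rintro ⟨_, n, rfl⟩
    simpa using hθ.pow n
  let f := IsUnit.liftRight ((θ : B →* E).comp (Submonoid.powers w).subtype) hu
  have h1 : centralLocLift w hw θ hθ (centralFrac w hw a n) =
    ((f ⟨w ^ n, n, rfl⟩)⁻¹ : Eˣ) * θ a := rfl
  have h2 : θ w ^ n = ((f ⟨w ^ n, n, rfl⟩ : Eˣ) : E) := (map_pow θ w n).symm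
  rw [h1, h2, Units.mul_inv_cancel_left]

/-- A homomorphism `θ` on `B` that maps `w` to a unit and is injective on each homogeneous
component of even degree identifies the degree zero part of `B[w⁻¹]` with the subalgebra of the
fractions `θ a / θ w ^ n`, for `a` of degree `2 n`. -/
theorem degZeroLoc_equiv_subalgebra (P : Submodule k B) (w : B) (hw : w ∈ Subring.center B)
    (hP : w ∈ P ^ 2) (θ : B →ₐ[k] E) (hθ : IsUnit (θ w))
    (hinj : ∀ n, ∀ a ∈ P ^ (2 * n), θ a = 0 → a = 0) (D : Subalgebra k E)
    (hD : ∀ n, ∀ a ∈ P ^ (2 * n), ∃ d ∈ D, θ w ^ n * d = θ a)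
    (hsurj : ∀ d ∈ D, ∃ n, ∃ a ∈ P ^ (2 * n), θ w ^ n * d = θ a) :
    Nonempty (degZeroLoc P w hw hP ≃ₐ[k] D) := by
  have hmem : ∀ x : degZeroLoc P w hw hP,
      (centralLocLift w hw θ hθ).comp (degZeroLoc P w hw hP).val x ∈ D := by
    rintro ⟨_, n, a, ha, rfl⟩
    obtain ⟨d, hd, h⟩ := hD n a ha
    have h1 := centralLocLift_centralFrac w hw θ hθ a n
    rw [← h] at h1
    exact (hθ.pow n).mul_left_cancel h1 ▸ hd
  refine ⟨AlgEquiv.ofBijective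
    (((centralLocLift w hw θ hθ).comp (degZeroLoc P w hw hP).val).codRestrict D hmem) ⟨?_, ?_⟩⟩
  · rw [injective_iff_map_eq_zero]
    rintro ⟨_, n, a, ha, rfl⟩ hx
    have hx' : centralLocLift w hw θ hθ (centralFrac w hw a n) = 0 := congrArg Subtype.val hx
    have h1 := centralLocLift_centralFrac w hw θ hθ a n
    rw [hx', mul_zero] at h1
    have h0 := hinj n a ha h1.symm
    subst h0
    ext
    let _ := centralOre w hw
    exact OreLocalization.zero_oreDiv _
  · rintro ⟨d, hd⟩
    obtain ⟨n, a, ha, h⟩ := hsurj d hd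
    refine ⟨⟨_, n, a, ha, rfl⟩, Subtype.ext ((hθ.pow n).mul_left_cancel ?_)⟩
    rw [h]
    exact centralLocLift_centralFrac w hw θ hθ a n

theorem degZeroLoc_equiv (P : Submodule k B) (w : B) (hw : w ∈ Subring.center B)
    (hP : w ∈ P ^ 2) (θ : B →ₐ[k] E) (hθ : IsUnit (θ w))
    (hinj : ∀ n, ∀ a ∈ P ^ (2 * n), θ a = 0 → a = 0)
    (hsurj : ∀ c : E, ∃ a ∈ P ^ 2, θ a = c) :
    Nonempty (degZeroLoc P w hw hP ≃ₐ[k] E) := by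
  obtain ⟨e⟩ := degZeroLoc_equiv_subalgebra P w hw hP θ hθ hinj ⊤
    (fun n a _ => by
      obtain ⟨u, hu⟩ := hθ.pow n
      exact ⟨(u⁻¹ : Eˣ) * θ a, trivial, by rw [← hu, Units.mul_inv_cancel_left]⟩)
    (fun d _ => by
      obtain ⟨a, ha, h⟩ := hsurj (θ w * d)
      exact ⟨1, a, ha, by rw [h, pow_one]⟩)
  exact ⟨e.trans Subalgebra.topEquiv⟩

/-- The homomorphism `B → B[w⁻¹]`. -/
def centralLocMap (w : B) (hw : w ∈ Subring.center B) : B →ₐ[k] CentralLoc w hw :=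
  letI := centralOre w hw
  { (OreLocalization.numeratorRingHom : B →+* CentralLoc w hw) with
    commutes' := fun _ => rfl }

theorem centralFrac_zero (w : B) (hw : w ∈ Subring.center B) (a : B) :
    centralFrac w hw a 0 = centralLocMap (k := k) w hw a := by
  let _ := centralOre w hw
  have : (⟨w ^ 0, 0, rfl⟩ : Submonoid.powers w) = 1 := by ext; simp
  unfold centralFrac
  rw [this]
  rfl

theorem centralFrac_self (w : B) (hw : w ∈ Subring.center B) (a : B) (n : ℕ) :
    centralFrac w hw (w ^ n * a) n = centralFrac w hw a 0 := by
  let _ := centralOre w hw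
  have h := OreLocalization.expand' a (1 : Submonoid.powers w) (⟨w ^ n, n, rfl⟩)
  have h1 : (⟨w ^ 0, 0, rfl⟩ : Submonoid.powers w) = 1 := by ext; simp
  unfold centralFrac
  rw [h1, h, mul_one]
  rfl

theorem centralLocMap_pow_mul_centralFrac (w : B) (hw : w ∈ Subring.center B) (a : B) (n : ℕ) :
    centralLocMap (k := k) w hw w ^ n * centralFrac w hw a n = centralLocMap (k := k) w hw a := by
  rw [← map_pow, ← centralFrac_zero (k := k), centralFrac_mul, zero_add, centralFrac_self,
    centralFrac_zero (k := k)]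

theorem centralLocMap_injective (w : B) (hw : w ∈ Subring.center B) (hr : IsRegular w) :
    Function.Injective (centralLocMap (k := k) w hw) := by
  let _ := centralOre w hw
  refine OreLocalization.numeratorHom_inj ?_
  rintro _ ⟨n, rfl⟩ x hx
  exact (hr.pow n).left (by simpa using hx)

theorem degZeroLoc_congr {B' : Type*} [Ring B'] [Algebra k B'] (ψ : B ≃ₐ[k] B')
    {P : Submodule k B} {P' : Submodule k B'} (hPP : ∀ n, (P ^ n).map ψ.toLinearMap = P' ^ n)
    {w : B} {w' : B'} (hww : ψ w = w')
    (hw : w ∈ Subring.center B) (hP : w ∈ P ^ 2) (hw' : w' ∈ Subring.center B')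
    (hP' : w' ∈ P' ^ 2) (hr : IsRegular w') :
    Nonempty (degZeroLoc P w hw hP ≃ₐ[k] degZeroLoc P' w' hw' hP') := by
  subst hww
  let θ : B →ₐ[k] CentralLoc (ψ w) hw' := (centralLocMap (ψ w) hw').comp (ψ : B →ₐ[k] B')
  refine degZeroLoc_equiv_subalgebra P w hw hP θ ?_ ?_ _ ?_ ?_
  · have h1 : centralLocMap (k := k) (ψ w) hw' (ψ w) * centralFrac (ψ w) hw' 1 1 = 1 := by
      simpa using centralLocMap_pow_mul_centralFrac (k := k) (ψ w) hw' 1 1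
    have h2 : centralFrac (ψ w) hw' 1 1 * centralLocMap (k := k) (ψ w) hw' (ψ w) = 1 := by
      rw [← centralFrac_zero (k := k), centralFrac_mul] at h1 ⊢
      simpa using h1
    exact ⟨⟨_, _, h1, h2⟩, rfl⟩
  · intro n a _ h
    exact (map_eq_zero_iff ψ ψ.injective).mp
      ((map_eq_zero_iff _ (centralLocMap_injective (k := k) (ψ w) hw' hr)).mp h)
  · intro n a ha
    refine ⟨centralFrac (ψ w) hw' (ψ a) n, ⟨n, ψ a, ?_, rfl⟩,
      centralLocMap_pow_mul_centralFrac (k := k) _ _ _ _⟩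
    rw [← hPP]
    exact Submodule.mem_map_of_mem ha
  · rintro _ ⟨n, a', ha', rfl⟩
    rw [← hPP] at ha'
    obtain ⟨a, ha, rfl⟩ := ha'
    exact ⟨n, a, ha, centralLocMap_pow_mul_centralFrac (k := k) _ _ _ _⟩

end LocalizationModels

/-! ### Transport along linear isomorphisms -/

section Transport

variable {k V W : Type*} [Field k] [AddCommGroup V] [Module k V] [AddCommGroup W] [Module k W]

/-- The linear isomorphism `T : V → W` maps the relations `R` onto `R'` and, modulo `R'`, the
element `f` to `f'`. -/
structure IsPairMap (R : Submodule k (V ⊗[k] V)) (R' : Submodule k (W ⊗[k] W))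
    (f : V ⊗[k] V) (f' : W ⊗[k] W) (T : V ≃ₗ[k] W) : Prop where
  rel : ∀ r, TensorProduct.congr T T r ∈ R' ↔ r ∈ R
  elt : TensorProduct.congr T T f - f' ∈ R'

theorem conicRel_congr_mem {R : Submodule k (V ⊗[k] V)} {R' : Submodule k (W ⊗[k] W)}
    {f : V ⊗[k] V} {f' : W ⊗[k] W} {T : V ≃ₗ[k] W} (h : IsPairMap R R' f f' T)
    (r : V ⊗[k] V) : TensorProduct.congr T T r ∈ conicRel R' f' ↔ r ∈ conicRel R f := by
  unfold conicRel
  constructor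
  · intro hr
    obtain ⟨s, hs, t, ht, hst⟩ := Submodule.mem_sup.mp hr
    obtain ⟨c, rfl⟩ := Submodule.mem_span_singleton.mp ht
    have h1 : r - c • f ∈ R := by
      rw [← h.rel, map_sub, map_smul, ← hst]
      have : s + c • f' - c • TensorProduct.congr T T f =
        s - c • (TensorProduct.congr T T f - f') := by module
      rw [this]
      exact sub_mem hs (Submodule.smul_mem _ _ h.elt)
    exact Submodule.mem_sup.mpr ⟨_, h1, c • f, Submodule.smul_mem _ _
      (Submodule.mem_span_singleton_self f), by abel⟩
  · intro hr
    obtain ⟨s, hs, t, ht, rfl⟩ := Submodule.mem_sup.mp hr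
    obtain ⟨c, rfl⟩ := Submodule.mem_span_singleton.mp ht
    refine Submodule.mem_sup.mpr ⟨TensorProduct.congr T T s +
      c • (TensorProduct.congr T T f - f'), add_mem ((h.rel s).mpr hs)
      (Submodule.smul_mem _ _ h.elt), c • f', Submodule.smul_mem _ _
      (Submodule.mem_span_singleton_self f'), ?_⟩
    rw [map_add, map_smul]
    module

theorem dualDistrib_dualMap (T : V ≃ₗ[k] W)
    (s : Module.Dual k W ⊗[k] Module.Dual k W) (r : V ⊗[k] V) :
    TensorProduct.dualDistrib k V V (TensorProduct.congr T.dualMap T.dualMap s) r =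
      TensorProduct.dualDistrib k W W s (TensorProduct.congr T T r) := by
  induction s with
  | zero => simp
  | add a b ha hb => simp [ha, hb]
  | tmul φ ψ =>
    induction r with
    | zero => simp
    | add a b ha hb => simp only [map_add, ha, hb]
    | tmul v w => simp [LinearEquiv.dualMap_apply]

/-- If `T ⊗ T` maps `R` onto `R'`, then the transpose of `T` maps `R'^⊥` onto `R^⊥`. -/
theorem orth_congr_mem {R : Submodule k (V ⊗[k] V)} {R' : Submodule k (W ⊗[k] W)} {T : V ≃ₗ[k] W}
    (h : ∀ r, TensorProduct.congr T T r ∈ R' ↔ r ∈ R)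
    (s : Module.Dual k W ⊗[k] Module.Dual k W) :
    TensorProduct.congr T.dualMap T.dualMap s ∈ orth R ↔ s ∈ orth R' := by
  simp only [orth, Submodule.mem_comap, Submodule.mem_dualAnnihilator, dualDistrib_dualMap]
  constructor
  · intro hs r hr
    have := hs ((TensorProduct.congr T T).symm r)
      ((h _).mp (by rwa [LinearEquiv.apply_symm_apply]))
    rwa [LinearEquiv.apply_symm_apply] at this
  · intro hs r hr
    exact hs _ ((h r).mpr hr)

theorem isRegular_map_algEquiv {A B : Type*} [Ring A] [Algebra k A] [Ring B] [Algebra k B]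
    (e : A ≃ₐ[k] B) {a : A} (h : IsRegular a) : IsRegular (e a) := by
  constructor
  · intro x y hxy
    apply e.symm.injective
    apply h.left
    apply e.injective
    simpa using hxy
  · intro x y hxy
    apply e.symm.injective
    apply h.right
    apply e.injective
    simpa using hxy

theorem center_map_algEquiv {A B : Type*} [Ring A] [Algebra k A] [Ring B] [Algebra k B]
    (e : A ≃ₐ[k] B) {a : A} (h : a ∈ Subring.center A) : e a ∈ Subring.center B := by
  rw [Subring.mem_center_iff] at h ⊢
  intro b
  have := congrArg e (h (e.symm b))
  simpa using this

/-- An isomorphism of the quadratic data `(R, f)` and `(R', f')` maps every dual element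
of the second pair to one of the first. -/
theorem isDualElement_congr {R : Submodule k (V ⊗[k] V)} {R' : Submodule k (W ⊗[k] W)}
    {f : V ⊗[k] V} {f' : W ⊗[k] W} {T : V ≃ₗ[k] W} (h : IsPairMap R R' f f' T)
    {w : QuadDual (conicRel R' f')} (hw : IsDualElement R' f' w) :
    IsDualElement R f (quadCongr T.dualMap (orth_congr_mem (conicRel_congr_mem h)) w) := by
  set e := quadCongr T.dualMap (orth_congr_mem (conicRel_congr_mem h)) with he
  let e' := quadCongr T.dualMap (orth_congr_mem h.rel)
  have hcomm : ∀ b, dualProj R f (e b) = e' (dualProj R' f' b) := by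
    have : (dualProj R f).comp (e : _ →ₐ[k] _) =
        (e' : _ →ₐ[k] _).comp (dualProj R' f') := by
      refine quadAlg_hom_ext fun v => ?_
      simp [e, e', dualProj, quadMap_quadGen]
    exact fun b => AlgHom.congr_fun this b
  refine ⟨?_, center_map_algEquiv e hw.central, isRegular_map_algEquiv e hw.regular, ?_⟩
  · rw [← quadCongr_isGradedIso T.dualMap (orth_congr_mem (conicRel_congr_mem h)) 2]
    exact Submodule.mem_map_of_mem hw.deg_two
  · ext b
    obtain ⟨b, rfl⟩ := e.surjective b
    rw [RingHom.mem_ker, hcomm, map_eq_zero_iff e' e'.injective, ← RingHom.mem_ker, hw.ker_eq,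
      Ideal.mem_span_singleton', Ideal.mem_span_singleton']
    constructor
    · rintro ⟨a, rfl⟩
      exact ⟨e a, by rw [map_mul]⟩
    · rintro ⟨a, ha⟩
      refine ⟨e.symm a, e.injective ?_⟩
      rw [map_mul, e.apply_symm_apply, ha]

theorem cAlg_congr {R : Submodule k (V ⊗[k] V)} {R' : Submodule k (W ⊗[k] W)}
    {f : V ⊗[k] V} {f' : W ⊗[k] W} {T : V ≃ₗ[k] W} (h : IsPairMap R R' f f' T)
    {w : QuadDual (conicRel R' f')} (hw : IsDualElement R' f' w) :
    Nonempty (CAlg R' f' w hw ≃ₐ[k] CAlg R f _ (isDualElement_congr h hw)) :=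
  degZeroLoc_congr _ (quadCongr_isGradedIso T.dualMap (orth_congr_mem (conicRel_congr_mem h)))
    rfl _ _ _ _ (isDualElement_congr h hw).regular

theorem IsPairMap.symm {R : Submodule k (V ⊗[k] V)} {R' : Submodule k (W ⊗[k] W)}
    {f : V ⊗[k] V} {f' : W ⊗[k] W} {T : V ≃ₗ[k] W} (h : IsPairMap R R' f f' T) :
    IsPairMap R' R f' f T.symm := by
  have key : ∀ r, TensorProduct.congr T T (TensorProduct.congr T.symm T.symm r) = r :=
    fun r => (TensorProduct.congr T T).apply_symm_apply r
  refine ⟨fun r => ?_, ?_⟩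
  · rw [← h.rel, key]
  · rw [← h.rel, map_sub, key, ← neg_mem_iff, neg_sub]
    exact h.elt

theorem IsPairMap.trans {U : Type*} [AddCommGroup U] [Module k U] {R : Submodule k (V ⊗[k] V)}
    {R' : Submodule k (W ⊗[k] W)} {R'' : Submodule k (U ⊗[k] U)}
    {f : V ⊗[k] V} {f' : W ⊗[k] W} {f'' : U ⊗[k] U} {T : V ≃ₗ[k] W} {T' : W ≃ₗ[k] U}
    (h : IsPairMap R R' f f' T) (h' : IsPairMap R' R'' f' f'' T') :
    IsPairMap R R'' f f'' (T.trans T') := by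
  have key : ∀ r, TensorProduct.congr (T.trans T') (T.trans T') r =
      TensorProduct.congr T' T' (TensorProduct.congr T T r) := by
    intro r
    induction r with
    | zero => simp
    | tmul v w => simp
    | add a b ha hb => simp only [map_add, ha, hb]
  refine ⟨fun r => ?_, ?_⟩
  · rw [key, h'.rel, h.rel]
  · have h1 := add_mem ((h'.rel _).mpr h.elt) h'.elt
    rw [map_sub, sub_add_sub_cancel] at h1
    rwa [key]

/-- An isomorphism of pairs induces isomorphisms of all the attached algebras, provided that
`C(A)` is known for one of them to be independent of the choice of the dual element. -/
theorem IsPairMap.sameConic {R : Submodule k (V ⊗[k] V)} {R' : Submodule k (V ⊗[k] V)}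
    {f f' : V ⊗[k] V} {T : V ≃ₗ[k] V} (h : IsPairMap R R' f f' T)
    {B : Type*} [Ring B] [Algebra k B] (hB : CAlgIs R' f' B) : SameConic R R' f f' := by
  refine ⟨⟨quadCongr T h.rel, quadCongr_isGradedIso T h.rel, ?_⟩,
    ⟨_, quadCongr_isGradedIso _ (orth_congr_mem (conicRel_congr_mem h.symm))⟩, ?_, ?_⟩
  · rw [quadCongr_quadTwo, ← sub_eq_zero, ← map_sub]
    exact quadTwo_eq_zero _ h.elt
  · obtain ⟨w, hw⟩ := hB.1
    exact ⟨_, isDualElement_congr h hw⟩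
  · intro w hw w' hw'
    obtain ⟨e⟩ := cAlg_congr h.symm hw
    obtain ⟨e₁⟩ := hB.2 _ (isDualElement_congr h.symm hw)
    obtain ⟨e₂⟩ := hB.2 _ hw'
    exact ⟨e.trans (e₁.trans e₂.symm)⟩

end Transport

/-! ### The common presentation of the three algebras -/

noncomputable section Family

variable {k : Type*} [Field k]

/-- A subalgebra of `T(V)/(R)` that contains the generators is everything. -/
theorem mem_of_quadGen_mem {V : Type*} [AddCommGroup V] [Module k V] {R : Submodule k (V ⊗[k] V)}
    (S : Subalgebra k (QuadAlg R)) (h : ∀ v, quadGen R v ∈ S) (b : QuadAlg R) : b ∈ S := by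
  have hn : ∀ n, quadDeg R n ≤ Subalgebra.toSubmodule S := by
    intro n
    induction n with
    | zero =>
      rw [quadDeg, pow_zero]
      rintro _ ⟨c, rfl⟩
      exact S.smul_mem S.one_mem c
    | succ n ih =>
      rw [quadDeg, pow_succ', Submodule.mul_le]
      rintro _ ⟨v, rfl⟩ c hc
      exact S.mul_mem (h v) (ih hc)
  obtain ⟨s, c, hc, rfl⟩ := exists_sum_quadDeg R b
  exact S.sum_mem fun n _ => hn n (hc n)

theorem quadAlg_mul_comm {V : Type*} [AddCommGroup V] [Module k V] {R : Submodule k (V ⊗[k] V)}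
    (h : ∀ v w, quadGen R v * quadGen R w = quadGen R w * quadGen R v) (a b : QuadAlg R) :
    a * b = b * a := by
  have h1 : ∀ v b, quadGen R v * b = b * quadGen R v := by
    intro v b
    refine (Subalgebra.mem_centralizer_iff k).mp
      (mem_of_quadGen_mem (Subalgebra.centralizer k {quadGen R v}) ?_ b) _ rfl
    intro w
    rw [Subalgebra.mem_centralizer_iff]
    rintro _ rfl
    exact h v w
  refine (Subalgebra.mem_centralizer_iff k).mp
    (mem_of_quadGen_mem (Subalgebra.centralizer k {a}) ?_ b) _ rfl
  intro w
  rw [Subalgebra.mem_centralizer_iff]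
  rintro _ rfl
  exact (h1 w _).symm

/-- The superpotential `ω_S + ε x³ + ε' y³`; the types S, S' and NC are `(ε, ε') = (0, 0)`, `(1, 0)`
and `(1, 1)`. -/
def potE (ε ε' : k) : (Fin 3 → k) ⊗[k] ((Fin 3 → k) ⊗[k] (Fin 3 → k)) :=
  potS k + ε • mono3 k 0 0 0 + ε' • mono3 k 1 1 1

/-- The relations `yz + zy + ε x²`, `zx + xz + ε' y²` and `xy + yx` of `D(ω_S + ε x³ + ε' y³)`. -/
def relE (ε ε' : k) : Submodule k ((Fin 3 → k) ⊗[k] (Fin 3 → k)) := derivRel (potE ε ε')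

theorem relS_eq : relS k = relE 0 0 := by simp [relS, relE, potE]

theorem relS'_eq : relS' k = relE 1 0 := by simp [relS', relE, potE, potS']

theorem relN_eq : relN k = relE 1 1 := by simp [relN, relE, potE, potN]

theorem pderivPot_mono3 (i a b c : Fin 3) :
    pderivPot i (mono3 k a b c) = (if i = a then (1 : k) else 0) • (bas k b ⊗ₜ[k] bas k c) := by
  simp [pderivPot, mono3, bas, Pi.single_apply]

theorem relE_eq_span (ε ε' : k) : relE ε ε' = Submodule.span k
    {bas k 1 ⊗ₜ bas k 2 + bas k 2 ⊗ₜ bas k 1 + ε • (bas k 0 ⊗ₜ bas k 0),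
      bas k 2 ⊗ₜ bas k 0 + bas k 0 ⊗ₜ bas k 2 + ε' • (bas k 1 ⊗ₜ bas k 1),
      bas k 0 ⊗ₜ bas k 1 + bas k 1 ⊗ₜ bas k 0} := by
  have hr : (Set.range fun i => pderivPot i (potE ε ε')) =
      {pderivPot 0 (potE ε ε'), pderivPot 1 (potE ε ε'), pderivPot 2 (potE ε ε')} := by
    ext t
    simp only [Set.mem_range, Fin.exists_fin_succ, Set.mem_insert_iff, Set.mem_singleton_iff]
    simp [eq_comm]
  rw [relE, derivRel, hr]
  simp [potE, potS, pderivPot_mono3]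

/-- The coefficient of `x_i* ⊗ x_j*` in an element of `V* ⊗ V*`. -/
def dualCoeff (s : Module.Dual k (Fin 3 → k) ⊗[k] Module.Dual k (Fin 3 → k)) (i j : Fin 3) : k :=
  TensorProduct.dualDistrib k _ _ s (bas k i ⊗ₜ bas k j)

theorem mem_orth_relE {ε ε' : k} {s : Module.Dual k (Fin 3 → k) ⊗[k] Module.Dual k (Fin 3 → k)} :
    s ∈ orth (relE ε ε') ↔
      dualCoeff s 1 2 + dualCoeff s 2 1 + ε * dualCoeff s 0 0 = 0 ∧
      dualCoeff s 2 0 + dualCoeff s 0 2 + ε' * dualCoeff s 1 1 = 0 ∧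
      dualCoeff s 0 1 + dualCoeff s 1 0 = 0 := by
  simp only [orth, Submodule.mem_comap, Submodule.mem_dualAnnihilator, dualCoeff]
  constructor
  · intro h
    refine ⟨?_, ?_, ?_⟩
    · have h0 := h (bas k 1 ⊗ₜ bas k 2 + bas k 2 ⊗ₜ bas k 1 + ε • (bas k 0 ⊗ₜ bas k 0))
        (relE_eq_span ε ε' ▸ Submodule.subset_span (by simp))
      simp only [map_add, map_smul, smul_eq_mul] at h0
      exact h0
    · have h0 := h (bas k 2 ⊗ₜ bas k 0 + bas k 0 ⊗ₜ bas k 2 + ε' • (bas k 1 ⊗ₜ bas k 1))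
        (relE_eq_span ε ε' ▸ Submodule.subset_span (by simp))
      simp only [map_add, map_smul, smul_eq_mul] at h0
      exact h0
    · have h0 := h (bas k 0 ⊗ₜ bas k 1 + bas k 1 ⊗ₜ bas k 0)
        (relE_eq_span ε ε' ▸ Submodule.subset_span (by simp))
      simp only [map_add] at h0
      exact h0
  · rintro ⟨h0, h1, h2⟩ r hr
    rw [relE_eq_span] at hr
    induction hr using Submodule.span_induction with
    | mem t ht =>
      obtain rfl | rfl | rfl := ht
      · simpa using h0
      · simpa using h1
      · simpa using h2
    | zero => simp
    | add a b _ _ ha hb => rw [map_add, ha, hb, add_zero]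
    | smul c a _ ha => rw [map_smul, ha, smul_zero]

theorem mem_orth_conicRel {ε ε' a b c : k}
    {s : Module.Dual k (Fin 3 → k) ⊗[k] Module.Dual k (Fin 3 → k)} :
    s ∈ orth (conicRel (relE ε ε') (diagForm a b c)) ↔ s ∈ orth (relE ε ε') ∧
      a * dualCoeff s 0 0 + b * dualCoeff s 1 1 + c * dualCoeff s 2 2 = 0 := by
  simp only [orth, conicRel, Submodule.dualAnnihilator_sup_eq, Submodule.comap_inf,
    Submodule.mem_inf]
  refine and_congr_right fun _ => ?_
  simp only [Submodule.mem_comap, Submodule.mem_dualAnnihilator, Submodule.mem_span_singleton]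
  constructor
  · intro h
    simpa [diagForm, dualCoeff] using h _ ⟨1, one_smul _ _⟩
  · rintro h _ ⟨t, rfl⟩
    rw [map_smul]
    simp only [diagForm, map_add, map_smul, smul_eq_mul]
    simp only [dualCoeff] at h
    rw [h, mul_zero]

theorem dual_eq_sum (φ : Module.Dual k (Fin 3 → k)) :
    φ = ∑ i, φ (bas k i) • (LinearMap.proj i : (Fin 3 → k) →ₗ[k] k) := by
  refine LinearMap.pi_ext' fun i => LinearMap.ext_ring ?_
  simp [bas, Pi.single_apply]

theorem quadEval_eq_sum {D : Type*} [Ring D] [Algebra k D] (g : Module.Dual k (Fin 3 → k) →ₗ[k] D)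
    (s : Module.Dual k (Fin 3 → k) ⊗[k] Module.Dual k (Fin 3 → k)) :
    quadEval g s = ∑ i, ∑ j, dualCoeff s i j • (g (LinearMap.proj i) * g (LinearMap.proj j)) := by
  induction s with
  | zero => simp [dualCoeff]
  | add s t hs ht =>
    simp only [dualCoeff] at hs ht ⊢
    simp only [map_add, hs, ht, LinearMap.add_apply, add_smul, Finset.sum_add_distrib]
  | tmul φ ψ =>
    rw [quadEval_tmul]
    conv_lhs => rw [dual_eq_sum φ, dual_eq_sum ψ]
    simp only [map_sum, map_smul, Finset.sum_mul_sum, smul_mul_smul_comm]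
    simp [dualCoeff]

/-- Three commuting elements `X`, `Y`, `Z` with `X² - ε YZ = a w`, `Y² - ε' XZ = b w` and `Z² = c w`
satisfy every relation of `S^!` up to a multiple of `w`. -/
theorem quadEval_eq_smul {ε ε' a b c : k} {D : Type*} [Ring D] [Algebra k D]
    (g : Module.Dual k (Fin 3 → k) →ₗ[k] D)
    (hc : ∀ i j : Fin 3, g (LinearMap.proj i) * g (LinearMap.proj j) =
      g (LinearMap.proj j) * g (LinearMap.proj i)) {w : D}
    (h0 : g (LinearMap.proj 0) ^ 2 - ε • (g (LinearMap.proj 1) * g (LinearMap.proj 2)) = a • w)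
    (h1 : g (LinearMap.proj 1) ^ 2 - ε' • (g (LinearMap.proj 0) * g (LinearMap.proj 2)) = b • w)
    (h2 : g (LinearMap.proj 2) ^ 2 = c • w)
    {s : Module.Dual k (Fin 3 → k) ⊗[k] Module.Dual k (Fin 3 → k)} (hs : s ∈ orth (relE ε ε')) :
    quadEval g s = (a * dualCoeff s 0 0 + b * dualCoeff s 1 1 + c * dualCoeff s 2 2) • w := by
  obtain ⟨e0, e1, e2⟩ := mem_orth_relE.mp hs
  rw [quadEval_eq_sum]
  simp only [Fin.sum_univ_three, hc 1 0, hc 2 0, hc 2 1, ← pow_two]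
  have e0' : dualCoeff s 1 2 = - dualCoeff s 2 1 - ε * dualCoeff s 0 0 := by
    linear_combination e0
  have e1' : dualCoeff s 0 2 = - dualCoeff s 2 0 - ε' * dualCoeff s 1 1 := by
    linear_combination e1
  have e2' : dualCoeff s 0 1 = - dualCoeff s 1 0 := by
    linear_combination e2
  rw [e0', e1', e2', sub_eq_iff_eq_add.mp h0, sub_eq_iff_eq_add.mp h1, h2]
  module

theorem dualCoeff_tmul (i j p q : Fin 3) :
    dualCoeff ((LinearMap.proj i : (Fin 3 → k) →ₗ[k] k) ⊗ₜ[k] (LinearMap.proj j)) p q =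
      (if p = i then 1 else 0) * (if q = j then (1 : k) else 0) := by
  simp [dualCoeff, bas, Pi.single_apply, eq_comm]

theorem dualCoeff_add (s t : Module.Dual k (Fin 3 → k) ⊗[k] Module.Dual k (Fin 3 → k))
    (p q : Fin 3) : dualCoeff (s + t) p q = dualCoeff s p q + dualCoeff t p q := by
  simp [dualCoeff]

theorem dualCoeff_sub (s t : Module.Dual k (Fin 3 → k) ⊗[k] Module.Dual k (Fin 3 → k))
    (p q : Fin 3) : dualCoeff (s - t) p q = dualCoeff s p q - dualCoeff t p q := by
  simp [dualCoeff]

theorem dualCoeff_smul (c : k) (s : Module.Dual k (Fin 3 → k) ⊗[k] Module.Dual k (Fin 3 → k))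
    (p q : Fin 3) : dualCoeff (c • s) p q = c * dualCoeff s p q := by
  simp [dualCoeff]

/-- The generator `x_i*` of `A^!`, for `A = D(ω_S + ε x³ + ε' y³)/(a x² + b y² + c z²)`. -/
abbrev dualGen (ε ε' a b c : k) (i : Fin 3) :
    QuadDual (conicRel (relE ε ε') (diagForm a b c)) :=
  quadGen _ (LinearMap.proj i)

theorem quadGen_eq_sum (R : Submodule k (Module.Dual k (Fin 3 → k) ⊗[k] Module.Dual k (Fin 3 → k)))
    (φ : Module.Dual k (Fin 3 → k)) :
    quadGen R φ = ∑ i, φ (bas k i) • quadGen R (LinearMap.proj i) := by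
  conv_lhs => rw [dual_eq_sum φ]
  simp

theorem dualGen_mul_comm (ε ε' a b c : k) (i j : Fin 3) :
    dualGen ε ε' a b c i * dualGen ε ε' a b c j = dualGen ε ε' a b c j * dualGen ε ε' a b c i := by
  have h : (LinearMap.proj i : (Fin 3 → k) →ₗ[k] k) ⊗ₜ[k] (LinearMap.proj j : (Fin 3 → k) →ₗ[k] k) -
      (LinearMap.proj j : (Fin 3 → k) →ₗ[k] k) ⊗ₜ[k] (LinearMap.proj i : (Fin 3 → k) →ₗ[k] k) ∈
      orth (conicRel (relE ε ε') (diagForm a b c)) := by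
    rw [mem_orth_conicRel, mem_orth_relE]
    simp only [dualCoeff_sub, dualCoeff_tmul]
    refine ⟨⟨?_, ?_, ?_⟩, ?_⟩ <;> ring
  have h1 := quadTwo_eq_zero _ h
  rw [quadTwo_eq_quadEval, map_sub, quadEval_tmul, quadEval_tmul, sub_eq_zero] at h1
  exact h1

theorem quadDual_mul_comm (ε ε' a b c : k)
    (x y : QuadDual (conicRel (relE ε ε') (diagForm a b c))) : x * y = y * x := by
  refine quadAlg_mul_comm (fun φ ψ => ?_) x y
  rw [quadGen_eq_sum _ φ, quadGen_eq_sum _ ψ, Finset.sum_mul_sum, Finset.sum_mul_sum,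
    Finset.sum_comm]
  refine Finset.sum_congr rfl fun i _ => Finset.sum_congr rfl fun j _ => ?_
  rw [smul_mul_smul_comm, smul_mul_smul_comm, dualGen_mul_comm, mul_comm (ψ _)]

/-- The element `w` of `A^!_2` with `x² - ε yz = a w`, `y² - ε' xz = b w` and `z² = c w`. -/
structure IsConicElement (ε ε' a b c : k)
    (w : QuadDual (conicRel (relE ε ε') (diagForm a b c))) : Prop where
  deg_two : w ∈ quadDeg (orth (conicRel (relE ε ε') (diagForm a b c))) 2
  proj_eq_zero : dualProj (relE ε ε') (diagForm a b c) w = 0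
  eq_x : dualGen ε ε' a b c 0 ^ 2 - ε • (dualGen ε ε' a b c 1 * dualGen ε ε' a b c 2) = a • w
  eq_y : dualGen ε ε' a b c 1 ^ 2 - ε' • (dualGen ε ε' a b c 0 * dualGen ε ε' a b c 2) = b • w
  eq_z : dualGen ε ε' a b c 2 ^ 2 = c • w

theorem exists_isConicElement {ε ε' a b c : k} (h : ¬ (a = 0 ∧ b = 0 ∧ c = 0)) :
    ∃ w, IsConicElement ε ε' a b c w := by
  obtain ⟨p, q, r, hpqr⟩ : ∃ p q r : k, a * p + b * q + c * r = 1 := by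
    by_cases ha : a = 0
    · by_cases hb : b = 0
      · have hc : c ≠ 0 := fun hc => h ⟨ha, hb, hc⟩
        exact ⟨0, 0, c⁻¹, by field_simp; ring⟩
      · exact ⟨0, b⁻¹, 0, by field_simp; ring⟩
    · exact ⟨a⁻¹, 0, 0, by field_simp; ring⟩
  let d : Fin 3 → Module.Dual k (Fin 3 → k) := fun i => LinearMap.proj i
  let t0 := d 0 ⊗ₜ[k] d 0 - ε • d 1 ⊗ₜ[k] d 2
  let t1 := d 1 ⊗ₜ[k] d 1 - ε' • d 0 ⊗ₜ[k] d 2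
  let t2 := d 2 ⊗ₜ[k] d 2
  let t := p • t0 + q • t1 + r • t2
  have ht : t ∈ orth (relE ε ε') := by
    rw [mem_orth_relE]
    simp [t, t0, t1, t2, d, dualCoeff_tmul, dualCoeff_sub, dualCoeff_add, dualCoeff_smul]
    exact ⟨by ring, by ring⟩
  have key : ∀ (m : k) (s : Module.Dual k (Fin 3 → k) ⊗[k] Module.Dual k (Fin 3 → k)),
      s - m • t ∈ orth (conicRel (relE ε ε') (diagForm a b c)) →
      quadEval (quadGen (orth (conicRel (relE ε ε') (diagForm a b c)))) s =
        m • quadTwo (orth (conicRel (relE ε ε') (diagForm a b c))) t := by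
    intro m s hs
    have h1 := quadTwo_eq_zero _ hs
    rw [map_sub, map_smul, sub_eq_zero] at h1
    rw [← h1, quadTwo_eq_quadEval]
  refine ⟨quadTwo _ t, ?_, ?_, ?_, ?_, ?_⟩
  · rw [quadDeg_two_eq_range]
    exact ⟨t, rfl⟩
  · rw [dualProj, quadMap_quadTwo, quadTwo_eq_zero _ ht]
  · rw [← key a t0, pow_two]
    · simp [t0, d]
    · rw [mem_orth_conicRel, mem_orth_relE]
      simp [t, t0, t1, t2, d, dualCoeff_tmul, dualCoeff_sub, dualCoeff_add, dualCoeff_smul]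
      exact ⟨⟨by ring, by ring⟩, by linear_combination (-a) * hpqr⟩
  · rw [← key b t1, pow_two]
    · simp [t1, d]
    · rw [mem_orth_conicRel, mem_orth_relE]
      simp [t, t0, t1, t2, d, dualCoeff_tmul, dualCoeff_sub, dualCoeff_add, dualCoeff_smul]
      exact ⟨⟨by ring, by ring⟩, by linear_combination (-b) * hpqr⟩
  · rw [← key c t2, pow_two]
    · simp [t2, d]
    · rw [mem_orth_conicRel, mem_orth_relE]
      simp [t, t0, t1, t2, d, dualCoeff_tmul, dualCoeff_sub, dualCoeff_add, dualCoeff_smul]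
      exact ⟨⟨by ring, by ring⟩, by linear_combination (-c) * hpqr⟩

variable {ε ε' a b c : k} {w : QuadDual (conicRel (relE ε ε') (diagForm a b c))}

/-- Elements of degree two in the kernel of `A^! → S^!` are multiples of `w`, since the degree two
part of `S^!` is `(V* ⊗ V*)/R^⊥`. -/
theorem IsConicElement.exists_eq_smul (hw : IsConicElement ε ε' a b c w)
    {v : QuadDual (conicRel (relE ε ε') (diagForm a b c))}
    (hv : v ∈ quadDeg (orth (conicRel (relE ε ε') (diagForm a b c))) 2)
    (hv' : dualProj (relE ε ε') (diagForm a b c) v = 0) : ∃ m : k, v = m • w := by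
  rw [quadDeg_two_eq_range] at hv
  obtain ⟨s, rfl⟩ := hv
  rw [dualProj, quadMap_quadTwo, quadTwo_eq_zero_iff] at hv'
  rw [quadTwo_eq_quadEval]
  exact ⟨_, quadEval_eq_smul _ (dualGen_mul_comm ε ε' a b c) hw.eq_x hw.eq_y hw.eq_z hv'⟩

theorem IsConicElement.ker_eq (hw : IsConicElement ε ε' a b c w) :
    RingHom.ker (dualProj (relE ε ε') (diagForm a b c)) = Ideal.span {w} := by
  apply le_antisymm
  · obtain ⟨D, _, _, π, hπ⟩ := exists_commRing_quotient (k := k) (quadDual_mul_comm ε ε' a b c) w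
    have hπw : π w = 0 := by
      rw [← RingHom.mem_ker, hπ]
      exact Ideal.mem_span_singleton_self w
    have h0 := congrArg π hw.eq_x
    have h1 := congrArg π hw.eq_y
    have h2 := congrArg π hw.eq_z
    simp only [map_sub, map_pow, map_smul, map_mul] at h0 h1 h2
    let g := π.toLinearMap ∘ₗ quadGen (orth (conicRel (relE ε ε') (diagForm a b c)))
    have hg : ∀ s ∈ orth (relE ε ε'), quadEval g s = 0 := by
      intro s hs
      rw [quadEval_eq_smul (w := π w) g (fun i j => mul_comm _ _) h0 h1 h2 hs, hπw, smul_zero]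
    have hcomp : (quadLift _ g hg).comp (dualProj (relE ε ε') (diagForm a b c)) = π :=
      quadAlg_hom_ext fun v => by
        rw [AlgHom.comp_apply, dualProj, quadMap_quadGen, quadLift_quadGen]
        rfl
    intro x hx
    rw [← hπ, RingHom.mem_ker, ← hcomp, AlgHom.comp_apply, RingHom.mem_ker.mp hx, map_zero]
  · rw [Ideal.span_singleton_le_iff_mem]
    exact hw.proj_eq_zero

/-- `A^!_2` is spanned by `w`, `xy`, `xz` and `yz`. -/
theorem IsConicElement.quadDeg_two_le (hw : IsConicElement ε ε' a b c w) :
    quadDeg (orth (conicRel (relE ε ε') (diagForm a b c))) 2 ≤ Submodule.span k (Set.range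
      ![w, dualGen ε ε' a b c 0 * dualGen ε ε' a b c 1, dualGen ε ε' a b c 0 * dualGen ε ε' a b c 2,
        dualGen ε ε' a b c 1 * dualGen ε ε' a b c 2]) := by
  have hm : ∀ i j : Fin 3, dualGen ε ε' a b c i * dualGen ε ε' a b c j ∈ Submodule.span k (Set.range
      ![w, dualGen ε ε' a b c 0 * dualGen ε ε' a b c 1, dualGen ε ε' a b c 0 * dualGen ε ε' a b c 2,
        dualGen ε ε' a b c 1 * dualGen ε ε' a b c 2]) := by
    have hh := fun l => Submodule.subset_span (R := k) (Set.mem_range_self (f :=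
      ![w, dualGen ε ε' a b c 0 * dualGen ε ε' a b c 1, dualGen ε ε' a b c 0 * dualGen ε ε' a b c 2,
        dualGen ε ε' a b c 1 * dualGen ε ε' a b c 2]) l)
    have hw0 := hh 0
    have h01 := hh 1
    have h02 := hh 2
    have h12 := hh 3
    simp only [Matrix.cons_val] at hw0 h01 h02 h12
    have h00 := hw.eq_x
    have h11 := hw.eq_y
    have h22 := hw.eq_z
    rw [sub_eq_iff_eq_add, pow_two] at h00 h11
    rw [pow_two] at h22
    intro i j
    fin_cases i <;> fin_cases j
    · exact h00 ▸ add_mem (Submodule.smul_mem _ _ hw0) (Submodule.smul_mem _ _ h12)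
    · exact h01
    · exact h02
    · exact (dualGen_mul_comm ε ε' a b c 1 0) ▸ h01
    · exact h11 ▸ add_mem (Submodule.smul_mem _ _ hw0) (Submodule.smul_mem _ _ h02)
    · exact h12
    · exact (dualGen_mul_comm ε ε' a b c 2 0) ▸ h02
    · exact (dualGen_mul_comm ε ε' a b c 2 1) ▸ h12
    · exact h22 ▸ Submodule.smul_mem _ _ hw0
  rw [quadDeg, pow_two, Submodule.mul_le]
  rintro _ ⟨φ, rfl⟩ _ ⟨ψ, rfl⟩
  rw [quadGen_eq_sum _ φ, quadGen_eq_sum _ ψ, Finset.sum_mul_sum]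
  refine Submodule.sum_mem _ fun i _ => Submodule.sum_mem _ fun j _ => ?_
  rw [smul_mul_smul_comm]
  exact Submodule.smul_mem _ _ (hm i j)

end Family

/-! ### The algebra `C(A)` as the coordinate ring of four points -/

noncomputable section Models

universe u

variable {k : Type u} [Field k]

theorem injective_linearCombination_of_span {C : Type*} [AddCommGroup C] [Module k C] {n : ℕ}
    [Module.Finite k C] (hC : Module.finrank k C = n) {v : Fin n → C}
    (hv : ∀ t, ∃ c : Fin n → k, t = ∑ i, c i • v i) {c : Fin n → k} (h : ∑ i, c i • v i = 0) :
    c = 0 := by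
  have hs : Function.Surjective (Fintype.linearCombination k v) := fun t => by
    obtain ⟨c, rfl⟩ := hv t
    exact ⟨c, Fintype.linearCombination_apply _ _ _⟩
  have hi := (LinearMap.injective_iff_surjective_of_finrank_eq_finrank
    (f := Fintype.linearCombination k v) (by simp [hC])).mpr hs
  apply hi
  rw [map_zero, ← h, Fintype.linearCombination_apply]

/-- Let `B` be generated in degree one by `ℓ`, `x`, `y`, with `B_2` of dimension at most four, and
let `θ` map `B` to an algebra of dimension four, with `θ ℓ = 1`, in such a way that `1`, `θ x`, `θ y`
and `θ (x y)` span, `θ y ^ 2` being a combination of the first three. Then `θ` is injective on `B_2`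
for dimension reasons, so that the relations for `x ^ 2` and `y ^ 2` lift to `B`, whence
`B_(n + 1) = ℓ B_n` for `n ≥ 2` and `θ` is injective on every `B_n`. -/
theorem eq_zero_of_mem_pow_of_map_eq_zero {B C : Type*} [CommRing B] [Algebra k B] [CommRing C]
    [Algebra k C] (hC : Module.finrank k C = 4) (P : Submodule k B) {ℓ x y : B} (hℓ : ℓ ∈ P)
    (hx : x ∈ P) (hy : y ∈ P) (hP : ∀ a ∈ P, ∃ c₀ c₁ c₂ : k, a = c₀ • ℓ + c₁ • x + c₂ • y)
    {m : Fin 4 → B} (hm : P ^ 2 ≤ Submodule.span k (Set.range m)) (θ : B →ₐ[k] C) (hθ : θ ℓ = 1)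
    (hspan : ∀ t : C, ∃ c₀ c₁ c₂ c₃ : k,
      t = c₀ • 1 + c₁ • θ x + c₂ • θ y + c₃ • (θ x * θ y))
    (hsq : ∃ c₀ c₁ c₂ : k, θ y ^ 2 = c₀ • 1 + c₁ • θ x + c₂ • θ y) :
    ∀ n, ∀ a ∈ P ^ n, θ a = 0 → a = 0 := by
  have hfin : Module.Finite k C := Module.finite_of_finrank_pos (by omega)
  have hnt : Nontrivial C := Module.nontrivial_of_finrank_pos (R := k) (by omega)
  have hmul : ∀ {a b}, a ∈ P → b ∈ P → a * b ∈ P ^ 2 := fun ha hb => by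
    rw [pow_two]; exact Submodule.mul_mem_mul ha hb
  have h2 : ∀ a ∈ P ^ 2, θ a = 0 → a = 0 := by
    intro a ha h0
    obtain ⟨c, rfl⟩ := (Submodule.mem_span_range_iff_exists_fun k).mp (hm ha)
    have := injective_linearCombination_of_span hC (v := fun i => θ (m i)) (fun t => by
      obtain ⟨c₀, c₁, c₂, c₃, rfl⟩ := hspan t
      have hb : c₀ • (ℓ * ℓ) + c₁ • (ℓ * x) + c₂ • (ℓ * y) + c₃ • (x * y) ∈ P ^ 2 :=
        add_mem (add_mem (add_mem (Submodule.smul_mem _ _ (hmul hℓ hℓ))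
          (Submodule.smul_mem _ _ (hmul hℓ hx))) (Submodule.smul_mem _ _ (hmul hℓ hy)))
          (Submodule.smul_mem _ _ (hmul hx hy))
      obtain ⟨d, hd⟩ := (Submodule.mem_span_range_iff_exists_fun k).mp (hm hb)
      refine ⟨d, ?_⟩
      have := congrArg θ hd
      simp only [map_sum, map_smul, map_add, map_mul, hθ, one_mul] at this
      exact this.symm) (c := c) (by simpa using h0)
    simp [this]
  have hform : ∀ a ∈ P ^ 2, ∃ c₀ c₁ c₂ c₃ : k,
      a = ℓ * (c₀ • ℓ + c₁ • x + c₂ • y) + c₃ • (x * y) := by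
    intro a ha
    obtain ⟨c₀, c₁, c₂, c₃, h⟩ := hspan (θ a)
    refine ⟨c₀, c₁, c₂, c₃, sub_eq_zero.mp (h2 _ (sub_mem ha (add_mem (hmul hℓ ?_)
      (Submodule.smul_mem _ _ (hmul hx hy)))) ?_)⟩
    · exact add_mem (add_mem (Submodule.smul_mem _ _ hℓ) (Submodule.smul_mem _ _ hx))
        (Submodule.smul_mem _ _ hy)
    · simp [hθ, h]
  have hcomb : ∀ c₀ c₁ c₂ : k, c₀ • ℓ + c₁ • x + c₂ • y ∈ P := fun c₀ c₁ c₂ =>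
    add_mem (add_mem (Submodule.smul_mem _ _ hℓ) (Submodule.smul_mem _ _ hx))
      (Submodule.smul_mem _ _ hy)
  obtain ⟨u, hu, hyy⟩ : ∃ u ∈ P, y * y = ℓ * u := by
    obtain ⟨c₀, c₁, c₂, h⟩ := hsq
    refine ⟨_, hcomb c₀ c₁ c₂, sub_eq_zero.mp (h2 _ (sub_mem (hmul hy hy)
      (hmul hℓ (hcomb _ _ _))) ?_)⟩
    rw [map_sub, map_mul, map_mul, hθ, ← pow_two, h]
    simp [hθ]
  obtain ⟨v, hv, c, hxx⟩ : ∃ v ∈ P, ∃ c : k, x * x = ℓ * v + c • (x * y) := by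
    obtain ⟨c₀, c₁, c₂, c₃, h⟩ := hform _ (hmul hx hx)
    exact ⟨_, hcomb c₀ c₁ c₂, c₃, h⟩
  have hdiv : ∀ n, ∀ a ∈ P ^ (n + 3), ∃ b ∈ P ^ (n + 2), a = ℓ * b := by
    intro n
    induction n with
    | zero =>
      intro a ha
      rw [zero_add, pow_succ'] at ha
      induction ha using Submodule.mul_induction_on' with
      | mem_mul_mem p hp q hq =>
        obtain ⟨d₀, d₁, d₂, rfl⟩ := hP p hp
        obtain ⟨c₀, c₁, c₂, c₃, rfl⟩ := hform q hq
        refine ⟨(d₀ • ℓ + d₁ • x + d₂ • y) * (c₀ • ℓ + c₁ • x + c₂ • y) + (c₃ * d₀) • (x * y) +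
          (c₃ * d₁) • (v * y) + (c₃ * d₁ * c) • (x * u) + (c₃ * d₂) • (x * u), ?_, ?_⟩
        · exact add_mem (add_mem (add_mem (add_mem (hmul (hcomb _ _ _) (hcomb _ _ _))
            (Submodule.smul_mem _ _ (hmul hx hy))) (Submodule.smul_mem _ _ (hmul hv hy)))
            (Submodule.smul_mem _ _ (hmul hx hu))) (Submodule.smul_mem _ _ (hmul hx hu))
        · simp only [Algebra.smul_def, map_mul] at hxx ⊢
          linear_combination (algebraMap k B c₃ * algebraMap k B d₁) * y * hxx +
            (algebraMap k B c₃ * algebraMap k B d₁ * algebraMap k B c +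
              algebraMap k B c₃ * algebraMap k B d₂) * x * hyy
      | add p _ q _ ihp ihq =>
        obtain ⟨b, hb, rfl⟩ := ihp
        obtain ⟨d, hd, rfl⟩ := ihq
        exact ⟨b + d, add_mem hb hd, by ring⟩
    | succ n ih =>
      intro a ha
      rw [show n + 1 + 3 = (n + 3) + 1 by ring, pow_succ'] at ha
      induction ha using Submodule.mul_induction_on' with
      | mem_mul_mem p hp q hq =>
        obtain ⟨b, hb, rfl⟩ := ih q hq
        refine ⟨p * b, ?_, by ring⟩
        rw [show n + 1 + 2 = (n + 2) + 1 by ring, pow_succ']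
        exact Submodule.mul_mem_mul hp hb
      | add p _ q _ ihp ihq =>
        obtain ⟨b, hb, rfl⟩ := ihp
        obtain ⟨d, hd, rfl⟩ := ihq
        exact ⟨b + d, add_mem hb hd, by ring⟩
  have hge : ∀ n, ∀ a ∈ P ^ (n + 2), θ a = 0 → a = 0 := by
    intro n
    induction n with
    | zero => exact h2
    | succ n ih =>
      intro a ha h0
      obtain ⟨b, hb, rfl⟩ := hdiv n a ha
      rw [map_mul, hθ, one_mul] at h0
      rw [ih b hb h0, mul_zero]
  intro n a ha h0
  match n, ha with
  | 0, ha =>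
    rw [pow_zero, Submodule.mem_one] at ha
    obtain ⟨c, rfl⟩ := ha
    rw [AlgHom.commutes] at h0
    rw [(map_eq_zero_iff _ (algebraMap k C).injective).mp h0, map_zero]
  | 1, ha =>
    rw [pow_one] at ha
    obtain ⟨c₀, c₁, c₂, rfl⟩ := hP a ha
    have := injective_linearCombination_of_span hC (v := ![1, θ x, θ y, θ x * θ y]) (fun t => by
      obtain ⟨c₀, c₁, c₂, c₃, rfl⟩ := hspan t
      exact ⟨![c₀, c₁, c₂, c₃], by simp [Fin.sum_univ_four]⟩) (c := ![c₀, c₁, c₂, 0]) (by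
        simpa [hθ, Fin.sum_univ_four] using h0)
    have e0 := congrFun this 0
    have e1 := congrFun this 1
    have e2 := congrFun this 2
    simp at e0 e1 e2
    simp [e0, e1, e2]
  | n + 2, ha => exact hge n a ha h0

/-- Let `(p 0, p 1, p 2)` be a point of the conic pencil `x² - ε yz = a W`, `y² - ε' xz = b W`,
`z² = c W` with values in an algebra `C` of dimension four, normalized so that one coordinate is
`1`. If the two other coordinates generate `C` as in `eq_zero_of_mem_pow_of_map_eq_zero`, then
`C(A) ≅ C`. -/
theorem cAlgIs_of_point {ε ε' a b c : k} (h : ¬ (a = 0 ∧ b = 0 ∧ c = 0)) {C : Type*} [CommRing C]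
    [Algebra k C] (hC : Module.finrank k C = 4) (p : Fin 3 → C) {W : C} (hW : IsUnit W)
    (h0 : p 0 ^ 2 - ε • (p 1 * p 2) = a • W) (h1 : p 1 ^ 2 - ε' • (p 0 * p 2) = b • W)
    (h2 : p 2 ^ 2 = c • W) (e : Equiv.Perm (Fin 3)) (hp : p (e 0) = 1)
    (hspan : ∀ t : C, ∃ c₀ c₁ c₂ c₃ : k,
      t = c₀ • 1 + c₁ • p (e 1) + c₂ • p (e 2) + c₃ • (p (e 1) * p (e 2)))
    (hsq : ∃ c₀ c₁ c₂ : k, p (e 2) ^ 2 = c₀ • 1 + c₁ • p (e 1) + c₂ • p (e 2)) :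
    CAlgIs (relE ε ε') (diagForm a b c) C := by
  obtain ⟨w, hw⟩ := exists_isConicElement (ε := ε) (ε' := ε') h
  have hnt : Nontrivial C := Module.nontrivial_of_finrank_pos (R := k) (by omega)
  let g : Module.Dual k (Fin 3 → k) →ₗ[k] C :=
    ∑ i, (LinearMap.toSpanSingleton k C (p i)) ∘ₗ (LinearMap.applyₗ (bas k i))
  have hg : ∀ i, g (LinearMap.proj i) = p i := by
    intro i
    simp [g, bas, Pi.single_apply]
  have hrel : ∀ s ∈ orth (conicRel (relE ε ε') (diagForm a b c)), quadEval g s = 0 := by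
    intro s hs
    rw [mem_orth_conicRel] at hs
    rw [quadEval_eq_smul (w := W) g (fun i j => mul_comm _ _) (by rw [hg, hg, hg]; exact h0)
      (by rw [hg, hg, hg]; exact h1) (by rw [hg]; exact h2) hs.1, hs.2, zero_smul]
  let θ := quadLift _ g hrel
  have hθ : ∀ i, θ (dualGen ε ε' a b c i) = p i := fun i => by
    rw [← hg]; exact quadLift_quadGen _ _ _ _
  -- One of `a`, `b`, `c` being nonzero, the three relations determine `θ w`.
  have hθw : θ w = W := by
    have k0 := congrArg θ hw.eq_x
    have k1 := congrArg θ hw.eq_y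
    have k2 := congrArg θ hw.eq_z
    simp only [map_sub, map_pow, map_smul, map_mul, hθ] at k0 k1 k2
    rw [h0] at k0
    rw [h1] at k1
    rw [h2] at k2
    by_cases ha : a = 0
    · by_cases hb : b = 0
      · exact (smul_right_injective C (fun hc => h ⟨ha, hb, hc⟩) k2).symm
      · exact (smul_right_injective C hb k1).symm
    · exact (smul_right_injective C ha k0).symm
  have hgen : ∀ i, dualGen ε ε' a b c i ∈
      LinearMap.range (quadGen (orth (conicRel (relE ε ε') (diagForm a b c)))) :=
    fun i => ⟨_, rfl⟩
  have hinj : ∀ n, ∀ x ∈ quadDeg (orth (conicRel (relE ε ε') (diagForm a b c))) n,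
      θ x = 0 → x = 0 := by
    let _ : CommRing (QuadDual (conicRel (relE ε ε') (diagForm a b c))) :=
      { (inferInstance : Ring (QuadDual (conicRel (relE ε ε') (diagForm a b c)))) with
        mul_comm := quadDual_mul_comm ε ε' a b c }
    refine eq_zero_of_mem_pow_of_map_eq_zero hC
      (LinearMap.range (quadGen (orth (conicRel (relE ε ε') (diagForm a b c)))))
      (hgen (e 0)) (hgen (e 1)) (hgen (e 2)) ?_ hw.quadDeg_two_le θ ((hθ _).trans hp) ?_ ?_
    · rintro _ ⟨φ, rfl⟩
      refine ⟨φ (bas k (e 0)), φ (bas k (e 1)), φ (bas k (e 2)), ?_⟩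
      rw [quadGen_eq_sum, ← Equiv.sum_comp e, Fin.sum_univ_three]
    · rw [hθ, hθ]
      exact hspan
    · rw [hθ, hθ]
      exact hsq
  have hleft : ∀ x, w * x = 0 → x = 0 := by
    intro x hx
    refine eq_zero_of_mul_eq_zero_of_homogeneous _ hw.deg_two ?_ hx
    intro n y hy hwy
    refine hinj n y hy ?_
    have := congrArg θ hwy
    rw [map_mul, map_zero, hθw] at this
    exact hW.mul_right_eq_zero.mp this
  have hwreg : IsRegular w := by
    have hl : IsLeftRegular w := by
      intro x y hxy
      rw [← sub_eq_zero]
      exact hleft _ (by rw [mul_sub, sub_eq_zero]; exact hxy)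
    refine ⟨hl, fun x y hxy => hl ?_⟩
    simpa only [quadDual_mul_comm ε ε' a b c _ w] using hxy
  refine ⟨⟨w, hw.deg_two, Subring.mem_center_iff.mpr fun x => quadDual_mul_comm _ _ _ _ _ _ _,
    hwreg, hw.ker_eq⟩, ?_⟩
  intro v hv
  have hv0 : dualProj (relE ε ε') (diagForm a b c) v = 0 := by
    rw [← RingHom.mem_ker, hv.ker_eq]
    exact Ideal.mem_span_singleton_self v
  obtain ⟨m, rfl⟩ := hw.exists_eq_smul hv.deg_two hv0
  have hm : m ≠ 0 := by
    rintro rfl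
    have hone : (1 : QuadDual (conicRel (relE ε ε') (diagForm a b c))) = 0 := by
      apply hv.regular.left
      simp
    have := congrArg θ hone
    rw [map_one, map_zero] at this
    exact one_ne_zero this
  have hunit : IsUnit (θ (m • w)) := by
    rw [map_smul, hθw, Algebra.smul_def]
    exact ((isUnit_iff_ne_zero.mpr hm).map (algebraMap k C)).mul hW
  refine degZeroLoc_equiv _ _ _ _ θ hunit (fun n => hinj (2 * n)) ?_
  intro t
  obtain ⟨c₀, c₁, c₂, c₃, ht⟩ := hspan t
  have hmul : ∀ i j, dualGen ε ε' a b c i * dualGen ε ε' a b c j ∈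
      (LinearMap.range (quadGen (orth (conicRel (relE ε ε') (diagForm a b c))))) ^ 2 := by
    intro i j
    rw [pow_two]
    exact Submodule.mul_mem_mul (hgen i) (hgen j)
  refine ⟨c₀ • (dualGen ε ε' a b c (e 0) * dualGen ε ε' a b c (e 0)) +
    c₁ • (dualGen ε ε' a b c (e 0) * dualGen ε ε' a b c (e 1)) +
    c₂ • (dualGen ε ε' a b c (e 0) * dualGen ε ε' a b c (e 2)) +
    c₃ • (dualGen ε ε' a b c (e 1) * dualGen ε ε' a b c (e 2)),
    add_mem (add_mem (add_mem (Submodule.smul_mem _ _ (hmul _ _))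
      (Submodule.smul_mem _ _ (hmul _ _))) (Submodule.smul_mem _ _ (hmul _ _)))
      (Submodule.smul_mem _ _ (hmul _ _)), ?_⟩
  simp only [map_add, map_smul, map_mul, hθ, hp, one_mul]
  exact ht.symm

/-- A presentation of `A^!` by generators and relations: the algebra `k[x, y, z]/(J)` is `A^!` as
soon as the relations of either one hold in the other. -/
theorem dualIs_of_relations {ε ε' a b c : k} {J : Set (MvPolynomial (Fin 3) k)}
    (hJ : ∃ W : MvPolynomial (Fin 3) k,
      (MvPolynomial.X 0 ^ 2 - MvPolynomial.C ε * (MvPolynomial.X 1 * MvPolynomial.X 2)) -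
        MvPolynomial.C a * W ∈ Ideal.span J ∧
      (MvPolynomial.X 1 ^ 2 - MvPolynomial.C ε' * (MvPolynomial.X 0 * MvPolynomial.X 2)) -
        MvPolynomial.C b * W ∈ Ideal.span J ∧
      MvPolynomial.X 2 ^ 2 - MvPolynomial.C c * W ∈ Ideal.span J)
    (h : ¬ (a = 0 ∧ b = 0 ∧ c = 0))
    (hrel : ∀ (D : Type u) [CommRing D] [Algebra k D] (p : Fin 3 → D) (W : D),
      p 0 ^ 2 - ε • (p 1 * p 2) = a • W → p 1 ^ 2 - ε' • (p 0 * p 2) = b • W →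
      p 2 ^ 2 = c • W → ∀ q ∈ J, MvPolynomial.aeval p q = 0) :
    DualIs (relE ε ε') (diagForm a b c) J := by
  obtain ⟨W, j0, j1, j2⟩ := hJ
  let I := Ideal.span J
  let p : Fin 3 → (MvPolynomial (Fin 3) k ⧸ I) := fun i => Ideal.Quotient.mk I (MvPolynomial.X i)
  let g : Module.Dual k (Fin 3 → k) →ₗ[k] (MvPolynomial (Fin 3) k ⧸ I) :=
    ∑ i, (LinearMap.toSpanSingleton k _ (p i)) ∘ₗ (LinearMap.applyₗ (bas k i))
  have hg : ∀ i, g (LinearMap.proj i) = p i := by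
    intro i
    simp [g, bas, Pi.single_apply]
  have hsmul : ∀ (c : k) (q : MvPolynomial (Fin 3) k),
      c • Ideal.Quotient.mk I q = Ideal.Quotient.mk I (MvPolynomial.C c * q) := fun c q => by
    rw [← MvPolynomial.smul_eq_C_mul]; rfl
  have hq : ∀ s ∈ orth (conicRel (relE ε ε') (diagForm a b c)), quadEval g s = 0 := by
    intro s hs
    rw [mem_orth_conicRel] at hs
    rw [quadEval_eq_smul (w := Ideal.Quotient.mk I W) g (fun i j => mul_comm _ _) (a := a) (b := b)
      (c := c) (ε := ε) (ε' := ε') ?_ ?_ ?_ hs.1, hs.2, zero_smul]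
    · rw [hg, hg, hg, hsmul, ← map_mul, hsmul, ← map_pow, ← map_sub, Ideal.Quotient.eq]
      exact j0
    · rw [hg, hg, hg, hsmul, ← map_mul, hsmul, ← map_pow, ← map_sub, Ideal.Quotient.eq]
      exact j1
    · rw [hg, hsmul, ← map_pow, Ideal.Quotient.eq]
      exact j2
  obtain ⟨w, hw⟩ := exists_isConicElement (ε := ε) (ε' := ε') h
  have hψ : ∃ ψ : MvPolynomial (Fin 3) k →ₐ[k] QuadDual (conicRel (relE ε ε') (diagForm a b c)),
      (∀ i, ψ (MvPolynomial.X i) = dualGen ε ε' a b c i) ∧ ∀ q ∈ J, ψ q = 0 := by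
    let _ : CommRing (QuadDual (conicRel (relE ε ε') (diagForm a b c))) :=
      { (inferInstance : Ring (QuadDual (conicRel (relE ε ε') (diagForm a b c)))) with
        mul_comm := quadDual_mul_comm ε ε' a b c }
    exact ⟨MvPolynomial.aeval (R := k) (dualGen ε ε' a b c), fun i => MvPolynomial.aeval_X _ i,
      hrel _ (dualGen ε ε' a b c) w hw.eq_x hw.eq_y hw.eq_z⟩
  obtain ⟨ψ, hψ, hψJ⟩ := hψ
  have hψI : ∀ q ∈ I, ψ q = 0 := by
    have : I ≤ RingHom.ker ψ := Ideal.span_le.mpr hψJ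
    exact fun q hq => this hq
  let e₁ := quadLift _ g hq
  let e₂ := Ideal.Quotient.liftₐ I ψ hψI
  have he₁ : ∀ i, e₁ (dualGen ε ε' a b c i) = p i := fun i => by
    rw [← hg]; exact quadLift_quadGen _ _ _ _
  have he₂ : ∀ i, e₂ (p i) = dualGen ε ε' a b c i := hψ
  refine ⟨AlgEquiv.ofAlgHom e₁ e₂ ?_ ?_, he₁⟩
  · apply Ideal.Quotient.algHom_ext
    refine MvPolynomial.algHom_ext fun i => ?_
    change e₁ (e₂ (p i)) = p i
    rw [he₂, he₁]
  · refine quadAlg_hom_ext fun φ => ?_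
    rw [quadGen_eq_sum, map_sum, map_sum]
    refine Finset.sum_congr rfl fun i _ => ?_
    rw [map_smul, map_smul, AlgHom.comp_apply, he₁, he₂]
    rfl

end Models

/-! ### Quotients of the polynomial ring in one variable -/

noncomputable section OneVariable

open Polynomial

variable {k : Type*} [Field k]

theorem exists_eq_sum_pow_of_monic {q : k[X]} (hq : q.Monic) {n : ℕ} (hn : q.natDegree = n)
    (hn0 : n ≠ 0) (t : k[X] ⧸ Ideal.span {q}) :
    ∃ c : Fin n → k, t = ∑ i, c i • Ideal.Quotient.mk (Ideal.span {q}) X ^ (i : ℕ) := by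
  obtain ⟨p, rfl⟩ := Ideal.Quotient.mk_surjective t
  have hlt : (p %ₘ q).natDegree < n := by
    rw [← hn]
    refine natDegree_modByMonic_lt p hq ?_
    rintro rfl
    simp at hn
    omega
  refine ⟨fun i => (p %ₘ q).coeff i, ?_⟩
  have h1 : Ideal.Quotient.mk (Ideal.span {q}) p = Ideal.Quotient.mk (Ideal.span {q}) (p %ₘ q) := by
    rw [Ideal.Quotient.eq, Ideal.mem_span_singleton]
    exact ⟨p /ₘ q, by linear_combination -(modByMonic_add_div p q)⟩
  conv_lhs => rw [h1, as_sum_range' _ n hlt]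
  rw [map_sum, ← Fin.sum_univ_eq_sum_range
    (fun i => Ideal.Quotient.mk (Ideal.span {q}) (monomial i ((p %ₘ q).coeff i))) n]
  refine Finset.sum_congr rfl fun i _ => ?_
  rw [← map_pow, ← C_mul_X_pow_eq_monomial, ← smul_eq_C_mul]
  rfl

theorem mk_self_eq_zero (q : k[X]) : Ideal.Quotient.mk (Ideal.span {q}) q = 0 :=
  Ideal.Quotient.eq_zero_iff_mem.mpr (Ideal.mem_span_singleton_self q)

/-- The generator `u` of `k[u]/(uⁿ)`. -/
abbrev truncGen (k : Type*) [Field k] (n : ℕ) : Trunc1 k n := Ideal.Quotient.mk _ X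

theorem truncGen_pow (n : ℕ) : truncGen k n ^ n = 0 := by
  rw [← map_pow]
  exact mk_self_eq_zero _

theorem truncGen_pow_ne_zero {m n : ℕ} (h : m < n) : truncGen k n ^ m ≠ 0 := by
  rw [← map_pow, Ne, Ideal.Quotient.eq_zero_iff_mem, Ideal.mem_span_singleton]
  intro hd
  exact absurd (le_of_X_pow_dvd_X_pow hd) (by omega)
where
  le_of_X_pow_dvd_X_pow {m n : ℕ} (hd : (X : k[X]) ^ n ∣ X ^ m) : n ≤ m := by
    have := natDegree_le_of_dvd hd (pow_ne_zero _ X_ne_zero)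
    simpa using this

theorem finrank_trunc1 (n : ℕ) : Module.finrank k (Trunc1 k n) = n := by
  rw [finrank_quotient_span_eq_natDegree, natDegree_X_pow]

instance (n : ℕ) [NeZero n] : Module.Finite k (Trunc1 k n) :=
  Module.finite_of_finrank_pos (by rw [finrank_trunc1]; exact NeZero.pos n)

theorem exists_eq_trunc1_two (t : Trunc1 k 2) :
    ∃ c₀ c₁ : k, t = c₀ • 1 + c₁ • truncGen k 2 := by
  obtain ⟨c, rfl⟩ := exists_eq_sum_pow_of_monic (monic_X_pow 2) (natDegree_X_pow 2) two_ne_zero t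
  exact ⟨c 0, c 1, by simp [Fin.sum_univ_two]⟩

theorem quotMul_equiv_prod {p q : k[X]} (h : IsCoprime p q) :
    Nonempty ((k[X] ⧸ Ideal.span {p * q}) ≃ₐ[k]
      (k[X] ⧸ Ideal.span {p}) × (k[X] ⧸ Ideal.span {q})) := by
  rw [← Ideal.span_singleton_mul_span_singleton]
  exact ⟨AlgEquiv.ofRingEquiv (f := Ideal.quotientMulEquivQuotientProd _ _
    ((Ideal.isCoprime_span_singleton_iff _ _).mpr h)) fun _ => rfl⟩

theorem quotXSubCPow_equiv_trunc1 (a : k) (n : ℕ) :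
    Nonempty ((k[X] ⧸ Ideal.span {(X - C a) ^ n}) ≃ₐ[k] Trunc1 k n) :=
  ⟨Ideal.quotientEquivAlg _ _ (algEquivAevalXAddC a) (by
    rw [Ideal.map_span, Set.image_singleton]
    congr 2
    simp)⟩

theorem quotProdXSubC_equiv_pi {n : ℕ} (a : Fin n → k) (ha : Function.Injective a) :
    Nonempty ((k[X] ⧸ Ideal.span {∏ i, (X - C (a i))}) ≃ₐ[k] (Fin n → k)) := by
  let Φ : k[X] →ₐ[k] (Fin n → k) := AlgHom.pi fun i => aeval (a i)
  have hΦ : ∀ p, Φ p = 0 ↔ p ∈ Ideal.span {∏ i, (X - C (a i))} := by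
    intro p
    rw [Ideal.mem_span_singleton]
    constructor
    · intro h
      refine Finset.prod_dvd_of_coprime ?_ ?_
      · intro i _ j _ hij
        exact pairwise_coprime_X_sub_C ha hij
      · intro i _
        rw [dvd_iff_isRoot]
        exact congrFun h i
    · rintro ⟨r, rfl⟩
      ext i
      simp only [Φ, AlgHom.pi_apply, map_mul, map_prod, Pi.zero_apply]
      rw [Finset.prod_eq_zero (Finset.mem_univ i) (by simp), zero_mul]
  let Ψ := Ideal.Quotient.liftₐ (Ideal.span {∏ i, (X - C (a i))}) Φ fun p hp => (hΦ p).mpr hp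
  have hinj : Function.Injective Ψ := by
    rw [injective_iff_map_eq_zero]
    intro t ht
    obtain ⟨p, rfl⟩ := Ideal.Quotient.mk_surjective t
    exact Ideal.Quotient.eq_zero_iff_mem.mpr ((hΦ p).mp ht)
  have hrank : Module.finrank k (k[X] ⧸ Ideal.span {∏ i, (X - C (a i))}) =
      Module.finrank k (Fin n → k) := by
    rw [finrank_quotient_span_eq_natDegree, natDegree_prod_of_monic _ _ fun i _ => monic_X_sub_C _]
    simp
  have hfin : Module.Finite k (k[X] ⧸ Ideal.span {∏ i, (X - C (a i))}) :=
    Module.Finite.of_injective Ψ.toLinearMap hinj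
  exact ⟨AlgEquiv.ofBijective Ψ ⟨hinj, (LinearMap.injective_iff_surjective_of_finrank_eq_finrank
    (f := Ψ.toLinearMap) hrank).mp hinj⟩⟩

theorem isCoprime_X_sub_C {a b : k} (h : a ≠ b) : IsCoprime (X - C a) (X - C b) :=
  isCoprime_X_sub_C_of_isUnit_sub (sub_ne_zero.mpr h).isUnit

theorem quot_equiv_of_distinct {q : k[X]} {a b c d : k} (hab : a ≠ b) (hac : a ≠ c) (had : a ≠ d)
    (hbc : b ≠ c) (hbd : b ≠ d) (hcd : c ≠ d)
    (hq : q = (X - C a) * (X - C b) * (X - C c) * (X - C d)) :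
    Nonempty ((k[X] ⧸ Ideal.span {q}) ≃ₐ[k] (Fin 4 → k)) := by
  have h : q = ∏ i, (X - C (![a, b, c, d] i)) := by
    simp [Fin.prod_univ_four, hq]
  rw [h]
  refine quotProdXSubC_equiv_pi _ ?_
  intro i j hij
  fin_cases i <;> fin_cases j <;> simp_all [eq_comm]

theorem quot_equiv_of_double {q : k[X]} {a b c : k} (hab : a ≠ b) (hac : a ≠ c) (hbc : b ≠ c)
    (hq : q = (X - C a) ^ 2 * ((X - C b) * (X - C c))) :
    Nonempty ((k[X] ⧸ Ideal.span {q}) ≃ₐ[k] Trunc1 k 2 × (Fin 2 → k)) := by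
  subst hq
  obtain ⟨e₁⟩ := quotMul_equiv_prod (p := (X - C a) ^ 2) (q := (X - C b) * (X - C c))
    (((isCoprime_X_sub_C hab).mul_right (isCoprime_X_sub_C hac)).pow_left)
  obtain ⟨e₂⟩ := quotXSubCPow_equiv_trunc1 a 2
  obtain ⟨e₃⟩ := quotProdXSubC_equiv_pi ![b, c] (by
    intro i j hij
    fin_cases i <;> fin_cases j <;> simp_all [eq_comm])
  rw [Fin.prod_univ_two] at e₃
  exact ⟨e₁.trans (AlgEquiv.prodCongr e₂ e₃)⟩

theorem quot_equiv_of_triple {q : k[X]} {a b : k} (hab : a ≠ b)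
    (hq : q = (X - C a) ^ 3 * (X - C b)) :
    Nonempty ((k[X] ⧸ Ideal.span {q}) ≃ₐ[k] Trunc1 k 3 × k) := by
  subst hq
  obtain ⟨e₁⟩ := quotMul_equiv_prod (p := (X - C a) ^ 3) (q := X - C b)
    ((isCoprime_X_sub_C hab).pow_left)
  obtain ⟨e₂⟩ := quotXSubCPow_equiv_trunc1 a 3
  exact ⟨e₁.trans (AlgEquiv.prodCongr e₂ (quotientSpanXSubCAlgEquiv b))⟩

/-! ### The three algebras are told apart by their nilpotent elements -/

theorem not_equiv_pi_of_sq_eq_zero {E : Type*} [Ring E] [Algebra k E] {n : ℕ} {t : E} (ht : t ≠ 0)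
    (ht2 : t ^ 2 = 0) : ¬ Nonempty (E ≃ₐ[k] (Fin n → k)) := by
  rintro ⟨e⟩
  have h := congrArg e ht2
  rw [map_pow, map_zero] at h
  exact ht ((map_eq_zero_iff e e.injective).mp (pow_eq_zero_iff two_ne_zero |>.mp h))

theorem double_not_equiv_pi (n : ℕ) :
    ¬ Nonempty ((Trunc1 k 2 × (Fin 2 → k)) ≃ₐ[k] (Fin n → k)) :=
  not_equiv_pi_of_sq_eq_zero (t := (truncGen k 2, 0))
    (fun h => truncGen_pow_ne_zero (k := k) one_lt_two (by simpa using congrArg Prod.fst h))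
    (by ext1 <;> simp [truncGen_pow])

theorem triple_not_equiv_pi (n : ℕ) : ¬ Nonempty ((Trunc1 k 3 × k) ≃ₐ[k] (Fin n → k)) :=
  not_equiv_pi_of_sq_eq_zero (t := (truncGen k 3 ^ 2, 0))
    (fun h => truncGen_pow_ne_zero (k := k) (n := 3) (m := 2) (by omega) (congrArg Prod.fst h))
    (by
      ext1
      · change (truncGen k 3 ^ 2) ^ 2 = 0
        rw [← pow_mul]
        exact pow_eq_zero_of_le (by omega) (truncGen_pow 3)
      · simp)

theorem triple_not_equiv_double :
    ¬ Nonempty ((Trunc1 k 3 × k) ≃ₐ[k] (Trunc1 k 2 × (Fin 2 → k))) := by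
  rintro ⟨e⟩
  let t : Trunc1 k 3 × k := (truncGen k 3, 0)
  have h3 : t ^ 3 = 0 := by ext1 <;> simp [t, truncGen_pow]
  have h2 : t ^ 2 ≠ 0 := fun h =>
    truncGen_pow_ne_zero (k := k) (n := 3) (m := 2) (by omega) (congrArg Prod.fst h)
  have h3' : e t ^ 3 = 0 := by rw [← map_pow, h3, map_zero]
  have hs : e t ^ 2 = 0 := by
    have hb : (e t).2 = 0 := by
      have : (e t).2 ^ 3 = 0 := congrArg Prod.snd h3'
      exact pow_eq_zero_iff three_ne_zero |>.mp this
    have ha : (e t).1 ^ 3 = 0 := congrArg Prod.fst h3'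
    obtain ⟨c₀, c₁, hc⟩ := exists_eq_trunc1_two (e t).1
    have hu := truncGen_pow (k := k) 2
    have hsmul : ∀ (c : k) (t : Trunc1 k 2), c • t = algebraMap k _ c * t :=
      fun c t => Algebra.smul_def c t
    have hc0 : c₀ = 0 := by
      by_contra h0
      have h5 : (e t).1 ^ 3 * truncGen k 2 = c₀ ^ 3 • truncGen k 2 := by
        rw [hc]
        simp only [hsmul, map_pow]
        linear_combination (3 * algebraMap k (Trunc1 k 2) c₀ ^ 2 * algebraMap k (Trunc1 k 2) c₁ +
          3 * algebraMap k (Trunc1 k 2) c₀ * algebraMap k (Trunc1 k 2) c₁ ^ 2 * truncGen k 2 +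
          algebraMap k (Trunc1 k 2) c₁ ^ 3 * truncGen k 2 ^ 2) * hu
      rw [ha, zero_mul] at h5
      exact (smul_ne_zero (pow_ne_zero 3 h0)
        (by simpa using truncGen_pow_ne_zero (k := k) one_lt_two)) h5.symm
    ext1
    · change (e t).1 ^ 2 = 0
      rw [hc, hc0, zero_smul, zero_add, _root_.smul_pow, hu, smul_zero]
    · change (e t).2 ^ 2 = 0
      rw [hb, zero_pow two_ne_zero]
  rw [← map_pow] at hs
  exact h2 ((map_eq_zero_iff e e.injective).mp hs)

/-! ### The quartic `u⁴ - 2 β u² - u - α + β²` -/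

theorem quartic_eq (α β : k) :
    quartic α β = X ^ 4 + (-C (2 * β) * X ^ 2 - X - C α + C (β ^ 2)) := by
  rw [quartic]; ring

theorem quartic_natDegree_and_monic (α β : k) :
    (quartic α β).natDegree = 4 ∧ (quartic α β).Monic := by
  have h : (-C (2 * β) * X ^ 2 - X - C α + C (β ^ 2)).degree < ((4 : ℕ) : WithBot ℕ) := by
    refine lt_of_le_of_lt ?_ (show ((2 : ℕ) : WithBot ℕ) < ((4 : ℕ) : WithBot ℕ) by norm_num)
    rw [← C_neg]
    compute_degree
    exact le_rfl
  rw [quartic_eq]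
  have hm := monic_X_pow_add h
  refine ⟨?_, hm⟩
  rw [natDegree_add_eq_left_of_degree_lt (by rwa [degree_X_pow]), natDegree_X_pow]

/-- Vieta's formulas for the quartic. -/
theorem quartic_eq_prod_iff (α β a b c d : k) :
    quartic α β = (X - C a) * (X - C b) * (X - C c) * (X - C d) ↔
      a + b + c + d = 0 ∧ a * b + a * c + a * d + b * c + b * d + c * d = -2 * β ∧
      a * b * c + a * b * d + a * c * d + b * c * d = 1 ∧ a * b * c * d = β ^ 2 - α := by
  have hprod : (X - C a) * (X - C b) * (X - C c) * (X - C d) =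
      X ^ 4 - C (a + b + c + d) * X ^ 3 +
        C (a * b + a * c + a * d + b * c + b * d + c * d) * X ^ 2 -
        C (a * b * c + a * b * d + a * c * d + b * c * d) * X + C (a * b * c * d) := by
    simp only [map_add, map_mul]
    ring
  constructor
  · intro h
    rw [hprod, quartic] at h
    have h0 := congrArg (coeff · 0) h
    have h1 := congrArg (coeff · 1) h
    have h2 := congrArg (coeff · 2) h
    have h3 := congrArg (coeff · 3) h
    simp [coeff_X, coeff_C, coeff_X_pow, -map_add, -map_mul, -map_pow] at h0 h1 h2 h3
    exact ⟨by linear_combination h3, by linear_combination -h2, by linear_combination h1,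
      by linear_combination -h0⟩
  · rintro ⟨h1, h2, h3, h4⟩
    rw [hprod, h1, h2, h3, h4, quartic]
    simp only [map_mul, map_neg, map_sub, map_pow, map_zero, map_one]
    ring

/-- `discN α β` is the discriminant of the quartic. -/
theorem discN_eq_prod_sq [CharZero k] {α β a b c d : k}
    (h : quartic α β = (X - C a) * (X - C b) * (X - C c) * (X - C d)) :
    discN α β = ((a - b) * (a - c) * (a - d) * (b - c) * (b - d) * (c - d)) ^ 2 := by
  obtain ⟨h1, h2, h3, h4⟩ := (quartic_eq_prod_iff α β a b c d).mp h
  have hd : d = -(a + b + c) := by linear_combination h1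
  subst hd
  have hβ : β = -(a * b + a * c + a * -(a + b + c) + b * c + b * -(a + b + c) +
      c * -(a + b + c)) / 2 := by
    rw [h2]; field_simp
  have hα : α = β ^ 2 - a * b * c * -(a + b + c) := by linear_combination h4
  have hdisc : ∀ p q r : k, q ^ 2 = 1 → p = -2 * β → r = β ^ 2 - α →
      discN α β = 16 * p ^ 4 * r - 4 * p ^ 3 * q ^ 2 - 128 * p ^ 2 * r ^ 2 + 144 * p * q ^ 2 * r -
        27 * q ^ 4 + 256 * r ^ 3 := by
    intro p q r hq hp hr
    rw [show q ^ 4 = (q ^ 2) ^ 2 by ring, hq, hp, hr, discN]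
    ring
  rw [hdisc _ (-(a * b * c + a * b * -(a + b + c) + a * c * -(a + b + c) + b * c * -(a + b + c))) _
    (by rw [h3]; ring) h2 h4]
  ring

/-- The coefficient of `u` in the quartic being `-1`, its roots are distinct, or a double root and
two simple ones, or a triple root and a simple one. -/
theorem quartic_root_types [IsAlgClosed k] [CharZero k] (α β : k) :
    (∃ a b c d : k, (a ≠ b ∧ a ≠ c ∧ a ≠ d ∧ b ≠ c ∧ b ≠ d ∧ c ≠ d) ∧
      quartic α β = (X - C a) * (X - C b) * (X - C c) * (X - C d)) ∨
    (∃ a b c : k, (a ≠ b ∧ a ≠ c ∧ b ≠ c) ∧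
      quartic α β = (X - C a) * (X - C a) * (X - C b) * (X - C c)) ∨
    (∃ a b : k, a ≠ b ∧ quartic α β = (X - C a) * (X - C a) * (X - C a) * (X - C b)) := by
  obtain ⟨hdeg, hmon⟩ := quartic_natDegree_and_monic α β
  have hsp := IsAlgClosed.splits (quartic α β)
  have hcard : (quartic α β).roots.card = 4 := by
    rw [IsAlgClosed.card_roots_eq_natDegree, hdeg]
  obtain ⟨a, b, c, d, hr⟩ := Multiset.card_eq_four.mp hcard
  have hq : quartic α β = (X - C a) * (X - C b) * (X - C c) * (X - C d) := by
    rw [hsp.eq_prod_roots_of_monic hmon, hr]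
    simp [mul_assoc]
  have key : ∀ a c d : k, quartic α β = (X - C a) * (X - C a) * (X - C c) * (X - C d) →
      (∃ a b c : k, (a ≠ b ∧ a ≠ c ∧ b ≠ c) ∧
        quartic α β = (X - C a) * (X - C a) * (X - C b) * (X - C c)) ∨
      (∃ a b : k, a ≠ b ∧ quartic α β = (X - C a) * (X - C a) * (X - C a) * (X - C b)) := by
    intro a c d h
    have hcd : c ≠ d := by
      rintro rfl
      obtain ⟨h1, -, h3, -⟩ := (quartic_eq_prod_iff α β a a c c).mp h
      have : c = -a := by
        have h2 : (2 : k) ≠ 0 := two_ne_zero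
        apply mul_left_cancel₀ h2
        linear_combination h1
      subst this
      have : (0 : k) = 1 := by linear_combination h3
      exact zero_ne_one this
    by_cases hac : a = c
    · subst hac
      exact Or.inr ⟨a, d, hcd, h⟩
    · by_cases had : a = d
      · subst had
        exact Or.inr ⟨a, c, hac, by rw [h]; ring⟩
      · exact Or.inl ⟨a, c, d, ⟨hac, had, hcd⟩, h⟩
  by_cases hab : a = b
  · subst hab; exact Or.inr (key a c d hq)
  by_cases hac : a = c
  · subst hac; exact Or.inr (key a b d (by rw [hq]; ring))
  by_cases had : a = d
  · subst had; exact Or.inr (key a b c (by rw [hq]; ring))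
  by_cases hbc : b = c
  · subst hbc; exact Or.inr (key b a d (by rw [hq]; ring))
  by_cases hbd : b = d
  · subst hbd; exact Or.inr (key b a c (by rw [hq]; ring))
  by_cases hcd : c = d
  · subst hcd; exact Or.inr (key c a b (by rw [hq]; ring))
  exact Or.inl ⟨a, b, c, d, ⟨hab, hac, had, hbc, hbd, hcd⟩, hq⟩

theorem quartic_triple_iff [CharZero k] (α β : k) :
    (∃ a b : k, a ≠ b ∧ quartic α β = (X - C a) * (X - C a) * (X - C a) * (X - C b)) ↔
      ∃ μ : k, μ ^ 3 = 1 ∧ α = 3 / 4 * μ ∧ β = 3 / 4 * μ ^ 2 := by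
  constructor
  · rintro ⟨a, b, -, h⟩
    obtain ⟨h1, h2, h3, h4⟩ := (quartic_eq_prod_iff α β a a a b).mp h
    have hb : b = -3 * a := by linear_combination h1
    subst hb
    have ha : -8 * a ^ 3 = 1 := by linear_combination h3
    have hβ : β = 3 * a ^ 2 := by
      apply mul_left_cancel₀ (two_ne_zero' k)
      linear_combination h2
    refine ⟨-2 * a, by linear_combination ha, ?_, by rw [hβ]; field_simp; ring⟩
    have hα : α = 12 * a ^ 4 := by
      rw [hβ] at h4
      linear_combination h4
    rw [hα]
    field_simp
    linear_combination (-6 * a) * ha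
  · rintro ⟨μ, hμ, rfl, rfl⟩
    refine ⟨-μ / 2, 3 * μ / 2, ?_, ?_⟩
    · intro h
      have h0 : μ = 0 := by
        apply mul_left_cancel₀ (two_ne_zero' k)
        field_simp at h
        linear_combination (-1 / 2 : k) * h
      rw [h0] at hμ
      norm_num at hμ
    · rw [quartic_eq_prod_iff]
      refine ⟨by ring, by ring, ?_, ?_⟩
      · linear_combination hμ
      · linear_combination (-3 / 4 * μ) * hμ

theorem quot_quartic_equiv_pi_iff [IsAlgClosed k] [CharZero k] (α β : k) :
    Nonempty ((k[X] ⧸ Ideal.span {quartic α β}) ≃ₐ[k] (Fin 4 → k)) ↔ discN α β ≠ 0 := by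
  rcases quartic_root_types α β with ⟨a, b, c, d, ⟨hab, hac, had, hbc, hbd, hcd⟩, h⟩ |
    ⟨a, b, c, ⟨hab, hac, hbc⟩, h⟩ | ⟨a, b, hab, h⟩
  · refine iff_of_true (quot_equiv_of_distinct hab hac had hbc hbd hcd h) ?_
    rw [discN_eq_prod_sq h]
    exact pow_ne_zero 2 (mul_ne_zero (mul_ne_zero (mul_ne_zero (mul_ne_zero (mul_ne_zero
      (sub_ne_zero.mpr hab) (sub_ne_zero.mpr hac)) (sub_ne_zero.mpr had)) (sub_ne_zero.mpr hbc))
      (sub_ne_zero.mpr hbd)) (sub_ne_zero.mpr hcd))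
  · refine iff_of_false ?_ (by rw [discN_eq_prod_sq h]; simp)
    rintro ⟨e⟩
    obtain ⟨e'⟩ := quot_equiv_of_double hab hac hbc (h.trans (by ring))
    exact double_not_equiv_pi 4 ⟨e'.symm.trans e⟩
  · refine iff_of_false ?_ (by rw [discN_eq_prod_sq h]; simp)
    rintro ⟨e⟩
    obtain ⟨e'⟩ := quot_equiv_of_triple hab (h.trans (by ring))
    exact triple_not_equiv_pi 4 ⟨e'.symm.trans e⟩

theorem quot_quartic_equiv_triple_iff [IsAlgClosed k] [CharZero k] (α β : k) :
    Nonempty ((k[X] ⧸ Ideal.span {quartic α β}) ≃ₐ[k] Trunc1 k 3 × k) ↔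
      ∃ μ : k, μ ^ 3 = 1 ∧ α = 3 / 4 * μ ∧ β = 3 / 4 * μ ^ 2 := by
  rw [← quartic_triple_iff]
  constructor
  · rintro ⟨e⟩
    rcases quartic_root_types α β with ⟨a, b, c, d, ⟨hab, hac, had, hbc, hbd, hcd⟩, h⟩ |
      ⟨a, b, c, ⟨hab, hac, hbc⟩, h⟩ | h
    · obtain ⟨e'⟩ := quot_equiv_of_distinct hab hac had hbc hbd hcd h
      exact absurd ⟨e.symm.trans e'⟩ (triple_not_equiv_pi 4)
    · obtain ⟨e'⟩ := quot_equiv_of_double hab hac hbc (h.trans (by ring))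
      exact absurd ⟨e.symm.trans e'⟩ triple_not_equiv_double
    · exact h
  · rintro ⟨a, b, hab, h⟩
    exact quot_equiv_of_triple hab (h.trans (by ring))

theorem quot_quartic_equiv_double_iff [IsAlgClosed k] [CharZero k] (α β : k) :
    Nonempty ((k[X] ⧸ Ideal.span {quartic α β}) ≃ₐ[k] Trunc1 k 2 × (Fin 2 → k)) ↔
      discN α β = 0 ∧ ¬ ∃ μ : k, μ ^ 3 = 1 ∧ α = 3 / 4 * μ ∧ β = 3 / 4 * μ ^ 2 := by
  rw [← quot_quartic_equiv_triple_iff, ← not_not (a := discN α β = 0), ← Ne,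
    ← quot_quartic_equiv_pi_iff]
  constructor
  · rintro ⟨e⟩
    refine ⟨?_, ?_⟩
    · rintro ⟨e'⟩
      exact double_not_equiv_pi 4 ⟨e.symm.trans e'⟩
    · rintro ⟨e'⟩
      exact triple_not_equiv_double ⟨e'.symm.trans e⟩
  · rintro ⟨hd, ht⟩
    rcases quartic_root_types α β with ⟨a, b, c, d, ⟨hab, hac, had, hbc, hbd, hcd⟩, h⟩ |
      ⟨a, b, c, ⟨hab, hac, hbc⟩, h⟩ | ⟨a, b, hab, h⟩
    · exact absurd (quot_equiv_of_distinct hab hac had hbc hbd hcd h) hd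
    · exact quot_equiv_of_double hab hac hbc (h.trans (by ring))
    · exact absurd (quot_equiv_of_triple hab (h.trans (by ring))) ht

end OneVariable

/-! ### The algebras `C(A)` of the table -/

noncomputable section Table

variable {k : Type*} [Field k]

theorem cAlgIs_iff {V B B' : Type*} [AddCommGroup V] [Module k V] [Ring B] [Algebra k B] [Ring B']
    [Algebra k B'] {R : Submodule k (V ⊗[k] V)} {f : V ⊗[k] V} (h : CAlgIs R f B) :
    CAlgIs R f B' ↔ Nonempty (B ≃ₐ[k] B') := by
  obtain ⟨⟨w, hw⟩, hB⟩ := h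
  constructor
  · intro h'
    obtain ⟨e⟩ := hB w hw
    obtain ⟨e'⟩ := h'.2 w hw
    exact ⟨e.symm.trans e'⟩
  · rintro ⟨e'⟩
    refine ⟨⟨w, hw⟩, fun v hv => ?_⟩
    obtain ⟨e⟩ := hB v hv
    exact ⟨e.trans e'⟩

/-! #### `k[u, v]/(u², v²)` -/

theorem trunc2_X_sq (i : Fin 2) :
    (Ideal.Quotient.mk _ (MvPolynomial.X i) : Trunc2 k) ^ 2 = 0 := by
  rw [← map_pow, Ideal.Quotient.eq_zero_iff_mem]
  exact Ideal.subset_span (by fin_cases i <;> simp)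

theorem exists_eq_trunc2 (t : Trunc2 k) : ∃ c₀ c₁ c₂ c₃ : k,
    t = c₀ • 1 + c₁ • (Ideal.Quotient.mk _ (MvPolynomial.X 0) : Trunc2 k) +
      c₂ • (Ideal.Quotient.mk _ (MvPolynomial.X 1) : Trunc2 k) +
      c₃ • ((Ideal.Quotient.mk _ (MvPolynomial.X 0) : Trunc2 k) *
        (Ideal.Quotient.mk _ (MvPolynomial.X 1) : Trunc2 k)) := by
  have hsmul : ∀ (c : k) (t : Trunc2 k), c • t = algebraMap k _ c * t :=
    fun c t => Algebra.smul_def c t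
  have hu := trunc2_X_sq (k := k) 0
  have hv := trunc2_X_sq (k := k) 1
  obtain ⟨p, rfl⟩ := Ideal.Quotient.mk_surjective t
  set u : Trunc2 k := Ideal.Quotient.mk _ (MvPolynomial.X 0)
  set v : Trunc2 k := Ideal.Quotient.mk _ (MvPolynomial.X 1)
  simp only [hsmul]
  induction p using MvPolynomial.induction_on with
  | C a => exact ⟨a, 0, 0, 0, by simp; rfl⟩
  | add p q hp hq =>
    obtain ⟨a₀, a₁, a₂, a₃, ha⟩ := hp
    obtain ⟨b₀, b₁, b₂, b₃, hb⟩ := hq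
    refine ⟨a₀ + b₀, a₁ + b₁, a₂ + b₂, a₃ + b₃, ?_⟩
    rw [map_add, ha, hb]
    simp only [map_add]
    ring
  | mul_X p i hp =>
    obtain ⟨a₀, a₁, a₂, a₃, ha⟩ := hp
    rw [map_mul, ha]
    fin_cases i
    · refine ⟨0, a₀, 0, a₂, ?_⟩
      change _ * u = _
      rw [map_zero]
      linear_combination (algebraMap k (Trunc2 k) a₁ + algebraMap k (Trunc2 k) a₃ * v) * hu
    · refine ⟨0, 0, a₀, a₁, ?_⟩
      change _ * v = _
      rw [map_zero]
      linear_combination (algebraMap k (Trunc2 k) a₂ + algebraMap k (Trunc2 k) a₃ * u) * hv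

theorem linearIndependent_of_dualNumber {T : Type*} [CommRing T] [Algebra k T]
    (ψ : T →ₐ[k] DualNumber (DualNumber k)) {u v : T}
    (hu : ψ u = TrivSqZeroExt.inl DualNumber.eps) (hv : ψ v = DualNumber.eps) :
    LinearIndependent k ![1, u, v, u * v] := by
  rw [Fintype.linearIndependent_iff]
  intro c hc
  have h := congrArg ψ hc
  simp only [map_add, map_smul, Fin.sum_univ_four, Matrix.cons_val, map_mul, map_one, hu, hv,
    map_zero] at h
  have h00 := congrArg (fun t => TrivSqZeroExt.fst (TrivSqZeroExt.fst t)) h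
  have h01 := congrArg (fun t => TrivSqZeroExt.snd (TrivSqZeroExt.fst t)) h
  have h10 := congrArg (fun t => TrivSqZeroExt.fst (TrivSqZeroExt.snd t)) h
  have h11 := congrArg (fun t => TrivSqZeroExt.snd (TrivSqZeroExt.snd t)) h
  simp at h00 h01 h10 h11
  intro i
  fin_cases i
  · exact h00
  · exact h01
  · exact h10
  · exact h11

theorem finrank_trunc2 : Module.finrank k (Trunc2 k) = 4 := by
  let φ : MvPolynomial (Fin 2) k →ₐ[k] DualNumber (DualNumber k) :=
    MvPolynomial.aeval (R := k) (S₁ := DualNumber (DualNumber k))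
      ![TrivSqZeroExt.inl DualNumber.eps, DualNumber.eps]
  have hφ : ∀ p ∈ Ideal.span {(MvPolynomial.X 0 : MvPolynomial (Fin 2) k) ^ 2,
      MvPolynomial.X 1 ^ 2}, φ p = 0 := by
    have : Ideal.span {(MvPolynomial.X 0 : MvPolynomial (Fin 2) k) ^ 2,
        MvPolynomial.X 1 ^ 2} ≤ RingHom.ker φ := by
      rw [Ideal.span_le]
      rintro _ (rfl | rfl)
      · simp [RingHom.mem_ker, φ, pow_two, ← TrivSqZeroExt.inl_mul]
      · simp [RingHom.mem_ker, φ, pow_two]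
    exact fun p hp => this hp
  let ψ : Trunc2 k →ₐ[k] DualNumber (DualNumber k) := Ideal.Quotient.liftₐ _ φ hφ
  let b : Fin 4 → Trunc2 k := ![1, Ideal.Quotient.mk _ (MvPolynomial.X 0),
    Ideal.Quotient.mk _ (MvPolynomial.X 1),
    (Ideal.Quotient.mk _ (MvPolynomial.X 0) : Trunc2 k) *
      (Ideal.Quotient.mk _ (MvPolynomial.X 1) : Trunc2 k)]
  have hψ0 : ψ (Ideal.Quotient.mk _ (MvPolynomial.X 0)) = TrivSqZeroExt.inl DualNumber.eps := by
    change φ _ = _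
    simp [φ]
  have hψ1 : ψ (Ideal.Quotient.mk _ (MvPolynomial.X 1)) = DualNumber.eps := by
    change φ _ = _
    simp [φ]
  have hli : LinearIndependent k b := linearIndependent_of_dualNumber ψ hψ0 hψ1
  have hsp : ⊤ ≤ Submodule.span k (Set.range b) := by
    rintro t -
    obtain ⟨c₀, c₁, c₂, c₃, rfl⟩ := exists_eq_trunc2 t
    rw [Submodule.mem_span_range_iff_exists_fun]
    exact ⟨![c₀, c₁, c₂, c₃], by simp [Fin.sum_univ_four, b]⟩
  rw [Module.finrank_eq_card_basis (Module.Basis.mk hli hsp), Fintype.card_fin]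

theorem cAlgIs_trunc2 (ε : k) : CAlgIs (relE ε 0) (diagForm 1 0 0) (Trunc2 k) := by
  have hu := trunc2_X_sq (k := k) 0
  have hv := trunc2_X_sq (k := k) 1
  have hs := exists_eq_trunc2 (k := k)
  have hr := finrank_trunc2 (k := k)
  generalize (Ideal.Quotient.mk _ (MvPolynomial.X 0) : Trunc2 k) = u at hu hs
  generalize (Ideal.Quotient.mk _ (MvPolynomial.X 1) : Trunc2 k) = v at hv hs
  refine cAlgIs_of_point (by simp) hr ![1, u, v] (W := 1 - ε • (u * v)) ?_ ?_ ?_ ?_ 1 rfl hs ?_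
  · refine IsNilpotent.isUnit_one_sub ⟨2, ?_⟩
    rw [_root_.smul_pow, mul_pow, hu, zero_mul, smul_zero]
  · simp
  · simpa using hu
  · simpa using hv
  · exact ⟨0, 0, 0, by simpa using hv⟩

/-! #### `k[u]/(u⁴)` -/

theorem exists_eq_of_monic_quartic {q : Polynomial k} (hq : q.Monic) (hn : q.natDegree = 4)
    (t : Polynomial k ⧸ Ideal.span {q}) : ∃ c₀ c₁ c₂ c₃ : k,
      t = c₀ • 1 + c₁ • Ideal.Quotient.mk (Ideal.span {q}) Polynomial.X +
        c₂ • Ideal.Quotient.mk (Ideal.span {q}) Polynomial.X ^ 2 +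
        c₃ • Ideal.Quotient.mk (Ideal.span {q}) Polynomial.X ^ 3 := by
  obtain ⟨c, rfl⟩ := exists_eq_sum_pow_of_monic hq hn (by norm_num) t
  exact ⟨c 0, c 1, c 2, c 3, by simp [Fin.sum_univ_four]⟩

theorem cAlgIs_trunc1_four (ε' : k) : CAlgIs (relE 1 ε') (diagForm 0 1 0) (Trunc1 k 4) := by
  have hs := exists_eq_of_monic_quartic (k := k) (Polynomial.monic_X_pow 4)
    (Polynomial.natDegree_X_pow 4)
  have hu := truncGen_pow (k := k) 4
  change ∀ t : Trunc1 k 4, ∃ c₀ c₁ c₂ c₃ : k, t = c₀ • 1 + c₁ • truncGen k 4 +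
    c₂ • truncGen k 4 ^ 2 + c₃ • truncGen k 4 ^ 3 at hs
  generalize truncGen k 4 = u at hu hs
  refine cAlgIs_of_point (by simp) (finrank_trunc1 4) ![u, 1, u ^ 2] (W := 1 - ε' • u ^ 3)
    ?_ ?_ ?_ ?_ (Equiv.swap 0 1) rfl ?_ ?_
  · refine IsNilpotent.isUnit_one_sub ⟨4, ?_⟩
    rw [_root_.smul_pow, ← pow_mul, mul_comm, pow_mul, hu, zero_pow three_ne_zero, smul_zero]
  · simp
  · simp [← pow_succ']
  · simp [← pow_mul, hu]
  · intro t
    obtain ⟨c₀, c₁, c₂, c₃, h⟩ := hs t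
    exact ⟨c₀, c₁, c₂, c₃, by rw [h, pow_succ' u 2]; rfl⟩
  · exact ⟨0, 0, 0, by simp [Equiv.swap_apply_of_ne_of_ne, ← pow_mul, hu]⟩

/-! #### `k[u]/(u²) × k[u]/(u²)` -/

/-- The point with first coordinate `s + c u` over `k[u]/(u²)` of the pencil, where `s² = α`. -/
theorem pencil_point_of_sq_eq_zero {T : Type*} [CommRing T] [Algebra k T] {u : T} (hu : u ^ 2 = 0)
    {ε ε' α s c : k} (hs : s ^ 2 = α) (hc : 2 * s * c = ε - ε' * α * s) :
    (s • 1 + c • u) ^ 2 - ε • (1 * u) = α • (1 - ε' • ((s • 1 + c • u) * u)) := by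
  have hs' := congrArg (algebraMap k T) hs
  have hc' := congrArg (algebraMap k T) hc
  simp only [map_pow, map_mul, map_sub, map_ofNat] at hs' hc'
  simp only [Algebra.smul_def]
  linear_combination (algebraMap k T c ^ 2 + algebraMap k T α * algebraMap k T ε' *
    algebraMap k T c) * hu + hs' + u * hc'

theorem cAlgIs_trunc1_two_prod [IsAlgClosed k] [CharZero k] (ε ε' : k) {α : k} (hα : α ≠ 0) :
    CAlgIs (relE ε ε') (diagForm α 1 0) (Trunc1 k 2 × Trunc1 k 2) := by
  obtain ⟨s, hs⟩ := IsAlgClosed.exists_pow_nat_eq α two_pos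
  have hs0 : s ≠ 0 := by rintro rfl; exact hα (by rw [← hs]; ring)
  have hex := exists_eq_trunc1_two (k := k)
  have hu := truncGen_pow (k := k) 2
  generalize truncGen k 2 = u at hu hex
  -- The square roots of `α` modulo `z` lift to solutions of `x² - ε z = α (1 - ε' x z)`.
  obtain ⟨c, hc⟩ : ∃ c : k, 2 * s * c = ε - ε' * α * s :=
    ⟨(ε - ε' * α * s) / (2 * s), by field_simp⟩
  obtain ⟨d, hd⟩ : ∃ d : k, 2 * (-s) * d = ε - ε' * α * (-s) :=
    ⟨(ε - ε' * α * (-s)) / (2 * (-s)), by field_simp⟩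
  have hx1 := pencil_point_of_sq_eq_zero hu hs hc
  have hx2 := pencil_point_of_sq_eq_zero hu (show (-s) ^ 2 = α by rw [neg_sq, hs]) hd
  have hz : ((u, u) : Trunc1 k 2 × Trunc1 k 2) ^ 2 = 0 := Prod.ext hu hu
  refine cAlgIs_of_point (by simp) (by simp [Module.finrank_prod, finrank_trunc1])
    ![(s • 1 + c • u, (-s) • 1 + d • u), 1, (u, u)]
    (W := 1 - ε' • ((s • 1 + c • u, (-s) • 1 + d • u) * (u, u)))
    ?_ ?_ ?_ ?_ (Equiv.swap 0 1) rfl ?_ ?_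
  · refine IsNilpotent.isUnit_one_sub ⟨2, ?_⟩
    rw [_root_.smul_pow, mul_pow, hz, mul_zero, smul_zero]
  · exact Prod.ext hx1 hx2
  · simp
  · simpa using hz
  · rintro ⟨t₁, t₂⟩
    obtain ⟨a₀, a₁, rfl⟩ := hex t₁
    obtain ⟨b₀, b₁, rfl⟩ := hex t₂
    have h2 : (2 : k) ≠ 0 := two_ne_zero
    have key : ∀ {T : Type _} [CommRing T] [Algebra k T] (u : T), u ^ 2 = 0 →
        ∀ r e c₀ c₁ c₂ c₃ : k, c₀ • (1 : T) + c₁ • (r • 1 + e • u) + c₂ • u +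
          c₃ • ((r • 1 + e • u) * u) = (c₀ + c₁ * r) • 1 + (c₁ * e + c₂ + c₃ * r) • u := by
      intro T _ _ u hu r e c₀ c₁ c₂ c₃
      simp only [Algebra.smul_def, map_add, map_mul]
      linear_combination (algebraMap k T c₃ * algebraMap k T e) * hu
    refine ⟨(a₀ + b₀) / 2, (a₀ - b₀) / (2 * s),
      (a₁ + b₁ - (a₀ - b₀) / (2 * s) * (c + d)) / 2,
      (a₁ - b₁ - (a₀ - b₀) / (2 * s) * (c - d)) / (2 * s), Prod.ext ?_ ?_⟩
    · refine Eq.trans ?_ (key u hu s c _ _ _ _).symm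
      refine congrArg₂ (· + ·) (congrArg (· • 1) ?_) (congrArg (· • u) ?_) <;> field_simp <;> ring
    · refine Eq.trans ?_ (key u hu (-s) d _ _ _ _).symm
      refine congrArg₂ (· + ·) (congrArg (· • 1) ?_) (congrArg (· • u) ?_) <;> field_simp <;> ring
  · exact ⟨0, 0, 0, by
      simpa [Equiv.swap_apply_of_ne_of_ne] using hz⟩

/-! #### `k⁴` and quotients of `k[u]` by a quartic -/

theorem cAlgIs_pi_four [CharZero k] : CAlgIs (relE (0 : k) 0) (diagForm 1 1 1) (Fin 4 → k) := by
  refine cAlgIs_of_point (by simp) (by simp) ![1, ![1, 1, -1, -1], ![1, -1, 1, -1]] (W := 1)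
    isUnit_one ?_ ?_ ?_ 1 rfl ?_ ?_
  · simp
  · ext i; fin_cases i <;> simp
  · ext i; fin_cases i <;> simp
  · intro t
    refine ⟨(t 0 + t 1 + t 2 + t 3) / 4, (t 0 + t 1 - t 2 - t 3) / 4,
      (t 0 - t 1 + t 2 - t 3) / 4, (t 0 - t 1 - t 2 + t 3) / 4, ?_⟩
    ext i; fin_cases i <;> simp [Matrix.vecHead, Matrix.vecTail] <;> ring
  · exact ⟨1, 0, 0, by ext i; fin_cases i <;> simp⟩

/-- The point `(u, 1, u² - α)` of the pencil `x² - yz = α W`, `y² = W`, `z² = W`. -/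
theorem cAlgIs_of_generator_S' {C : Type*} [CommRing C] [Algebra k C]
    (hC : Module.finrank k C = 4) {α : k} {u : C} (hu : (u ^ 2 - α • 1) ^ 2 = 1)
    (hs : ∀ t : C, ∃ c₀ c₁ c₂ c₃ : k, t = c₀ • 1 + c₁ • u + c₂ • u ^ 2 + c₃ • u ^ 3) :
    CAlgIs (relE 1 0) (diagForm α 1 1) C := by
  refine cAlgIs_of_point (by simp) hC ![u, 1, u ^ 2 - α • 1] (W := 1) isUnit_one ?_ ?_ ?_
    (Equiv.swap 0 1) rfl ?_ ?_
  · simp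
  · simp
  · simpa using hu
  · intro t
    obtain ⟨c₀, c₁, c₂, c₃, rfl⟩ := hs t
    refine ⟨c₀ + c₂ * α, c₁ + c₃ * α, c₂, c₃, ?_⟩
    change _ = _ + _ • u + _ • (u ^ 2 - α • 1) + _ • (u * (u ^ 2 - α • 1))
    simp only [Algebra.smul_def, map_add, map_mul]
    ring
  · exact ⟨1, 0, 0, by simpa [Equiv.swap_apply_of_ne_of_ne] using hu⟩

/-- The point `(u² - β, u, 1)` of the pencil `x² - yz = α W`, `y² - xz = β W`, `z² = W`. -/
theorem cAlgIs_of_generator_N {C : Type*} [CommRing C] [Algebra k C]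
    (hC : Module.finrank k C = 4) {α β : k} {u : C} (hu : (u ^ 2 - β • 1) ^ 2 = u + α • 1)
    (hs : ∀ t : C, ∃ c₀ c₁ c₂ c₃ : k, t = c₀ • 1 + c₁ • u + c₂ • u ^ 2 + c₃ • u ^ 3) :
    CAlgIs (relE 1 1) (diagForm α β 1) C := by
  refine cAlgIs_of_point (by simp) hC ![u ^ 2 - β • 1, u, 1] (W := 1) isUnit_one ?_ ?_ ?_
    (Equiv.swap 0 2) rfl ?_ ?_
  · simp [hu]
  · simp
  · simp
  · intro t
    obtain ⟨c₀, c₁, c₂, c₃, rfl⟩ := hs t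
    refine ⟨c₀ + c₂ * β, c₁ + c₃ * β, c₂, c₃, ?_⟩
    change _ = _ + _ • u + _ • (u ^ 2 - β • 1) + _ • (u * (u ^ 2 - β • 1))
    simp only [Algebra.smul_def, map_add, map_mul]
    ring
  · exact ⟨α, 1, 0, by simp [Equiv.swap_apply_of_ne_of_ne, hu, add_comm]⟩

theorem cAlgIs_quartic (α β : k) :
    CAlgIs (relE 1 1) (diagForm α β 1) (Polynomial k ⧸ Ideal.span {quartic α β}) := by
  obtain ⟨hdeg, hmon⟩ := quartic_natDegree_and_monic α β
  have hq : Ideal.Quotient.mk (Ideal.span {quartic α β})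
      ((Polynomial.X ^ 2 - β • 1) ^ 2 - (Polynomial.X + α • 1)) = 0 := by
    rw [← mk_self_eq_zero (quartic α β)]
    congr 1
    simp only [quartic, Algebra.smul_def, ← Polynomial.C_eq_algebraMap, map_mul, map_pow, map_ofNat]
    ring
  exact cAlgIs_of_generator_N (by rw [finrank_quotient_span_eq_natDegree, hdeg])
    (sub_eq_zero.mp hq) (exists_eq_of_monic_quartic hmon hdeg)

open Polynomial in
theorem cAlgIs_S'_quartic [IsAlgClosed k] (α : k) :
    ∃ s t : k, s ^ 2 = α + 1 ∧ t ^ 2 = α - 1 ∧ CAlgIs (relE 1 0) (diagForm α 1 1)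
      (k[X] ⧸ Ideal.span {(X - C s) * (X - C (-s)) * (X - C t) * (X - C (-t))}) := by
  obtain ⟨s, hs⟩ := IsAlgClosed.exists_pow_nat_eq (α + 1) two_pos
  obtain ⟨t, ht⟩ := IsAlgClosed.exists_pow_nat_eq (α - 1) two_pos
  refine ⟨s, t, hs, ht, ?_⟩
  have hmon : ((X - C s) * (X - C (-s)) * (X - C t) * (X - C (-t))).Monic := by
    monicity!
  have hdeg : ((X - C s) * (X - C (-s)) * (X - C t) * (X - C (-t))).natDegree = 4 := by
    compute_degree!
  have hq : Ideal.Quotient.mk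
      (Ideal.span {(X - C s) * (X - C (-s)) * (X - C t) * (X - C (-t))})
      ((X ^ 2 - α • 1) ^ 2 - 1) = 0 := by
    rw [← mk_self_eq_zero ((X - C s) * (X - C (-s)) * (X - C t) * (X - C (-t)))]
    congr 1
    have hs' := congrArg (C : k → k[X]) hs
    have ht' := congrArg (C : k → k[X]) ht
    simp only [map_pow, map_add, map_sub, map_one] at hs' ht'
    simp only [Algebra.smul_def, ← Polynomial.C_eq_algebraMap, map_neg]
    linear_combination (X ^ 2 - C t ^ 2) * hs' + (X ^ 2 - C α - 1) * ht'
  exact cAlgIs_of_generator_S' (by rw [finrank_quotient_span_eq_natDegree, hdeg])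
    (sub_eq_zero.mp hq) (exists_eq_of_monic_quartic hmon hdeg)

theorem cAlgIs_S'_double [IsAlgClosed k] [CharZero k] {α : k} (hα : α = 1 ∨ α = -1) :
    CAlgIs (relE 1 0) (diagForm α 1 1) (Trunc1 k 2 × (Fin 2 → k)) := by
  obtain ⟨s, t, hs, ht, h⟩ := cAlgIs_S'_quartic α
  rw [cAlgIs_iff h]
  rcases hα with rfl | rfl
  · have ht0 : t = 0 := by simpa using ht
    have hs0 : s ≠ 0 := by rintro rfl; norm_num at hs
    subst ht0
    exact quot_equiv_of_double (a := 0) (b := s) (c := -s) hs0.symm (by simpa using hs0)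
      (by simpa [self_eq_neg] using hs0) (by rw [neg_zero]; ring)
  · have hs0 : s = 0 := by simpa using hs
    have ht0 : t ≠ 0 := by rintro rfl; norm_num at ht
    subst hs0
    exact quot_equiv_of_double (a := 0) (b := t) (c := -t) ht0.symm (by simpa using ht0)
      (by simpa [self_eq_neg] using ht0) (by rw [neg_zero]; ring)

theorem cAlgIs_S'_distinct [IsAlgClosed k] [CharZero k] {α : k} (h1 : α ≠ 1) (h2 : α ≠ -1) :
    CAlgIs (relE 1 0) (diagForm α 1 1) (Fin 4 → k) := by
  obtain ⟨s, t, hs, ht, h⟩ := cAlgIs_S'_quartic α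
  rw [cAlgIs_iff h]
  have hs0 : s ≠ 0 := by rintro rfl; exact h2 (by linear_combination -hs)
  have ht0 : t ≠ 0 := by rintro rfl; exact h1 (by linear_combination -ht)
  have hne : s ^ 2 ≠ t ^ 2 := by
    rw [hs, ht]
    intro h
    exact two_ne_zero (α := k) (by linear_combination h)
  refine quot_equiv_of_distinct ?_ ?_ ?_ ?_ ?_ ?_ rfl
  · simpa [self_eq_neg] using hs0
  · rintro rfl; exact hne rfl
  · rintro rfl; exact hne (by ring)
  · rintro rfl; exact hne (by ring)
  · intro e; exact hne (by rw [← neg_sq s, e, neg_sq])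
  · simpa [self_eq_neg] using ht0

end Table

/-! ### Presentations of the dual algebras -/

section Presentations

open MvPolynomial

variable {k : Type*} [Field k]

theorem dualIs_sq_sq (ε : k) : DualIs (relE ε 0) (diagForm 1 0 0) {X 1 ^ 2, X 2 ^ 2} := by
  refine dualIs_of_relations ⟨X 0 ^ 2 - C ε * (X 1 * X 2), ?_, ?_, ?_⟩ (by simp) ?_
  · simp
  · simpa using Ideal.subset_span (by simp)
  · simpa using Ideal.subset_span (by simp)
  · rintro D _ _ p W - h1 h2 q (rfl | rfl)
    · simpa using h1
    · simpa using h2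

theorem dualIs_diag_one_zero (ε ε' α : k) : DualIs (relE ε ε') (diagForm α 1 0)
    {X 0 ^ 2 - C ε * (X 1 * X 2) - C α * (X 1 ^ 2 - C ε' * (X 0 * X 2)), X 2 ^ 2} := by
  refine dualIs_of_relations ⟨X 1 ^ 2 - C ε' * (X 0 * X 2), ?_, ?_, ?_⟩ (by simp) ?_
  · exact Ideal.subset_span (by simp)
  · simp
  · simpa using Ideal.subset_span (by simp)
  · rintro D _ _ p W h0 h1 h2 q (rfl | rfl)
    · rw [one_smul] at h1
      simp [← Algebra.smul_def, h0, h1]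
    · simpa using h2

theorem dualIs_diag_one (ε ε' α β : k) : DualIs (relE ε ε') (diagForm α β 1)
    {X 0 ^ 2 - C ε * (X 1 * X 2) - C α * X 2 ^ 2,
      X 1 ^ 2 - C ε' * (X 0 * X 2) - C β * X 2 ^ 2} := by
  refine dualIs_of_relations ⟨X 2 ^ 2, ?_, ?_, ?_⟩ (by simp) ?_
  · exact Ideal.subset_span (by simp)
  · exact Ideal.subset_span (by simp)
  · simp
  · rintro D _ _ p W h0 h1 h2 q (rfl | rfl)
    · rw [one_smul] at h2
      simp [← Algebra.smul_def, h0, h2]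
    · rw [one_smul] at h2
      simp [← Algebra.smul_def, h1, h2]

theorem DualIs.congr {R : Submodule k ((Fin 3 → k) ⊗[k] (Fin 3 → k))}
    {f : (Fin 3 → k) ⊗[k] (Fin 3 → k)} {J J' : Set (MvPolynomial (Fin 3) k)} (h : DualIs R f J)
    (hJ : Ideal.span J = Ideal.span J') : DualIs R f J' := by
  obtain ⟨e, he⟩ := h
  exact ⟨e.trans (Ideal.quotientEquivAlgOfEq k hJ), fun i => by rw [AlgEquiv.trans_apply, he]; rfl⟩

end Presentations

/-! ### Central elements of degree two, and automorphisms -/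

noncomputable section Normal

variable {k : Type*} [Field k]

/-- The coefficient of `x_i ⊗ x_j` in an element of `V ⊗ V`. -/
def coeff2 (r : (Fin 3 → k) ⊗[k] (Fin 3 → k)) (i j : Fin 3) : k :=
  TensorProduct.dualDistrib k (Fin 3 → k) (Fin 3 → k)
    ((LinearMap.proj i : (Fin 3 → k) →ₗ[k] k) ⊗ₜ (LinearMap.proj j : (Fin 3 → k) →ₗ[k] k)) r

theorem eq_sum_coeff2 (r : (Fin 3 → k) ⊗[k] (Fin 3 → k)) :
    r = ∑ i, ∑ j, coeff2 r i j • (bas k i ⊗ₜ[k] bas k j) := by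
  induction r with
  | zero => simp [coeff2]
  | add r s hr hs =>
    simp only [coeff2, map_add] at hr hs ⊢
    simp only [add_smul, Finset.sum_add_distrib, ← hr, ← hs]
  | tmul v w =>
    have hv : ∀ v : Fin 3 → k, v = ∑ i, v i • bas k i := fun v => by
      ext j; simp [bas, Pi.single_apply]
    conv_lhs => rw [hv v, hv w]
    simp only [TensorProduct.sum_tmul, TensorProduct.tmul_sum, TensorProduct.smul_tmul_smul]
    rw [Finset.sum_comm]
    simp [coeff2]

theorem relE_mem₀ (ε ε' : k) :
    bas k 1 ⊗ₜ bas k 2 + bas k 2 ⊗ₜ bas k 1 + ε • (bas k 0 ⊗ₜ bas k 0) ∈ relE ε ε' :=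
  relE_eq_span ε ε' ▸ Submodule.subset_span (by simp)

theorem relE_mem₁ (ε ε' : k) :
    bas k 2 ⊗ₜ bas k 0 + bas k 0 ⊗ₜ bas k 2 + ε' • (bas k 1 ⊗ₜ bas k 1) ∈ relE ε ε' :=
  relE_eq_span ε ε' ▸ Submodule.subset_span (by simp)

theorem relE_mem₂ (ε ε' : k) : bas k 0 ⊗ₜ bas k 1 + bas k 1 ⊗ₜ bas k 0 ∈ relE ε ε' :=
  relE_eq_span ε ε' ▸ Submodule.subset_span (by simp)

/-- Generators of `M₂(k)` that satisfy the relations of `D(ω_S + ε x³ + ε' y³)`: the first two have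
square one and anticommute, and the third is an anticommuting one, corrected by multiples of
them. -/
def matGen (ε ε' : k) : Fin 3 → Matrix (Fin 2) (Fin 2) k :=
  ![!![1, 0; 0, -1], !![0, 1; 1, 0], !![-(ε' / 2), 1 - ε / 2; -1 - ε / 2, ε' / 2]]

theorem exists_matrix_rep [CharZero k] (ε ε' : k) :
    ∃ Φ : QuadAlg (relE ε ε') →ₐ[k] Matrix (Fin 2) (Fin 2) k,
      (∀ i, Φ (quadGen _ (bas k i)) = matGen ε ε' i) ∧
      ∀ r, Φ (quadTwo _ r) = ∑ i, ∑ j, coeff2 r i j • (matGen ε ε' i * matGen ε ε' j) := by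
  let g : (Fin 3 → k) →ₗ[k] Matrix (Fin 2) (Fin 2) k := Fintype.linearCombination k (matGen ε ε')
  have hg : ∀ i, g (bas k i) = matGen ε ε' i := fun i => by
    simp [g, Fintype.linearCombination_apply, bas, Pi.single_apply]
  have hR : ∀ r ∈ relE ε ε', quadEval g r = 0 := by
    intro r hr
    rw [relE_eq_span] at hr
    induction hr using Submodule.span_induction with
    | mem t ht =>
      obtain rfl | rfl | rfl := ht
      · simp only [map_add, map_smul, quadEval_tmul, hg]
        ext i j
        fin_cases i <;> fin_cases j <;> simp [matGen] <;> ring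
      · simp only [map_add, map_smul, quadEval_tmul, hg]
        ext i j
        fin_cases i <;> fin_cases j <;> simp [matGen] <;> ring
      · simp only [map_add, quadEval_tmul, hg]
        ext i j
        fin_cases i <;> fin_cases j <;> simp [matGen]
    | zero => simp
    | add a b _ _ ha hb => rw [map_add, ha, hb, add_zero]
    | smul c a _ ha => rw [map_smul, ha, smul_zero]
  refine ⟨quadLift _ g hR, fun i => by rw [quadLift_quadGen, hg], fun r => ?_⟩
  rw [quadLift_quadTwo]
  conv_lhs => rw [eq_sum_coeff2 r]
  simp [hg]

/-- The central elements of degree two are the combinations of `x²`, `y²` and `z²`: the image in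
`M₂(k)` of any other one does not commute with the generators. -/
theorem exists_diagForm_of_central [CharZero k] {ε ε' : k} {f : (Fin 3 → k) ⊗[k] (Fin 3 → k)}
    (hf : quadTwo (relE ε ε') f ∈ Subring.center (QuadAlg (relE ε ε'))) :
    ∃ a b c : k, f - diagForm a b c ∈ relE ε ε' := by
  obtain ⟨Φ, hΦ, hΦ2⟩ := exists_matrix_rep ε ε'
  have hcomm : ∀ i, Φ (quadTwo _ f) * matGen ε ε' i = matGen ε ε' i * Φ (quadTwo _ f) := by
    intro i
    rw [← hΦ, ← map_mul, ← map_mul, Subring.mem_center_iff.mp hf]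
  rw [hΦ2] at hcomm
  have e0 := hcomm 0
  have e1 := hcomm 1
  simp only [Fin.sum_univ_three] at e0 e1
  have e001 := congrFun (congrFun e0 0) 1
  have e010 := congrFun (congrFun e0 1) 0
  have e100 := congrFun (congrFun e1 0) 0
  have e101 := congrFun (congrFun e1 0) 1
  simp [matGen] at e001 e010 e100 e101
  have s12 : coeff2 f 1 2 = coeff2 f 2 1 := by
    linear_combination (-1 / 2 : k) * e101
  have s02 : coeff2 f 0 2 = coeff2 f 2 0 := by
    linear_combination (1 / 4 : k) * (e010 - e001)
  have s01 : coeff2 f 0 1 = coeff2 f 1 0 := by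
    linear_combination (-1 / 2 : k) * e001 - (1 - ε / 2) * s02 - ε' / 2 * s12
  refine ⟨coeff2 f 0 0 - ε * coeff2 f 1 2, coeff2 f 1 1 - ε' * coeff2 f 0 2, coeff2 f 2 2, ?_⟩
  have hsum := eq_sum_coeff2 f
  simp only [Fin.sum_univ_three, ← s12, ← s02, ← s01] at hsum
  have : f - diagForm (coeff2 f 0 0 - ε * coeff2 f 1 2) (coeff2 f 1 1 - ε' * coeff2 f 0 2)
      (coeff2 f 2 2) =
      coeff2 f 1 2 • (bas k 1 ⊗ₜ bas k 2 + bas k 2 ⊗ₜ bas k 1 + ε • (bas k 0 ⊗ₜ bas k 0)) +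
      coeff2 f 0 2 • (bas k 2 ⊗ₜ bas k 0 + bas k 0 ⊗ₜ bas k 2 + ε' • (bas k 1 ⊗ₜ bas k 1)) +
      coeff2 f 0 1 • (bas k 0 ⊗ₜ bas k 1 + bas k 1 ⊗ₜ bas k 0) := by
    conv_lhs => lhs; rw [hsum]
    rw [diagForm]
    module
  rw [this]
  exact add_mem (add_mem (Submodule.smul_mem _ _ (relE_mem₀ _ _))
    (Submodule.smul_mem _ _ (relE_mem₁ _ _))) (Submodule.smul_mem _ _ (relE_mem₂ _ _))

theorem exists_diagForm_of_isCentralRegular [CharZero k] {ε ε' : k}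
    {f : (Fin 3 → k) ⊗[k] (Fin 3 → k)} (hf : IsCentralRegular (relE ε ε') f) :
    ∃ a b c : k, ¬ (a = 0 ∧ b = 0 ∧ c = 0) ∧ f - diagForm a b c ∈ relE ε ε' := by
  obtain ⟨a, b, c, h⟩ := exists_diagForm_of_central hf.1
  refine ⟨a, b, c, ?_, h⟩
  rintro ⟨rfl, rfl, rfl⟩
  have h0 : quadTwo (relE ε ε') f = 0 := quadTwo_eq_zero _ (by simpa [diagForm] using h)
  have h1 : (1 : QuadAlg (relE ε ε')) = 0 := hf.2.left (by simp [h0])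
  obtain ⟨Φ, -, -⟩ := exists_matrix_rep ε ε'
  have h2 := congrArg Φ h1
  rw [map_one, map_zero] at h2
  exact one_ne_zero h2

/-- The linear automorphism of `V` that maps `x_i` to `l i • x_(σ i)`. -/
def monomialEquiv (σ : Equiv.Perm (Fin 3)) (l : Fin 3 → kˣ) : (Fin 3 → k) ≃ₗ[k] (Fin 3 → k) :=
  (LinearEquiv.piCongrRight fun i => LinearEquiv.smulOfUnit (l i)).trans
    (LinearEquiv.funCongrLeft k k σ.symm)

theorem monomialEquiv_bas (σ : Equiv.Perm (Fin 3)) (l : Fin 3 → kˣ) (i : Fin 3) :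
    monomialEquiv σ l (bas k i) = (l i : k) • bas k (σ i) := by
  ext j
  simp [monomialEquiv, LinearEquiv.smulOfUnit, bas, Pi.single_apply, Equiv.symm_apply_eq,
    Units.smul_def, LinearMap.funLeft]
  split_ifs with h
  · rw [h, Equiv.symm_apply_apply]
  · rfl

/-- For an injective `T ⊗ T` it is enough to check that the relations are mapped into
themselves. -/
theorem isPairMap_of_le {R : Submodule k ((Fin 3 → k) ⊗[k] (Fin 3 → k))}
    {f f' : (Fin 3 → k) ⊗[k] (Fin 3 → k)} (T : (Fin 3 → k) ≃ₗ[k] (Fin 3 → k))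
    (h : R ≤ R.comap (TensorProduct.congr T T).toLinearMap)
    (hf : TensorProduct.congr T T f - f' ∈ R) : IsPairMap R R f f' T := by
  refine ⟨fun r => ⟨fun hr => ?_, fun hr => h hr⟩, hf⟩
  have h1 : R.map (TensorProduct.congr T T).toLinearMap = R :=
    Submodule.eq_of_le_of_finrank_eq (Submodule.map_le_iff_le_comap.mpr h)
      (LinearEquiv.finrank_map_eq _ _)
  rw [← h1] at hr
  obtain ⟨s, hs, hsr⟩ := hr
  rwa [← (TensorProduct.congr T T).injective hsr]

theorem isPairMap_refl {V : Type*} [AddCommGroup V] [Module k V] {R : Submodule k (V ⊗[k] V)}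
    {f f' : V ⊗[k] V} (h : f - f' ∈ R) : IsPairMap R R f f' (LinearEquiv.refl k V) := by
  have h1 : ∀ r : V ⊗[k] V,
      TensorProduct.congr (LinearEquiv.refl k V) (LinearEquiv.refl k V) r = r := by
    intro r
    simp
  exact ⟨fun r => by rw [h1], by rwa [h1]⟩

/-- The elements `f` and `g` of `V ⊗ V` are conjugate modulo `R` under a linear automorphism that
preserves `R`. -/
def AreConjugate {V : Type*} [AddCommGroup V] [Module k V] (R : Submodule k (V ⊗[k] V))
    (f g : V ⊗[k] V) : Prop :=
  ∃ T, IsPairMap R R f g T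

theorem AreConjugate.trans {V : Type*} [AddCommGroup V] [Module k V] {R : Submodule k (V ⊗[k] V)}
    {f g h : V ⊗[k] V} (hfg : AreConjugate R f g) (hgh : AreConjugate R g h) :
    AreConjugate R f h := by
  obtain ⟨T, hT⟩ := hfg
  obtain ⟨T', hT'⟩ := hgh
  exact ⟨_, hT.trans hT'⟩

/-- Rescaling the variables by `(p, q, r)` is an automorphism if `ε q r = ε p²`
and `ε' p r = ε' q²`. -/
theorem areConjugate_scale {ε ε' : k} (a b c p q r : k) (hp : p ≠ 0) (hq : q ≠ 0) (hr : r ≠ 0)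
    (h0 : ε * (q * r) = ε * p ^ 2) (h1 : ε' * (p * r) = ε' * q ^ 2) :
    AreConjugate (relE ε ε') (diagForm a b c)
      (diagForm (a * p ^ 2) (b * q ^ 2) (c * r ^ 2)) := by
  let T := monomialEquiv 1 ![Units.mk0 p hp, Units.mk0 q hq, Units.mk0 r hr]
  have t0 : T (bas k 0) = p • bas k 0 := monomialEquiv_bas _ _ _
  have t1 : T (bas k 1) = q • bas k 1 := monomialEquiv_bas _ _ _
  have t2 : T (bas k 2) = r • bas k 2 := monomialEquiv_bas _ _ _
  refine ⟨T, isPairMap_of_le _ ?_ ?_⟩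
  · conv_lhs => rw [relE_eq_span]
    rw [Submodule.span_le]
    rintro _ (rfl | rfl | rfl)
    · have := Submodule.smul_mem _ (q * r) (relE_mem₀ ε ε')
      simp only [SetLike.mem_coe, Submodule.mem_comap, LinearEquiv.coe_coe, map_add, map_smul,
        TensorProduct.congr_tmul, t0, t1, t2, TensorProduct.smul_tmul_smul]
      convert this using 1
      simp only [smul_add, smul_smul, mul_comm _ ε, h0, pow_two, mul_comm r q]
    · have := Submodule.smul_mem _ (p * r) (relE_mem₁ ε ε')
      simp only [SetLike.mem_coe, Submodule.mem_comap, LinearEquiv.coe_coe, map_add, map_smul,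
        TensorProduct.congr_tmul, t0, t1, t2, TensorProduct.smul_tmul_smul]
      convert this using 1
      simp only [smul_add, smul_smul, mul_comm _ ε', h1, pow_two, mul_comm r p]
    · have := Submodule.smul_mem _ (p * q) (relE_mem₂ ε ε')
      simp only [SetLike.mem_coe, Submodule.mem_comap, LinearEquiv.coe_coe, map_add,
        TensorProduct.congr_tmul, t0, t1, TensorProduct.smul_tmul_smul]
      convert this using 1
      simp only [smul_add, mul_comm q p]
  · have : TensorProduct.congr T T (diagForm a b c) =
        diagForm (a * p ^ 2) (b * q ^ 2) (c * r ^ 2) := by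
      simp only [diagForm, map_add, map_smul, TensorProduct.congr_tmul, t0, t1, t2,
        TensorProduct.smul_tmul_smul, smul_smul, pow_two]
    rw [this, sub_self]
    exact zero_mem _

/-- `x ↔ y` is an automorphism for `ε = ε'`. -/
theorem areConjugate_swap_xy (ε a b c : k) :
    AreConjugate (relE ε ε) (diagForm a b c) (diagForm b a c) := by
  let T := monomialEquiv (k := k) (Equiv.swap 0 1) 1
  have t0 : T (bas k 0) = bas k 1 := (monomialEquiv_bas _ _ _).trans (one_smul _ _)
  have t1 : T (bas k 1) = bas k 0 := (monomialEquiv_bas _ _ _).trans (one_smul _ _)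
  have t2 : T (bas k 2) = bas k 2 := (monomialEquiv_bas _ _ _).trans (one_smul _ _)
  refine ⟨T, isPairMap_of_le _ ?_ ?_⟩
  · conv_lhs => rw [relE_eq_span]
    rw [Submodule.span_le]
    rintro _ (rfl | rfl | rfl) <;>
      simp only [SetLike.mem_coe, Submodule.mem_comap, LinearEquiv.coe_coe, map_add, map_smul,
        TensorProduct.congr_tmul, t0, t1, t2]
    · convert relE_mem₁ ε ε using 2
      exact add_comm _ _
    · convert relE_mem₀ ε ε using 2
      exact add_comm _ _
    · convert relE_mem₂ ε ε using 1
      exact add_comm _ _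
  · have : TensorProduct.congr T T (diagForm a b c) - diagForm b a c = 0 := by
      simp only [diagForm, map_add, map_smul, TensorProduct.congr_tmul, t0, t1, t2]
      abel
    rw [this]
    exact zero_mem _

/-- `y ↔ z` is an automorphism for `ε' = 0`. -/
theorem areConjugate_swap_yz (ε a b c : k) :
    AreConjugate (relE ε 0) (diagForm a b c) (diagForm a c b) := by
  let T := monomialEquiv (k := k) (Equiv.swap 1 2) 1
  have t0 : T (bas k 0) = bas k 0 := (monomialEquiv_bas _ _ _).trans (one_smul _ _)
  have t1 : T (bas k 1) = bas k 2 := (monomialEquiv_bas _ _ _).trans (one_smul _ _)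
  have t2 : T (bas k 2) = bas k 1 := (monomialEquiv_bas _ _ _).trans (one_smul _ _)
  refine ⟨T, isPairMap_of_le _ ?_ ?_⟩
  · conv_lhs => rw [relE_eq_span]
    rw [Submodule.span_le]
    rintro _ (rfl | rfl | rfl) <;>
      simp only [SetLike.mem_coe, Submodule.mem_comap, LinearEquiv.coe_coe, map_add, map_smul,
        TensorProduct.congr_tmul, t0, t1, t2]
    · convert relE_mem₀ ε 0 using 2
      exact add_comm _ _
    · convert relE_mem₂ ε 0 using 1
      rw [zero_smul, add_zero, add_comm]
    · convert relE_mem₁ ε 0 using 1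
      rw [zero_smul, add_zero, add_comm]
  · have : TensorProduct.congr T T (diagForm a b c) - diagForm a c b = 0 := by
      simp only [diagForm, map_add, map_smul, TensorProduct.congr_tmul, t0, t1, t2]
      abel
    rw [this]
    exact zero_mem _

end Normal

/-! ### Normal forms of central elements -/

theorem span_pair_eq {A : Type*} [CommRing A] {p q r s : A} (hr : ∃ a b, a * p + b * q = r)
    (hs : ∃ a b, a * p + b * q = s) (hp : ∃ a b, a * r + b * s = p)
    (hq : ∃ a b, a * r + b * s = q) : Ideal.span {p, q} = Ideal.span {r, s} := by
  apply le_antisymm <;> rw [Ideal.span_le] <;> rintro _ (rfl | rfl) <;>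
    rw [SetLike.mem_coe, Ideal.mem_span_pair]
  exacts [hp, hq, hr, hs]

section NormalForms

variable {k : Type*} [Field k]

variable [IsAlgClosed k]

theorem exists_mul_sq_eq_one {a : k} (ha : a ≠ 0) : ∃ p : k, p ≠ 0 ∧ a * p ^ 2 = 1 := by
  obtain ⟨p, hp⟩ := IsAlgClosed.exists_pow_nat_eq a⁻¹ two_pos
  refine ⟨p, ?_, by rw [hp, mul_inv_cancel₀ ha]⟩
  rintro rfl
  exact inv_ne_zero ha (by rw [← hp]; ring)

theorem exists_mul_sq_eq_zero_or_one (a : k) :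
    ∃ p : k, p ≠ 0 ∧ (a * p ^ 2 = 1 ∨ a = 0 ∧ a * p ^ 2 = 0) := by
  by_cases ha : a = 0
  · exact ⟨1, one_ne_zero, Or.inr ⟨ha, by simp [ha]⟩⟩
  · obtain ⟨p, hp, h⟩ := exists_mul_sq_eq_one ha
    exact ⟨p, hp, Or.inl h⟩

theorem areConjugate_normalForm_S {a b c : k} (h : ¬ (a = 0 ∧ b = 0 ∧ c = 0)) :
    AreConjugate (relE 0 0) (diagForm a b c) (diagForm 1 0 0) ∨
    AreConjugate (relE 0 0) (diagForm a b c) (diagForm 1 1 0) ∨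
    AreConjugate (relE 0 0) (diagForm a b c) (diagForm 1 1 1) := by
  obtain ⟨p, hp, hap⟩ := exists_mul_sq_eq_zero_or_one a
  obtain ⟨q, hq, hbq⟩ := exists_mul_sq_eq_zero_or_one b
  obtain ⟨r, hr, hcr⟩ := exists_mul_sq_eq_zero_or_one c
  have hs : AreConjugate (relE 0 0) (diagForm a b c)
      (diagForm (a * p ^ 2) (b * q ^ 2) (c * r ^ 2)) :=
    areConjugate_scale a b c p q r hp hq hr (by ring) (by ring)
  have hxy : ∀ a b c : k, AreConjugate (relE 0 0) (diagForm a b c) (diagForm b a c) :=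
    areConjugate_swap_xy 0
  have hyz : ∀ a b c : k, AreConjugate (relE 0 0) (diagForm a b c) (diagForm a c b) :=
    areConjugate_swap_yz 0
  rcases hap with ha | ⟨ha0, ha⟩ <;> rcases hbq with hb | ⟨hb0, hb⟩ <;>
    rcases hcr with hc | ⟨hc0, hc⟩ <;> rw [ha, hb, hc] at hs
  · exact Or.inr (Or.inr hs)
  · exact Or.inr (Or.inl hs)
  · exact Or.inr (Or.inl (hs.trans (hyz _ _ _)))
  · exact Or.inl hs
  · exact Or.inr (Or.inl ((hs.trans (hxy _ _ _)).trans (hyz _ _ _)))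
  · exact Or.inl (hs.trans (hxy _ _ _))
  · exact Or.inl ((hs.trans (hyz _ _ _)).trans (hxy _ _ _))
  · exact absurd ⟨ha0, hb0, hc0⟩ h

theorem areConjugate_normalForm_S'_of_z_eq_zero (a : k) {b : k} (hb : b ≠ 0) :
    AreConjugate (relE 1 0) (diagForm a b 0) (diagForm 0 1 0) ∨
    AreConjugate (relE 1 0) (diagForm a b 0) (diagForm 1 1 0) := by
  obtain ⟨q, hq, hbq⟩ := exists_mul_sq_eq_one hb
  obtain ⟨p, hp, hap⟩ := exists_mul_sq_eq_zero_or_one a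
  have hqr : (1 : k) * p ^ 2 = 1 * (q * (p ^ 2 / q)) := by
    rw [mul_div_cancel₀ _ hq]
  have hs : AreConjugate (relE 1 0) (diagForm a b 0)
      (diagForm (a * p ^ 2) (b * q ^ 2) (0 * (p ^ 2 / q) ^ 2)) :=
    areConjugate_scale a b 0 p q (p ^ 2 / q) hp hq (div_ne_zero (pow_ne_zero 2 hp) hq)
      (by linear_combination -hqr) (by ring)
  rw [hbq, zero_mul] at hs
  rcases hap with ha | ⟨-, ha⟩ <;> rw [ha] at hs
  · exact Or.inr hs
  · exact Or.inl hs

theorem areConjugate_normalForm_S'_of_ne_zero (a : k) {b c : k} (hb : b ≠ 0) (hc : c ≠ 0) :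
    ∃ α, AreConjugate (relE 1 0) (diagForm a b c) (diagForm α 1 1) := by
  obtain ⟨q, hq, hbq⟩ := exists_mul_sq_eq_one hb
  obtain ⟨r, hr, hcr⟩ := exists_mul_sq_eq_one hc
  obtain ⟨p, hp⟩ := IsAlgClosed.exists_pow_nat_eq (q * r) two_pos
  have hp0 : p ≠ 0 := by
    rintro rfl
    exact mul_ne_zero hq hr (by rw [← hp]; ring)
  have hs : AreConjugate (relE 1 0) (diagForm a b c)
      (diagForm (a * p ^ 2) (b * q ^ 2) (c * r ^ 2)) :=
    areConjugate_scale a b c p q r hp0 hq hr (by linear_combination -hp) (by ring)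
  rw [hbq, hcr] at hs
  exact ⟨_, hs⟩

theorem areConjugate_normalForm_S' {a b c : k} (h : ¬ (a = 0 ∧ b = 0 ∧ c = 0)) :
    AreConjugate (relE 1 0) (diagForm a b c) (diagForm 1 0 0) ∨
    AreConjugate (relE 1 0) (diagForm a b c) (diagForm 0 1 0) ∨
    AreConjugate (relE 1 0) (diagForm a b c) (diagForm 1 1 0) ∨
    ∃ α, AreConjugate (relE 1 0) (diagForm a b c) (diagForm α 1 1) := by
  by_cases hb : b = 0
  · subst hb
    by_cases hc : c = 0
    · subst hc
      have ha : a ≠ 0 := fun ha => h ⟨ha, rfl, rfl⟩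
      obtain ⟨p, hp, hap⟩ := exists_mul_sq_eq_one ha
      have hs : AreConjugate (relE 1 0) (diagForm a 0 0)
          (diagForm (a * p ^ 2) (0 * p ^ 2) (0 * p ^ 2)) :=
        areConjugate_scale a 0 0 p p p hp hp hp (by ring) (by ring)
      rw [hap, zero_mul] at hs
      exact Or.inl hs
    · have hs : AreConjugate (relE 1 0) (diagForm a 0 c) (diagForm a c 0) :=
        areConjugate_swap_yz 1 a 0 c
      exact Or.inr ((areConjugate_normalForm_S'_of_z_eq_zero a hc).imp hs.trans
        fun h => Or.inl (hs.trans h))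
  · by_cases hc : c = 0
    · subst hc
      exact Or.inr ((areConjugate_normalForm_S'_of_z_eq_zero a hb).imp_right Or.inl)
    · exact Or.inr (Or.inr (Or.inr (areConjugate_normalForm_S'_of_ne_zero a hb hc)))

theorem areConjugate_normalForm_N {a b c : k} (h : ¬ (a = 0 ∧ b = 0 ∧ c = 0)) :
    (∃ α, AreConjugate (relE 1 1) (diagForm a b c) (diagForm α 1 0)) ∨
    ∃ α β, AreConjugate (relE 1 1) (diagForm a b c) (diagForm α β 1) := by
  have hs : ∀ a b c p : k, p ≠ 0 → AreConjugate (relE 1 1) (diagForm a b c)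
      (diagForm (a * p ^ 2) (b * p ^ 2) (c * p ^ 2)) := fun a b c p hp =>
    areConjugate_scale a b c p p p hp hp hp (by ring) (by ring)
  have key : ∀ a b : k, b ≠ 0 →
      ∃ α, AreConjugate (relE 1 1) (diagForm a b 0) (diagForm α 1 0) := by
    intro a b hb
    obtain ⟨p, hp, hbp⟩ := exists_mul_sq_eq_one hb
    have := hs a b 0 p hp
    rw [hbp, zero_mul] at this
    exact ⟨_, this⟩
  by_cases hc : c = 0
  · subst hc
    by_cases hb : b = 0
    · have ha : a ≠ 0 := fun ha => h ⟨ha, hb, rfl⟩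
      have hxy : AreConjugate (relE 1 1) (diagForm a b 0) (diagForm b a 0) :=
        areConjugate_swap_xy 1 a b 0
      obtain ⟨α, hα⟩ := key b a ha
      exact Or.inl ⟨α, hxy.trans hα⟩
    · exact Or.inl (key a b hb)
  · obtain ⟨p, hp, hcp⟩ := exists_mul_sq_eq_one hc
    have := hs a b c p hp
    rw [hcp] at this
    exact Or.inr ⟨_, _, this⟩

end NormalForms

open MvPolynomial in
theorem theorem4p7 (k : Type*) [Field k] [IsAlgClosed k] [CharZero k] :
    -- Type S
    ((∀ f, IsCentralRegular (relS k) f →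
        ∃ g ∈ ({diagForm 1 0 0, diagForm 1 1 0, diagForm 1 1 1} : Set _),
          SameConic (relS k) (relS k) f g) ∧
      (DualIs (relS k) (diagForm 1 0 0) {X 1 ^ 2, X 2 ^ 2} ∧
        CAlgIs (relS k) (diagForm 1 0 0) (Trunc2 k)) ∧
      (DualIs (relS k) (diagForm 1 1 0) {X 0 ^ 2 - X 1 ^ 2, X 2 ^ 2} ∧
        CAlgIs (relS k) (diagForm 1 1 0) (Trunc1 k 2 × Trunc1 k 2)) ∧
      (DualIs (relS k) (diagForm 1 1 1) {X 0 ^ 2 - X 1 ^ 2, X 0 ^ 2 - X 2 ^ 2} ∧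
        CAlgIs (relS k) (diagForm 1 1 1) (Fin 4 → k))) ∧
    -- Type S'
    ((∀ f, IsCentralRegular (relS' k) f →
        ∃ g ∈ ({diagForm 1 0 0, diagForm 0 1 0, diagForm 1 1 0} ∪
            Set.range (fun α => diagForm α 1 1) : Set _),
          SameConic (relS' k) (relS' k) f g) ∧
      (DualIs (relS' k) (diagForm 1 0 0) {X 1 ^ 2, X 2 ^ 2} ∧
        CAlgIs (relS' k) (diagForm 1 0 0) (Trunc2 k)) ∧
      (DualIs (relS' k) (diagForm 0 1 0) {X 0 ^ 2 - X 1 * X 2, X 2 ^ 2} ∧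
        CAlgIs (relS' k) (diagForm 0 1 0) (Trunc1 k 4)) ∧
      (DualIs (relS' k) (diagForm 1 1 0) {X 0 ^ 2 - X 1 * X 2 - X 1 ^ 2, X 2 ^ 2} ∧
        CAlgIs (relS' k) (diagForm 1 1 0) (Trunc1 k 2 × Trunc1 k 2)) ∧
      (∀ α : k,
        DualIs (relS' k) (diagForm α 1 1)
          {X 1 ^ 2 - X 2 ^ 2, X 0 ^ 2 - X 1 * X 2 - C α * X 1 ^ 2} ∧
        (α = 1 ∨ α = -1 → CAlgIs (relS' k) (diagForm α 1 1) (Trunc1 k 2 × (Fin 2 → k))) ∧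
        (α ≠ 1 ∧ α ≠ -1 → CAlgIs (relS' k) (diagForm α 1 1) (Fin 4 → k)))) ∧
    -- Type NC
    ((∀ f, IsCentralRegular (relN k) f →
        ∃ g ∈ (Set.range (fun α => diagForm α 1 0) ∪
            Set.range (fun p : k × k => diagForm p.1 p.2 1) : Set _),
          SameConic (relN k) (relN k) f g) ∧
      (∀ α : k,
        DualIs (relN k) (diagForm α 1 0)
          {X 0 ^ 2 - X 1 * X 2 - C α * (X 1 ^ 2 - X 0 * X 2), X 2 ^ 2} ∧
        (α = 0 → CAlgIs (relN k) (diagForm α 1 0) (Trunc1 k 4)) ∧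
        (α ≠ 0 → CAlgIs (relN k) (diagForm α 1 0) (Trunc1 k 2 × Trunc1 k 2))) ∧
      (∀ α β : k,
        DualIs (relN k) (diagForm α β 1)
          {X 0 ^ 2 - X 1 * X 2 - C α * X 2 ^ 2, X 1 ^ 2 - X 0 * X 2 - C β * X 2 ^ 2} ∧
        CAlgIs (relN k) (diagForm α β 1) (Polynomial k ⧸ Ideal.span {quartic α β}) ∧
        (CAlgIs (relN k) (diagForm α β 1) (Fin 4 → k) ↔ discN α β ≠ 0) ∧
        (CAlgIs (relN k) (diagForm α β 1) (Trunc1 k 3 × k) ↔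
          ∃ μ : k, μ ^ 3 = 1 ∧ α = 3 / 4 * μ ∧ β = 3 / 4 * μ ^ 2) ∧
        (CAlgIs (relN k) (diagForm α β 1) (Trunc1 k 2 × (Fin 2 → k)) ↔
          discN α β = 0 ∧
            ¬ ∃ μ : k, μ ^ 3 = 1 ∧ α = 3 / 4 * μ ∧ β = 3 / 4 * μ ^ 2))) := by
  rw [relS_eq, relS'_eq, relN_eq]
  -- A central regular element is diagonal modulo the relations, so that only diagonal forms matter.
  have hdiag : ∀ (ε ε' : k) f, IsCentralRegular (relE ε ε') f → ∃ a b c : k,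
      ¬ (a = 0 ∧ b = 0 ∧ c = 0) ∧ AreConjugate (relE ε ε') f (diagForm a b c) := by
    intro ε ε' f hf
    obtain ⟨a, b, c, h, hfd⟩ := exists_diagForm_of_isCentralRegular hf
    exact ⟨a, b, c, h, _, isPairMap_refl hfd⟩
  have hS110 : CAlgIs (relE (0 : k) 0) (diagForm 1 1 0) (Trunc1 k 2 × Trunc1 k 2) :=
    cAlgIs_trunc1_two_prod 0 0 one_ne_zero
  have hS'110 : CAlgIs (relE (1 : k) 0) (diagForm 1 1 0) (Trunc1 k 2 × Trunc1 k 2) :=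
    cAlgIs_trunc1_two_prod 1 0 one_ne_zero
  have hN10 : ∀ α : k, (α = 0 → CAlgIs (relE 1 1) (diagForm α 1 0) (Trunc1 k 4)) ∧
      (α ≠ 0 → CAlgIs (relE 1 1) (diagForm α 1 0) (Trunc1 k 2 × Trunc1 k 2)) :=
    fun α => ⟨by rintro rfl; exact cAlgIs_trunc1_four 1, cAlgIs_trunc1_two_prod 1 1⟩
  refine ⟨⟨?_, ⟨dualIs_sq_sq 0, cAlgIs_trunc2 0⟩, ⟨?_, hS110⟩, ⟨?_, cAlgIs_pi_four⟩⟩,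
    ⟨?_, ⟨dualIs_sq_sq 1, cAlgIs_trunc2 1⟩, ⟨?_, cAlgIs_trunc1_four 0⟩, ⟨?_, hS'110⟩,
      fun α => ⟨?_, cAlgIs_S'_double, fun h => cAlgIs_S'_distinct h.1 h.2⟩⟩,
    ⟨?_, fun α => ⟨?_, hN10 α⟩, fun α β => ⟨?_, cAlgIs_quartic α β, ?_, ?_, ?_⟩⟩⟩
  · intro f hf
    obtain ⟨a, b, c, h, hfd⟩ := hdiag 0 0 f hf
    rcases areConjugate_normalForm_S h with h | h | h <;> obtain ⟨T, hT⟩ := hfd.trans h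
    · exact ⟨_, by simp, hT.sameConic (cAlgIs_trunc2 0)⟩
    · exact ⟨_, by simp, hT.sameConic hS110⟩
    · exact ⟨_, by simp, hT.sameConic cAlgIs_pi_four⟩
  · refine (dualIs_diag_one_zero 0 0 1).congr ?_
    simp
  · refine (dualIs_diag_one 0 0 1 1).congr ?_
    simp only [map_zero, zero_mul, sub_zero, map_one, one_mul]
    refine span_pair_eq ⟨1, -1, by ring⟩ ⟨1, 0, by ring⟩ ⟨0, 1, by ring⟩ ⟨-1, 1, by ring⟩
  · intro f hf
    obtain ⟨a, b, c, h, hfd⟩ := hdiag 1 0 f hf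
    rcases areConjugate_normalForm_S' h with h | h | h | ⟨α, h⟩ <;> obtain ⟨T, hT⟩ := hfd.trans h
    · exact ⟨_, by simp, hT.sameConic (cAlgIs_trunc2 1)⟩
    · exact ⟨_, by simp, hT.sameConic (cAlgIs_trunc1_four 0)⟩
    · exact ⟨_, by simp, hT.sameConic hS'110⟩
    · refine ⟨_, Or.inr ⟨α, rfl⟩, ?_⟩
      by_cases hα : α = 1 ∨ α = -1
      · exact hT.sameConic (cAlgIs_S'_double hα)
      · rw [not_or] at hα
        exact hT.sameConic (cAlgIs_S'_distinct hα.1 hα.2)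
  · refine (dualIs_diag_one_zero 1 0 0).congr ?_
    simp
  · refine (dualIs_diag_one_zero 1 0 1).congr ?_
    simp
  · refine (dualIs_diag_one 1 0 α 1).congr ?_
    simp only [map_zero, zero_mul, sub_zero, map_one, one_mul]
    refine span_pair_eq ⟨0, 1, by ring⟩ ⟨1, -C α, by ring⟩ ⟨C α, 1, by ring⟩ ⟨1, 0, by ring⟩
  · intro f hf
    obtain ⟨a, b, c, h, hfd⟩ := hdiag 1 1 f hf
    rcases areConjugate_normalForm_N h with ⟨α, h⟩ | ⟨α, β, h⟩ <;> obtain ⟨T, hT⟩ := hfd.trans h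
    · refine ⟨_, Or.inl ⟨α, rfl⟩, ?_⟩
      by_cases hα : α = 0
      · exact hT.sameConic ((hN10 α).1 hα)
      · exact hT.sameConic ((hN10 α).2 hα)
    · exact ⟨_, Or.inr ⟨(α, β), rfl⟩, hT.sameConic (cAlgIs_quartic α β)⟩
  · refine (dualIs_diag_one_zero 1 1 α).congr ?_
    simp
  · refine (dualIs_diag_one 1 1 α β).congr ?_
    simp
  · rw [cAlgIs_iff (cAlgIs_quartic α β), quot_quartic_equiv_pi_iff]
  · rw [cAlgIs_iff (cAlgIs_quartic α β), quot_quartic_equiv_triple_iff]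
  · rw [cAlgIs_iff (cAlgIs_quartic α β), quot_quartic_equiv_double_iff]
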